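/- A Petri game with good markings consists of a finite Petri net $\mathcal N=(\mathcal P,\mathcal T,\mathcal F,\mathit{In})$ whose places are partitioned into system places and environment places, together with a set $\mathcal M_G$ of reachable markings of $\mathcal N$, the good markings. A strategy for the system players is a branching process $\sigma=(\mathcal N^\sigma,\lambda^\sigma)$ of $\mathcal N$ (an occurrence net with an initial homomorphism $\lambda^\sigma$ to $\mathcal N$ that is injective on transitions with the same precondition) satisfying two conditions. Justified refusal: for every set $C$ of pairwise concurrent places of $\mathcal N^\sigma$ and every $t\in\mathcal T$ with $\lambda^\sigma[C]=\mathrm{pre}(t)$, either some transition $t'$ of $\mathcal N^\sigma$ has label $t$ and precondition $C$, or $C$ contains a place $p$ with a system label such that no transition in the postcondition of $p$ has label $t$. Determinism: for every reachable marking $M$ of $\mathcal N^\sigma$ and every $p\in M$ with a system label, at most one transition in the postcondition of $p$ is enabled in $M$. A play $\pi$ of $\sigma$ is a subprocess of $\sigma$ in which each place has at most one outgoing transition; it is maximal if every set of pairwise concurrent places of $\pi$ that is the precondition of a transition of $\sigma$ contains a place with an outgoing transition in $\pi$. The strategy $\sigma$ is winning if every finite or infinite firing sequence, starting in the initial marking,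 of a maximal play of $\sigma$ in which each transition of the play occurs visits a marking $M$ with $\lambda^\sigma[M]\in\mathcal M_G$. A Petri game has exactly $n$ players if its places can be assigned to $n$ players such that each player has exactly one token initially, every transition has a non-empty precondition, and every transition produces for each player as many tokens as it consumes from that player. A player is always an environment player if all its places are environment places. A player alternates between being a system player and an environment player if every transition it takes part in moves its token from an environment place to a system place or vice versa, and it is on a system place in some reachable marking and on an environment place in some reachable marking. Theorem. Let $n\ge 3$. For Petri games with good markings and exactly $n$ players, one of which is always an environment player while each of the other players alternates between being a system player and an environment player, it is undecidable whether the system players have a winning strategy: there is no algorithm that, given a finite description of such a game, halts and correctly answers whether a winning strategy exists (on inputs that are not such games the algorithm may behave arbitrarily). -/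

import Mathlib

namespace PetriGames

/-- A Petri net with place set `P` and transition set `T`. Multisets over `P` are given by
`Multiset P`; the flow relation is given through the pre- and postconditions of transitions:
`F(p, t)` and `F(t, p)` are the multiplicities of `p` in `pre t` and in `post t`. -/
structure PetriNet (P T : Type) where
  pre : T → Multiset P
  post : T → Multiset P
  init : Multiset P

namespace PetriNet

variable {P T : Type} (N : PetriNet P T)

/-- `t` is enabled in the marking `M`. -/
def Enabled (M : Multiset P) (t : T) : Prop := N.pre t ≤ M

/-- `M [t⟩ M'`: the transition `t` is enabled in `M` and `M' = M - pre t + post t`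
(`R` is the remainder `M - pre t`). -/
def Fires (M : Multiset P) (t : T) (M' : Multiset P) : Prop :=
  ∃ R : Multiset P, M = N.pre t + R ∧ M' = N.post t + R

/-- The reachable markings. -/
def Reachable (M : Multiset P) : Prop :=
  Relation.ReflTransGen (fun M₁ M₂ => ∃ t, N.Fires M₁ t M₂) N.init M

/-- The direct-predecessor relation `x ⋖ y` (that is, `x ∈ pre y`) on the nodes of the net. -/
def Flow : P ⊕ T → P ⊕ T → Prop
  | Sum.inl p, Sum.inr t => p ∈ N.pre t
  | Sum.inr t, Sum.inl p => p ∈ N.post t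
  | Sum.inl _, Sum.inl _ => False
  | Sum.inr _, Sum.inr _ => False

/-- Causal order: the reflexive transitive closure of `⋖`. -/
def CausalLE (x y : P ⊕ T) : Prop := Relation.ReflTransGen N.Flow x y

/-- Two nodes are in conflict. -/
def Conflict (x y : P ⊕ T) : Prop :=
  ∃ (p : P) (t₁ t₂ : T), t₁ ≠ t₂ ∧ p ∈ N.pre t₁ ∧ p ∈ N.pre t₂ ∧
    N.CausalLE (Sum.inr t₁) x ∧ N.CausalLE (Sum.inr t₂) y

/-- Two nodes are concurrent: neither causally related nor in conflict. -/
def Concurrent (x y : P ⊕ T) : Prop :=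
  ¬ (N.CausalLE x y ∨ N.CausalLE y x) ∧ ¬ N.Conflict x y

/-- The places in `C` are pairwise concurrent. -/
def PairwiseConcurrent (C : Finset P) : Prop :=
  ∀ p ∈ C, ∀ q ∈ C, p ≠ q → N.Concurrent (Sum.inl p) (Sum.inl q)

/-- Occurrence nets. -/
structure IsOccurrenceNet : Prop where
  pre_nodup : ∀ t, (N.pre t).Nodup
  post_nodup : ∀ t, (N.post t).Nodup
  init_nodup : N.init.Nodup
  mem_init_iff : ∀ p, p ∈ N.init ↔ ∀ t, p ∉ N.post t
  existsUnique_producer : ∀ p, p ∉ N.init → ∃! t, p ∈ N.post t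
  wellFounded_flow : WellFounded N.Flow
  no_self_conflict : ∀ t : T, ¬ N.Conflict (Sum.inr t) (Sum.inr t)

/-- A finite or infinite sequence of fired transitions from the initial marking, with the
markings visited. `step i = none` means that the sequence has ended before position `i`; from then
on the marking stays as it is. -/
structure FiringSequence where
  marking : ℕ → Multiset P
  step : ℕ → Option T
  marking_zero : marking 0 = N.init
  fires : ∀ i t, step i = some t → N.Fires (marking i) t (marking (i + 1))
  ended : ∀ i, step i = none → step (i + 1) = none ∧ marking (i + 1) = marking i

/-- A firing sequence is complete if every transition of the net occurs in it. -/
def FiringSequence.IsComplete {N : PetriNet P T} (s : N.FiringSequence) : Prop :=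
  ∀ t : T, ∃ i, s.step i = some t

end PetriNet

/-- A branching process of the net `N`: an occurrence net together with an initial homomorphism to
`N` (the labelling of its places and transitions) that is injective on transitions with the
same precondition. -/
structure BranchingProcess {P T : Type} (N : PetriNet P T) where
  Place : Type
  Trans : Type
  net : PetriNet Place Trans
  placeLabel : Place → P
  transLabel : Trans → T
  isOccurrenceNet : net.IsOccurrenceNet
  map_pre : ∀ t, (net.pre t).map placeLabel = N.pre (transLabel t)
  map_post : ∀ t, (net.post t).map placeLabel = N.post (transLabel t)
  map_init : net.init.map placeLabel = N.init
  trans_injective : ∀ t t', net.pre t = net.pre t' → transLabel t = transLabel t' → t = t'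

/-- A Petri game whose winning condition is a set of good markings. Places not in `system` are
environment places. -/
structure PetriGame (P T : Type) extends PetriNet P T where
  system : Set P
  good : Set (Multiset P)

section Strategies

variable {P T : Type} (G : PetriGame P T)

/-- Justified refusal: only system places can prohibit transitions, and they do so in every
situation alike. -/
def JustifiedRefusal (σ : BranchingProcess G.toPetriNet) : Prop :=
  ∀ (C : Finset σ.Place) (t : T), σ.net.PairwiseConcurrent C →
    C.val.map σ.placeLabel = G.pre t →
    (∃ t' : σ.Trans, σ.transLabel t' = t ∧ σ.net.pre t' = C.val) ∨
    (∃ p ∈ C, σ.placeLabel p ∈ G.system ∧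
      ∀ t' : σ.Trans, p ∈ σ.net.pre t' → σ.transLabel t' ≠ t)

/-- Determinism: in every reachable marking, every system place has at most one enabled outgoing
transition. -/
def Deterministic (σ : BranchingProcess G.toPetriNet) : Prop :=
  ∀ M, σ.net.Reachable M → ∀ p ∈ M, σ.placeLabel p ∈ G.system →
    ∀ t₁ t₂, p ∈ σ.net.pre t₁ → p ∈ σ.net.pre t₂ →
      σ.net.Enabled M t₁ → σ.net.Enabled M t₂ → t₁ = t₂

/-- A strategy for the system players. -/
structure IsStrategy (σ : BranchingProcess G.toPetriNet) : Prop where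
  justifiedRefusal : JustifiedRefusal G σ
  deterministic : Deterministic G σ

end Strategies

/-- A play of `σ`: a subprocess of `σ` in which every place has at most one outgoing transition.
The inclusion of the subprocess into `σ` is given by injective maps that form an initial
homomorphism and respect the labels. -/
structure Play {P T : Type} {N : PetriNet P T} (σ : BranchingProcess N) where
  proc : BranchingProcess N
  placeMap : proc.Place → σ.Place
  transMap : proc.Trans → σ.Trans
  placeMap_injective : Function.Injective placeMap
  transMap_injective : Function.Injective transMap
  placeLabel_map : ∀ p, σ.placeLabel (placeMap p) = proc.placeLabel p
  transLabel_map : ∀ t, σ.transLabel (transMap t) = proc.transLabel t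
  map_pre : ∀ t, (proc.net.pre t).map placeMap = σ.net.pre (transMap t)
  map_post : ∀ t, (proc.net.post t).map placeMap = σ.net.post (transMap t)
  map_init : proc.net.init.map placeMap = σ.net.init
  post_subsingleton : ∀ p t t', p ∈ proc.net.pre t → p ∈ proc.net.pre t' → t = t'

/-- A play is maximal if every set of pairwise concurrent places of the play that is the
precondition of a transition of the strategy has a place from which the play proceeds. -/
def Play.IsMaximal {P T : Type} {N : PetriNet P T} {σ : BranchingProcess N} (π : Play σ) : Prop :=
  ∀ (C : Finset π.proc.Place) (t : σ.Trans), π.proc.net.PairwiseConcurrent C →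
    C.val.map π.placeMap = σ.net.pre t →
    ∃ p ∈ C, ∃ t' : π.proc.Trans, p ∈ π.proc.net.pre t'

/-- `σ` is winning for the good markings of `G`: every complete firing sequence of every maximal
play visits a good marking. -/
def IsWinning {P T : Type} (G : PetriGame P T) (σ : BranchingProcess G.toPetriNet) : Prop :=
  ∀ π : Play σ, π.IsMaximal → ∀ s : π.proc.net.FiringSequence, s.IsComplete →
    ∃ i, (s.marking i).map π.proc.placeLabel ∈ G.good

/-- The system players have a winning strategy in `G`. -/
def HasWinningStrategy {P T : Type} (G : PetriGame P T) : Prop :=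
  ∃ σ : BranchingProcess G.toPetriNet, IsStrategy G σ ∧ IsWinning G σ

section Players

variable {P T : Type} (G : PetriGame P T)

/-- The tokens of `G` are `n` individual players: every place belongs to one player, every player
initially has exactly one token, and every transition is taken by at least one player and hands
every participating player its token back. Hence in every reachable marking every player
has exactly one token, and that token lies on a place of this player. -/
structure IsPlayerAssignment (n : ℕ) (owner : P → Fin n) : Prop where
  init : ∀ i, (G.init.map owner).count i = 1
  conserves : ∀ t, (G.pre t).map owner = (G.post t).map owner
  pre_ne_zero : ∀ t, G.pre t ≠ 0

variable {n : ℕ} (owner : P → Fin n)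

/-- Player `i` is always an environment player. -/
def AlwaysEnvironment (i : Fin n) : Prop := ∀ p, owner p = i → p ∉ G.system

/-- Player `i` alternates between being a system player and being an environment player: every
transition it takes part in changes its type, and it is a system player in some reachable marking
and an environment player in some reachable marking. -/
structure Alternates (i : Fin n) : Prop where
  changes : ∀ t, ∀ p ∈ G.pre t, ∀ q ∈ G.post t, owner p = i → owner q = i →
    (p ∈ G.system ↔ q ∉ G.system)
  is_system : ∃ M, G.Reachable M ∧ ∃ p ∈ M, owner p = i ∧ p ∈ G.system
  is_environment : ∃ M, G.Reachable M ∧ ∃ p ∈ M, owner p = i ∧ p ∉ G.system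

/-- The good markings of `G` are reachable markings, and `G` is played by exactly `n` players, one
of which is always an environment player while all others alternate between being a system
player and being an environment player. -/
def IsAlternatingGame (n : ℕ) : Prop :=
  (∀ M ∈ G.good, G.Reachable M) ∧
  ∃ owner : P → Fin n, IsPlayerAssignment G n owner ∧
    ∃ e : Fin n, AlwaysEnvironment G owner e ∧ ∀ i, i ≠ e → Alternates G owner i

end Players

/-- Finite descriptions of Petri games with good markings: the list of the places, with `true` for a
system place and `false` for an environment place; the list of the transitions, each given by the
lists of the places in its pre- and postcondition; the list of the places in the initial marking;
and the list of the good markings. Places are denoted by their positions in the first list;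
multiplicities in multisets are multiplicities in lists. -/
abbrev GameCode : Type :=
  List Bool × List (List ℕ × List ℕ) × List ℕ × List (List ℕ)

/-- The multiset over the places `0, …, n - 1` denoted by a list (entries that are no places are
ignored). -/
def toMarking (n : ℕ) (l : List ℕ) : Multiset (Fin n) :=
  ((l.filterMap fun k => if h : k < n then some (⟨k, h⟩ : Fin n) else none : List (Fin n)) :
    Multiset (Fin n))

/-- The Petri game described by a code. Up to renaming of places and transitions, every finite Petri
game with finitely many good markings arises in this way. -/
def GameCode.toGame (c : GameCode) : PetriGame (Fin c.1.length) (Fin c.2.1.length) where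
  pre t := toMarking c.1.length (c.2.1.get t).1
  post t := toMarking c.1.length (c.2.1.get t).2
  init := toMarking c.1.length c.2.2.1
  system := {p | c.1.get p = true}
  good := {M | ∃ l ∈ c.2.2.2, M = toMarking c.1.length l}

/-- The question `Q` is decidable on the instances satisfying `K`: some algorithm halts with the
correct answer on all instances satisfying `K` (it may do anything, including not halting, on
others). -/
def DecidableOn {α : Type} [Primcodable α] (K Q : α → Prop) : Prop :=
  ∃ f : α →. Bool, Partrec f ∧ ∀ a, K a → (Q a → true ∈ f a) ∧ (¬ Q a → false ∈ f a)

end PetriGames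

/-! ### Nets in which every transition moves a single token -/

namespace PetriGames

/-! The proof reduces a halting problem to the existence of winning strategies. By `exists_machine`
there is one Turing machine whose halting on the inputs `g₀ g₁ g₂ … g₂` is undecidable in the number
of copies of `g₂`. Halting is expressed by laying tiles along a helix (`machineTiles_solvable_iff`):
one turn of the helix is one configuration, so that the successor of a tile is its right neighbour
and the tile one turn later lies above it. Such a tiling exists exactly when a certain game has a
winning strategy (`IsTileGame.solvable`, `IsTileGame.hasWinningStrategy`), and the code of that game
is primitive recursive in the input (`primrec_tileCode`).

In these games no two players ever share a transition. Hence a branching process is a family of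
independent trees, one for each player, and plays only interleave them. Two players write tiles; as
they learn nothing about anyone else, a strategy amounts to one sequence of tiles for each of them.
The environment player sees nothing either, but it suffices that for every wrong pair of sequences
some interleaving and some moves of this player avoid all good markings. The good markings serve to
discipline the interleaving: a schedule that drifts out of step visits one and is won by the system
players, so only disciplined schedules are tests. Since only finitely many places are available,
steps are counted modulo four. This is enough, because a lead that changes by one at a time and
starts within bounds cannot leave them without hitting the forbidden residue.

There are two tests. In the first (states 1 and 2) the first writer is between zero and two steps
ahead, so the two tiles compared have the same index or adjacent ones; this forces equal sequences
in which every tile may follow the one before it. In the second (states 3 and 4) the first writer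
initially completes the first turn alone and then stays one turn ahead; this checks the vertical
relation. The length `d` of a turn is not known to the game, but it is read off from the initial
tiles, and it is even, so that the 2`d` steps of a turn vanish modulo four. In the states 5 and 6
the environment player claims that a writer refuses to go on. Writing in step forever never visits a
good marking, so the writers must end with an accepting tile.

Given a winning strategy, follow one path of each writer. A position is `Safe` if no fair run from
it avoids the good markings; safety survives every move made in a marking that is not good
(`Safe.move`), and each claim of the environment player must therefore be false. This yields the
tiling step by step (`Synced.succ`, `IsWonUnfolding.solvable`). Conversely, if both players write a
tiling, an invariant on the numbers of their steps shows that every fair run visits a good marking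
(`exists_goodPos`).

The players beyond the third only pad their number. Each has a single move, from a system place to
an environment place, and good markings require that it has not been made. -/

/-- The marking in which the token of every player `i` lies on the place `s i`. -/
def stateMarking {P : Type} {n : ℕ} (s : Fin n → P) : Multiset P := Finset.univ.val.map s

theorem mem_stateMarking {P : Type} {n : ℕ} {s : Fin n → P} {p : P} :
    p ∈ stateMarking s ↔ ∃ i, s i = p := by
  simp [stateMarking]

theorem stateMarking_map {P Q : Type} {n : ℕ} (s : Fin n → P) (f : P → Q) :
    (stateMarking s).map f = stateMarking (fun i => f (s i)) :=
  Multiset.map_map _ _ _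

theorem stateMarking_eq_cons {P : Type} {n : ℕ} (s : Fin n → P) (i : Fin n) :
    stateMarking s = s i ::ₘ (Finset.univ.erase i).val.map s := by
  rw [stateMarking, ← Multiset.map_cons, Finset.erase_val, Multiset.cons_erase]
  simp

theorem stateMarking_update {P : Type} {n : ℕ} (s : Fin n → P) (i : Fin n) (q : P) :
    stateMarking (Function.update s i q) = q ::ₘ (Finset.univ.erase i).val.map s := by
  rw [stateMarking_eq_cons _ i, Function.update_self]
  congr 1
  refine Multiset.map_congr rfl fun j hj => ?_
  rw [Function.update_of_ne]
  exact ((Finset.univ.nodup.mem_erase_iff).1 (by simpa using hj)).1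

/-- The net consists of `n` independent automata: every transition moves the token of a single
player. -/
structure IsAutonomous {P T : Type} {n : ℕ} (N : PetriNet P T) (owner : P → Fin n)
    (src dst : T → P) (s₀ : Fin n → P) : Prop where
  pre_eq : ∀ t, N.pre t = {src t}
  post_eq : ∀ t, N.post t = {dst t}
  init_eq : N.init = stateMarking s₀
  owner_init : ∀ i, owner (s₀ i) = i
  owner_dst : ∀ t, owner (dst t) = owner (src t)

namespace IsAutonomous

variable {P T : Type} {n : ℕ} {N : PetriNet P T} {owner : P → Fin n} {src dst : T → P}
  {s₀ : Fin n → P}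

/-- Each place has one owner, so the token consumed by `t` can only be that of `owner (src t)`. This
replaces multisets by functions from players to places. -/
theorem fires_iff (h : IsAutonomous N owner src dst s₀) {s : Fin n → P}
    (hs : ∀ i, owner (s i) = i) (t : T) (M : Multiset P) :
    N.Fires (stateMarking s) t M ↔ s (owner (src t)) = src t ∧
      M = stateMarking (Function.update s (owner (src t)) (dst t)) := by
  rw [stateMarking_update, PetriNet.Fires]
  constructor
  · rintro ⟨R, h1, rfl⟩
    rw [h.pre_eq] at h1
    have hm : src t ∈ stateMarking s := by rw [h1]; simp
    obtain ⟨i, hi⟩ := mem_stateMarking.1 hm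
    have hi' : i = owner (src t) := by rw [← hi, hs]
    subst hi'
    refine ⟨hi, ?_⟩
    rw [stateMarking_eq_cons s (owner (src t)), hi, Multiset.singleton_add] at h1
    rw [h.post_eq, Multiset.singleton_add, (Multiset.cons_inj_right _).1 h1]
  · rintro ⟨h1, rfl⟩
    refine ⟨(Finset.univ.erase (owner (src t))).val.map s, ?_, ?_⟩
    · rw [h.pre_eq, stateMarking_eq_cons s (owner (src t)), h1, Multiset.singleton_add]
    · rw [h.post_eq, Multiset.singleton_add]

theorem owner_update (h : IsAutonomous N owner src dst s₀) {s : Fin n → P}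
    (hs : ∀ i, owner (s i) = i) (t : T) (i : Fin n) :
    owner (Function.update s (owner (src t)) (dst t) i) = i := by
  by_cases hi : i = owner (src t)
  · subst hi; rw [Function.update_self, h.owner_dst]
  · rw [Function.update_of_ne hi, hs]

/-- The states visited by a firing sequence. -/
theorem exists_states (h : IsAutonomous N owner src dst s₀) (s : N.FiringSequence) :
    ∃ f : ℕ → Fin n → P, f 0 = s₀ ∧ ∀ k, s.marking k = stateMarking (f k) ∧
      (∀ i, owner (f k i) = i) ∧
      (∀ t, s.step k = some t → f k (owner (src t)) = src t ∧
        f (k + 1) = Function.update (f k) (owner (src t)) (dst t)) ∧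
      (s.step k = none → f (k + 1) = f k) := by
  let f : ℕ → Fin n → P := fun k => Nat.rec s₀ (fun k g => match s.step k with
    | some t => Function.update g (owner (src t)) (dst t)
    | none => g) k
  have hsome : ∀ k t, s.step k = some t →
      f (k + 1) = Function.update (f k) (owner (src t)) (dst t) := by
    intro k t ht
    change (match s.step k with
      | some t => Function.update (f k) (owner (src t)) (dst t)
      | none => f k) = _
    rw [ht]
  have hnone : ∀ k, s.step k = none → f (k + 1) = f k := by
    intro k ht
    change (match s.step k with
      | some t => Function.update (f k) (owner (src t)) (dst t)
      | none => f k) = _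
    rw [ht]
  have key : ∀ k, s.marking k = stateMarking (f k) ∧ (∀ i, owner (f k i) = i) := by
    intro k
    induction k with
    | zero => exact ⟨s.marking_zero.trans h.init_eq, h.owner_init⟩
    | succ k ih =>
      rcases ht : s.step k with _ | t
      · rw [hnone k ht, (s.ended k ht).2]; exact ih
      · have := s.fires k t ht
        rw [ih.1, h.fires_iff ih.2] at this
        rw [hsome k t ht]
        exact ⟨this.2, fun i => h.owner_update ih.2 t i⟩
  refine ⟨f, rfl, fun k => ⟨(key k).1, (key k).2, fun t ht => ⟨?_, hsome k t ht⟩, hnone k⟩⟩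
  have := s.fires k t ht
  rw [(key k).1, h.fires_iff (key k).2] at this
  exact this.1

/-- States of an autonomous net that can be reached. -/
theorem reachable_stateMarking (h : IsAutonomous N owner src dst s₀) (s : Fin n → P)
    (hs : ∀ i, Relation.ReflTransGen (fun p q => ∃ t, src t = p ∧ dst t = q) (s₀ i) (s i)) :
    N.Reachable (stateMarking s) := by
  have howner : ∀ p q, Relation.ReflTransGen (fun p q => ∃ t, src t = p ∧ dst t = q) p q →
      owner q = owner p := by
    intro p q hpq
    induction hpq with
    | refl => rfl
    | tail _ hb ih => obtain ⟨t, rfl, rfl⟩ := hb; rw [h.owner_dst, ih]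
  have move : ∀ (i : Fin n) (g : Fin n → P) (q : P), (∀ i, owner (g i) = i) →
      Relation.ReflTransGen (fun p q => ∃ t, src t = p ∧ dst t = q) (g i) q →
      N.Reachable (stateMarking g) → N.Reachable (stateMarking (Function.update g i q)) := by
    intro i g q hg hq hr
    induction hq with
    | refl => rwa [Function.update_eq_self]
    | @tail b c hb hc ih =>
      obtain ⟨t, rfl, rfl⟩ := hc
      refine Relation.ReflTransGen.tail ih ⟨t, ?_⟩
      have ho : owner (src t) = i := by rw [howner _ _ hb, hg]
      have hu : ∀ j, owner (Function.update g i (src t) j) = j := by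
        intro j
        by_cases hj : j = i
        · subst hj; rw [Function.update_self, ho]
        · rw [Function.update_of_ne hj, hg]
      rw [h.fires_iff hu, ho]
      simp
  -- The players do not interact, so they can be brought to their targets one after another.
  have main : ∀ A : Finset (Fin n), N.Reachable (stateMarking (fun i => if i ∈ A then s i else s₀ i)) := by
    intro A
    induction A using Finset.induction_on with
    | empty =>
      simp only [Finset.notMem_empty, if_false]
      change N.Reachable (stateMarking s₀)
      rw [← h.init_eq]; exact Relation.ReflTransGen.refl
    | insert a A ha ih =>
      have := move a (fun i => if i ∈ A then s i else s₀ i) (s a) ?_ ?_ ih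
      · convert this using 2
        funext j
        by_cases hj : j = a
        · subst hj; simp
        · simp [hj]
      · intro i
        split_ifs
        · rw [howner _ _ (hs i), h.owner_init]
        · rw [h.owner_init]
      · simpa [ha] using hs a
  simpa using main Finset.univ

end IsAutonomous

/-- A homomorphism preserves the sizes of pre- and postconditions, so singletons lift to singletons.
Hence every strategy for a game without synchronization again consists of independent trees. -/
theorem BranchingProcess.exists_isAutonomous {P T : Type} {n : ℕ} {N : PetriNet P T}
    {owner : P → Fin n} {src dst : T → P} {s₀ : Fin n → P}
    (h : IsAutonomous N owner src dst s₀) (σ : BranchingProcess N) :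
    ∃ (src' dst' : σ.Trans → σ.Place) (s₀' : Fin n → σ.Place),
      IsAutonomous σ.net (fun p => owner (σ.placeLabel p)) src' dst' s₀' ∧
      (∀ t, σ.placeLabel (src' t) = src (σ.transLabel t)) ∧
      (∀ t, σ.placeLabel (dst' t) = dst (σ.transLabel t)) ∧
      ∀ i, σ.placeLabel (s₀' i) = s₀ i := by
  have h1 : ∀ t, ∃ p, σ.net.pre t = {p} ∧ σ.placeLabel p = src (σ.transLabel t) := by
    intro t
    have := σ.map_pre t
    rw [h.pre_eq, Multiset.map_eq_singleton] at this
    exact this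
  have h2 : ∀ t, ∃ p, σ.net.post t = {p} ∧ σ.placeLabel p = dst (σ.transLabel t) := by
    intro t
    have := σ.map_post t
    rw [h.post_eq, Multiset.map_eq_singleton] at this
    exact this
  have h3 : ∀ i, ∃ p ∈ σ.net.init, σ.placeLabel p = s₀ i := by
    intro i
    rw [← Multiset.mem_map, σ.map_init, h.init_eq]
    exact mem_stateMarking.2 ⟨i, rfl⟩
  choose src' hsrc hsrc' using h1
  choose dst' hdst hdst' using h2
  choose s₀' hs hs' using h3
  have hinj : Function.Injective s₀ := fun i j hij => by
    rw [← h.owner_init i, hij, h.owner_init]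
  refine ⟨src', dst', s₀', ⟨hsrc, hdst, ?_, fun i => by rw [hs', h.owner_init], fun t => ?_⟩,
    hsrc', hdst', hs'⟩
  -- The initial labels are distinct, so a label determines the initial place that carries it.
  · have hnd : (σ.net.init.map σ.placeLabel).Nodup := by
      rw [σ.map_init, h.init_eq]
      exact Multiset.Nodup.map hinj Finset.univ.nodup
    have hinj' : Function.Injective s₀' := fun i j hij => hinj (by rw [← hs', hij, hs'])
    rw [stateMarking, Multiset.Nodup.ext σ.isOccurrenceNet.init_nodup
      (Multiset.Nodup.map hinj' Finset.univ.nodup)]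
    intro p
    refine ⟨fun hp => ?_, fun hp => ?_⟩
    · have : σ.placeLabel p ∈ stateMarking s₀ := by
        rw [← h.init_eq, ← σ.map_init]; exact Multiset.mem_map_of_mem _ hp
      obtain ⟨i, hi⟩ := mem_stateMarking.1 this
      have := Multiset.inj_on_of_nodup_map hnd _ (hs i) _ hp (by rw [hs', hi])
      exact Multiset.mem_map.2 ⟨i, by simp, this⟩
    · obtain ⟨i, -, rfl⟩ := Multiset.mem_map.1 hp
      exact hs i
  · rw [hdst', hsrc', h.owner_dst]

/-- A fair infinite run of an autonomous net: in step `k`, player `m k` takes the transition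
`τ k`, and every player who can move does so eventually. -/
structure IsFairRun {P T : Type} {n : ℕ} (src dst : T → P) (f : ℕ → Fin n → P) (τ : ℕ → T)
    (m : ℕ → Fin n) : Prop where
  src_eq : ∀ k, src (τ k) = f k (m k)
  next : ∀ k, f (k + 1) = Function.update (f k) (m k) (dst (τ k))
  fair : ∀ k i, (∃ t, src t = f k i) → ∃ j, k ≤ j ∧ m j = i

end PetriGames

/-! ### Fair runs and plays -/

namespace PetriGames

namespace IsAutonomous

variable {P T : Type} {n : ℕ} {N : PetriNet P T} {owner : P → Fin n} {src dst : T → P}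
  {s₀ : Fin n → P}

theorem flow_src (h : IsAutonomous N owner src dst s₀) (t : T) :
    N.Flow (Sum.inl (src t)) (Sum.inr t) := by
  simp [PetriNet.Flow, h.pre_eq]

theorem flow_dst (h : IsAutonomous N owner src dst s₀) (t : T) :
    N.Flow (Sum.inr t) (Sum.inl (dst t)) := by
  simp [PetriNet.Flow, h.post_eq]

/-- A closed walk of a token would be a cycle of the flow relation, which is well-founded. -/
theorem acyclic (h : IsAutonomous N owner src dst s₀) (hN : N.IsOccurrenceNet) (p : P) :
    ¬ Relation.TransGen (fun p q => ∃ t, src t = p ∧ dst t = q) p p := by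
  intro hp
  have : Relation.TransGen N.Flow (Sum.inl p) (Sum.inl p) := by
    refine Relation.TransGen.lift' (f := Sum.inl) ?_ _ _ hp
    rintro _ _ ⟨t, rfl, rfl⟩
    exact Relation.TransGen.tail (Relation.TransGen.single (h.flow_src t)) (h.flow_dst t)
  exact hN.wellFounded_flow.transGen.asymmetric _ _ this this

/-- A token that has left a place of an occurrence net does not return. -/
theorem ne_of_left (h : IsAutonomous N owner src dst s₀) (hN : N.IsOccurrenceNet)
    {g : ℕ → P} (hg : ∀ k, g (k + 1) = g k ∨ ∃ t, src t = g k ∧ dst t = g (k + 1))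
    {j k : ℕ} (hjk : j < k) {t : T} (ht : src t = g j) (ht' : dst t = g (j + 1)) :
    g k ≠ g j := by
  intro hk
  apply h.acyclic hN (g j)
  have : Relation.ReflTransGen (fun p q => ∃ t, src t = p ∧ dst t = q) (g (j + 1)) (g k) := by
    obtain ⟨d, rfl⟩ := Nat.exists_eq_add_of_le (Nat.succ_le_of_lt hjk)
    clear hjk hk
    induction d with
    | zero => exact Relation.ReflTransGen.refl
    | succ d ih =>
      rcases hg (j.succ + d) with h1 | h1
      · rw [← Nat.add_assoc, h1]; exact ih
      · exact Relation.ReflTransGen.tail ih h1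
  rw [hk] at this
  exact Relation.TransGen.head' ⟨t, ht, ht'⟩ this

end IsAutonomous

namespace IsFairRun

variable {P T : Type} {n : ℕ} {N : PetriNet P T} {owner : P → Fin n} {src dst : T → P}
  {s₀ : Fin n → P} {f : ℕ → Fin n → P} {τ : ℕ → T} {m : ℕ → Fin n}

theorem owner_eq (h : IsAutonomous N owner src dst s₀) (hr : IsFairRun src dst f τ m)
    (h0 : f 0 = s₀) (k : ℕ) : ∀ i, owner (f k i) = i := by
  induction k with
  | zero => rw [h0]; exact h.owner_init
  | succ k ih =>
    intro i
    rw [hr.next]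
    by_cases hi : i = m k
    · subst hi; rw [Function.update_self, h.owner_dst, hr.src_eq, ih]
    · rw [Function.update_of_ne hi, ih]

theorem mover_eq (h : IsAutonomous N owner src dst s₀) (hr : IsFairRun src dst f τ m)
    (h0 : f 0 = s₀) (k : ℕ) : owner (src (τ k)) = m k := by
  rw [hr.src_eq, hr.owner_eq h h0]

theorem next_apply (hr : IsFairRun src dst f τ m) (i : Fin n) (k : ℕ) :
    f (k + 1) i = f k i ∨ (m k = i ∧ src (τ k) = f k i ∧ dst (τ k) = f (k + 1) i) := by
  by_cases hi : i = m k
  · subst hi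
    right
    rw [hr.next, Function.update_self]
    exact ⟨rfl, hr.src_eq k, rfl⟩
  · left
    rw [hr.next, Function.update_of_ne hi]

theorem mover_dst (hr : IsFairRun src dst f τ m) (k : ℕ) : f (k + 1) (m k) = dst (τ k) := by
  rw [hr.next, Function.update_self]

/-- Tokens do not return, so a run leaves each place at most once. This makes the part of the
strategy visited by a run a play. -/
theorem src_injective (h : IsAutonomous N owner src dst s₀) (hN : N.IsOccurrenceNet)
    (hr : IsFairRun src dst f τ m) (h0 : f 0 = s₀) {j k : ℕ} (hjk : src (τ j) = src (τ k)) :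
    j = k := by
  have hm : m j = m k := by rw [← hr.mover_eq h h0, hjk, hr.mover_eq h h0]
  have key : ∀ j k, src (τ j) = src (τ k) → m j = m k → ¬ j < k := by
    intro j k hjk hm hlt
    refine h.ne_of_left hN (g := fun k => f k (m j)) (fun k => ?_) hlt (hr.src_eq j)
      (hr.mover_dst j).symm ?_
    · exact (hr.next_apply (m j) k).imp_right fun h => ⟨_, h.2⟩
    · rw [← hr.src_eq, hjk, hr.src_eq, hm]
  rcases lt_trichotomy j k with h1 | h1 | h1
  · exact absurd h1 (key j k hjk hm)
  · exact h1
  · exact absurd h1 (key k j hjk.symm hm.symm)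

theorem eq_or_produced (hr : IsFairRun src dst f τ m) (k : ℕ) (i : Fin n) :
    f k i = f 0 i ∨ ∃ j, f k i = dst (τ j) := by
  induction k with
  | zero => exact Or.inl rfl
  | succ k ih =>
    rcases hr.next_apply i k with h1 | h1
    · rwa [h1]
    · exact Or.inr ⟨k, h1.2.2.symm⟩

end IsFairRun

theorem PetriNet.CausalLE.map {P T P' T' : Type} {N : PetriNet P T} {N' : PetriNet P' T'}
    {f : P → P'} {g : T → T'}
    (h : ∀ x y, N.Flow x y → N'.Flow (Sum.map f g x) (Sum.map f g y)) {x y : P ⊕ T}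
    (hxy : N.CausalLE x y) : N'.CausalLE (Sum.map f g x) (Sum.map f g y) :=
  Relation.ReflTransGen.lift _ h _ _ hxy

section RunPlay

variable {P T : Type} {N : PetriNet P T} {σ : BranchingProcess N} {n : ℕ}
  {owner : σ.Place → Fin n} {src dst : σ.Trans → σ.Place} {s₀ : Fin n → σ.Place}
  {f : ℕ → Fin n → σ.Place} {τ : ℕ → σ.Trans} {m : ℕ → Fin n}

/-- The net of the places and transitions that occur in a run. -/
def runNet (src dst : σ.Trans → σ.Place) (f : ℕ → Fin n → σ.Place) (τ : ℕ → σ.Trans)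
    (hs : ∀ k, ∃ j i, f j i = src (τ k)) (hd : ∀ k, ∃ j i, f j i = dst (τ k)) :
    PetriNet {p : σ.Place // ∃ k i, f k i = p} {t : σ.Trans // ∃ k, τ k = t} where
  pre t := {⟨src t.1, by obtain ⟨_, k, rfl⟩ := t; exact hs k⟩}
  post t := {⟨dst t.1, by obtain ⟨_, k, rfl⟩ := t; exact hd k⟩}
  init := stateMarking fun i => ⟨f 0 i, 0, i, rfl⟩

/-- The process formed by the places and transitions that occur in a run. -/
def runProcess (h : IsAutonomous σ.net owner src dst s₀) (hr : IsFairRun src dst f τ m)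
    (h0 : f 0 = s₀) : BranchingProcess N where
  Place := {p : σ.Place // ∃ k i, f k i = p}
  Trans := {t : σ.Trans // ∃ k, τ k = t}
  net := runNet src dst f τ (fun k => ⟨k, m k, (hr.src_eq k).symm⟩)
    (fun k => ⟨k + 1, m k, hr.mover_dst k⟩)
  placeLabel p := σ.placeLabel p.1
  transLabel t := σ.transLabel t.1
  isOccurrenceNet := by
    have hflow : ∀ x y, (runNet src dst f τ (fun k => ⟨k, m k, (hr.src_eq k).symm⟩)
        (fun k => ⟨k + 1, m k, hr.mover_dst k⟩)).Flow x y →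
        σ.net.Flow (Sum.map Subtype.val Subtype.val x) (Sum.map Subtype.val Subtype.val y) := by
      rintro (p | t) (q | u) hxy
      · exact hxy
      · have : p = _ := Multiset.mem_singleton.1 hxy
        rw [this]
        exact h.flow_src u.1
      · have : q = _ := Multiset.mem_singleton.1 hxy
        rw [this]
        exact h.flow_dst t.1
      · exact hxy
    have hinit : ∀ p : {p : σ.Place // ∃ k i, f k i = p},
        p ∈ stateMarking (fun i => (⟨f 0 i, 0, i, rfl⟩ : {p : σ.Place // ∃ k i, f k i = p})) ↔
          p.1 ∈ σ.net.init := by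
      intro p
      rw [h.init_eq, mem_stateMarking, mem_stateMarking]
      refine exists_congr fun i => Subtype.ext_iff.trans ?_
      rw [← h0]
    refine ⟨fun t => Multiset.nodup_singleton _, fun t => Multiset.nodup_singleton _, ?_, ?_, ?_,
      ?_, ?_⟩
    · refine Multiset.Nodup.map (f := fun i => (⟨f 0 i, 0, i, rfl⟩ :
        {p : σ.Place // ∃ k i, f k i = p})) (fun i j hij => ?_) Finset.univ.nodup
      have := congrArg Subtype.val hij
      dsimp only at this
      rw [← hr.owner_eq h h0 0 i, this, hr.owner_eq h h0]
    · intro p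
      refine (hinit p).trans ⟨fun hp t ht => ?_, fun hp => ?_⟩
      · refine (σ.isOccurrenceNet.mem_init_iff p.1).1 hp t.1 ?_
        rw [h.post_eq, Multiset.mem_singleton]
        exact congrArg Subtype.val (Multiset.mem_singleton.1 ht)
      · obtain ⟨_, k, i, rfl⟩ := p
        rcases hr.eq_or_produced k i with h1 | ⟨j, hj⟩
        · dsimp only
          rw [h1, h0, h.init_eq]
          exact mem_stateMarking.2 ⟨i, rfl⟩
        · exact absurd (Multiset.mem_singleton.2 (Subtype.ext hj)) (hp ⟨τ j, j, rfl⟩)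
    · intro p hp
      have hp' : p.1 ∉ σ.net.init := fun hp' => hp ((hinit p).2 hp')
      obtain ⟨t, ht, ht'⟩ := σ.isOccurrenceNet.existsUnique_producer p.1 hp'
      obtain ⟨_, k, i, rfl⟩ := p
      rcases hr.eq_or_produced k i with h1 | ⟨j, hj⟩
      · refine absurd ?_ hp'
        dsimp only
        rw [h1, h0, h.init_eq]
        exact mem_stateMarking.2 ⟨i, rfl⟩
      · refine ⟨⟨τ j, j, rfl⟩, Multiset.mem_singleton.2 (Subtype.ext hj), fun u hu => ?_⟩
        have e1 : f k i = dst u.1 := congrArg Subtype.val (Multiset.mem_singleton.1 hu)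
        exact Subtype.ext ((ht' u.1 (by dsimp only; rw [h.post_eq, e1]; simp)).trans
          (ht' (τ j) (by dsimp only; rw [h.post_eq, hj]; simp)).symm)
    · exact Subrelation.wf (fun {x y} hxy => hflow x y hxy)
        (InvImage.wf (Sum.map Subtype.val Subtype.val) σ.isOccurrenceNet.wellFounded_flow)
    · rintro t ⟨p, t₁, t₂, hne, h1, h2, h3, h4⟩
      refine σ.isOccurrenceNet.no_self_conflict t.1 ⟨p.1, t₁.1, t₂.1,
        fun he => hne (Subtype.ext he), ?_, ?_, h3.map hflow, h4.map hflow⟩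
      · rw [h.pre_eq, Multiset.mem_singleton]
        exact congrArg Subtype.val (Multiset.mem_singleton.1 h1)
      · rw [h.pre_eq, Multiset.mem_singleton]
        exact congrArg Subtype.val (Multiset.mem_singleton.1 h2)
  map_pre t := by
    rw [← σ.map_pre, h.pre_eq]; rfl
  map_post t := by
    rw [← σ.map_post, h.post_eq]; rfl
  map_init := by
    rw [← σ.map_init, h.init_eq, ← h0]
    exact (stateMarking_map _ _).trans (stateMarking_map _ _).symm
  trans_injective t t' hpre hl := by
    refine Subtype.ext (σ.trans_injective _ _ ?_ hl)
    rw [h.pre_eq, h.pre_eq]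
    exact congrArg _ (congrArg Subtype.val (Multiset.singleton_inj.1 hpre))

/-- The play formed by the places and transitions that occur in a run. -/
def runPlay (h : IsAutonomous σ.net owner src dst s₀) (hr : IsFairRun src dst f τ m)
    (h0 : f 0 = s₀) : Play σ where
  proc := runProcess h hr h0
  placeMap := Subtype.val
  transMap := Subtype.val
  placeMap_injective := Subtype.val_injective
  transMap_injective := Subtype.val_injective
  placeLabel_map _ := rfl
  transLabel_map _ := rfl
  map_pre t := by rw [h.pre_eq]; rfl
  map_post t := by rw [h.post_eq]; rfl
  map_init := by
    rw [h.init_eq]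
    exact (stateMarking_map _ _).trans (congrArg _ h0)
  post_subsingleton p t t' hp hp' := by
    have e : src t.1 = src t'.1 := by
      have e1 := congrArg Subtype.val (Multiset.mem_singleton.1 hp)
      have e2 := congrArg Subtype.val (Multiset.mem_singleton.1 hp')
      exact e1.symm.trans e2
    obtain ⟨_, j, rfl⟩ := t
    obtain ⟨_, k, rfl⟩ := t'
    obtain rfl := hr.src_injective h σ.isOccurrenceNet h0 e
    rfl

/-- Maximality is fairness: preconditions are single places, and a token on a place from which the
strategy allows a move must leave it in a fair run. -/
theorem runPlay_isMaximal (h : IsAutonomous σ.net owner src dst s₀)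
    (hr : IsFairRun src dst f τ m) (h0 : f 0 = s₀) : (runPlay h hr h0).IsMaximal := by
  intro C t _ hC
  rw [h.pre_eq, Multiset.map_eq_singleton] at hC
  obtain ⟨p, hp, hpt⟩ := hC
  refine ⟨p, by rw [← Finset.mem_val, hp]; simp, ?_⟩
  obtain ⟨_, k, i, rfl⟩ := p
  replace hpt : f k i = src t := hpt
  -- Otherwise player `i` would stay on this place forever, against fairness.
  have : ∃ j, f j i = f k i ∧ m j = i := by
    by_contra hcon
    push Not at hcon
    have hst : ∀ d, f (k + d) i = f k i := by
      intro d
      induction d with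
      | zero => rfl
      | succ d ih =>
        rcases hr.next_apply i (k + d) with h1 | h1
        · rw [← Nat.add_assoc, h1, ih]
        · exact absurd h1.1 (hcon _ ih)
    obtain ⟨j, hj, hmj⟩ := hr.fair k i ⟨t, hpt.symm⟩
    obtain ⟨d, rfl⟩ := Nat.exists_eq_add_of_le hj
    exact hcon _ (hst d) hmj
  obtain ⟨j, hj, rfl⟩ := this
  exact ⟨⟨τ j, j, rfl⟩, Multiset.mem_singleton.2 (Subtype.ext (by
    dsimp only; rw [hr.src_eq, hj]))⟩

theorem runNet_fires (hr : IsFairRun src dst f τ m) (hs : ∀ k, ∃ j i, f j i = src (τ k))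
    (hd : ∀ k, ∃ j i, f j i = dst (τ k)) (k : ℕ) :
    (runNet src dst f τ hs hd).Fires (stateMarking fun i => ⟨f k i, k, i, rfl⟩) ⟨τ k, k, rfl⟩
      (stateMarking fun i => ⟨f (k + 1) i, k + 1, i, rfl⟩) := by
  refine ⟨(Finset.univ.erase (m k)).val.map fun i => ⟨f k i, k, i, rfl⟩, ?_, ?_⟩
  · rw [stateMarking_eq_cons _ (m k), ← Multiset.singleton_add]
    congr 1
    exact congrArg _ (Subtype.ext (hr.src_eq k).symm)
  · rw [stateMarking_eq_cons _ (m k), ← Multiset.singleton_add]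
    congr 1
    · exact congrArg _ (Subtype.ext (hr.mover_dst k))
    · refine Multiset.map_congr rfl fun i hi => Subtype.ext ?_
      dsimp only
      rw [hr.next, Function.update_of_ne]
      exact ((Finset.univ.nodup.mem_erase_iff).1 (by simpa using hi)).1

/-- The firing sequence given by a run. -/
def runSequence (h : IsAutonomous σ.net owner src dst s₀) (hr : IsFairRun src dst f τ m)
    (h0 : f 0 = s₀) : (runProcess h hr h0).net.FiringSequence where
  marking k := stateMarking fun i => ⟨f k i, k, i, rfl⟩
  step k := some ⟨τ k, k, rfl⟩
  marking_zero := rfl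
  fires k t ht := by
    obtain rfl := Option.some_inj.1 ht
    exact runNet_fires hr (fun k => ⟨k, m k, (hr.src_eq k).symm⟩)
      (fun k => ⟨k + 1, m k, hr.mover_dst k⟩) k
  ended k hk := by cases hk

end RunPlay

/-- A fair run is a complete firing sequence of a maximal play, namely of the play formed by what it
visits. From here on, refuting a strategy means exhibiting a fair run without good states. -/
theorem IsWinning.visits_good {P T : Type} {G : PetriGame P T}
    {σ : BranchingProcess G.toPetriNet} {n : ℕ}
    {owner : σ.Place → Fin n} {src dst : σ.Trans → σ.Place} {s₀ : Fin n → σ.Place}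
    {f : ℕ → Fin n → σ.Place} {τ : ℕ → σ.Trans} {m : ℕ → Fin n} (hw : IsWinning G σ)
    (h : IsAutonomous σ.net owner src dst s₀) (hr : IsFairRun src dst f τ m) (h0 : f 0 = s₀) :
    ∃ k, stateMarking (fun i => σ.placeLabel (f k i)) ∈ G.good := by
  obtain ⟨k, hk⟩ := hw (runPlay h hr h0) (runPlay_isMaximal h hr h0) (runSequence h hr h0)
    (by rintro ⟨_, k, rfl⟩; exact ⟨k, rfl⟩)
  refine ⟨k, ?_⟩
  exact (stateMarking_map (fun i => (⟨f k i, k, i, rfl⟩ : {p : σ.Place // ∃ k i, f k i = p}))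
    (fun p => σ.placeLabel p.1)) ▸ hk

/-- A firing sequence of a play, seen in the strategy. -/
def Play.mapSequence {P T : Type} {N : PetriNet P T} {σ : BranchingProcess N} (π : Play σ)
    (s : π.proc.net.FiringSequence) : σ.net.FiringSequence where
  marking k := (s.marking k).map π.placeMap
  step k := (s.step k).map π.transMap
  marking_zero := by rw [s.marking_zero, π.map_init]
  fires k t ht := by
    obtain ⟨u, hu, rfl⟩ := Option.map_eq_some_iff.1 ht
    obtain ⟨R, h1, h2⟩ := s.fires k u hu
    exact ⟨R.map π.placeMap, by rw [h1, Multiset.map_add, π.map_pre],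
      by rw [h2, Multiset.map_add, π.map_post]⟩
  ended k hk := by
    rw [Option.map_eq_none_iff] at hk
    rw [(s.ended k hk).1, (s.ended k hk).2]
    exact ⟨rfl, rfl⟩

theorem Play.mapSequence_good {P T : Type} {N : PetriNet P T} {σ : BranchingProcess N}
    (π : Play σ) (s : π.proc.net.FiringSequence) (k : ℕ) :
    ((π.mapSequence s).marking k).map σ.placeLabel = (s.marking k).map π.proc.placeLabel := by
  change ((s.marking k).map π.placeMap).map _ = _
  rw [Multiset.map_map]
  exact Multiset.map_congr rfl fun p _ => π.placeLabel_map p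

/-- A strategy is winning if every sequence of states that respects its transitions and lets every
player move who can move visits a good marking. -/
theorem isWinning_of_states {P T : Type} {G : PetriGame P T}
    {σ : BranchingProcess G.toPetriNet} {n : ℕ}
    {owner : σ.Place → Fin n} {src dst : σ.Trans → σ.Place} {s₀ : Fin n → σ.Place}
    (h : IsAutonomous σ.net owner src dst s₀)
    (H : ∀ f : ℕ → Fin n → σ.Place, f 0 = s₀ →
      (∀ k, f (k + 1) = f k ∨ ∃ t i, src t = f k i ∧
        f (k + 1) = Function.update (f k) i (dst t)) →
      (∀ k i t, src t = f k i → ∃ j, k ≤ j ∧ ∃ t', src t' = f k i ∧ f (j + 1) i = dst t') →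
      ∃ k, stateMarking (fun i => σ.placeLabel (f k i)) ∈ G.good) :
    IsWinning G σ := by
  intro π hπ s hs
  obtain ⟨f, hf0, hf⟩ := h.exists_states (π.mapSequence s)
  suffices hgood : ∃ k, stateMarking (fun i => σ.placeLabel (f k i)) ∈ G.good by
    obtain ⟨k, hk⟩ := hgood
    refine ⟨k, ?_⟩
    rw [← π.mapSequence_good, (hf k).1, stateMarking_map]
    exact hk
  refine H f hf0 ?_ ?_
  · intro k
    rcases ht : (π.mapSequence s).step k with _ | t
    · exact Or.inl ((hf k).2.2.2 ht)
    · exact Or.inr ⟨t, _, ((hf k).2.2.1 t ht).1.symm, ((hf k).2.2.1 t ht).2⟩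
  · intro k i t ht
    have hmem : f k i ∈ (s.marking k).map π.placeMap := by
      change _ ∈ (π.mapSequence s).marking k
      rw [(hf k).1]
      exact mem_stateMarking.2 ⟨i, rfl⟩
    obtain ⟨p, hp, hpi⟩ := Multiset.mem_map.1 hmem
    obtain ⟨q, hq, t', ht'⟩ := hπ {p} t (by
      intro a ha b hb hab
      rw [Finset.mem_singleton] at ha hb
      exact absurd (ha.trans hb.symm) hab) (by
      rw [h.pre_eq, ht, ← hpi]; simp)
    rw [Finset.mem_singleton] at hq
    subst hq
    obtain ⟨j, hj⟩ := hs t'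
    have hst : (π.mapSequence s).step j = some (π.transMap t') := by
      change (s.step j).map _ = _
      rw [hj]; rfl
    have hsrc : src (π.transMap t') = f k i := by
      have : π.placeMap q ∈ σ.net.pre (π.transMap t') := by
        rw [← π.map_pre]; exact Multiset.mem_map_of_mem _ ht'
      rw [h.pre_eq, Multiset.mem_singleton] at this
      rw [← this, hpi]
    have hown : owner (src (π.transMap t')) = i := by rw [hsrc, (hf k).2.1]
    obtain ⟨e1, e2⟩ := (hf j).2.2.1 _ hst
    rw [hown] at e1 e2
    have e3 : f (j + 1) i = dst (π.transMap t') := by rw [e2, Function.update_self]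
    refine ⟨j, ?_, _, hsrc, e3⟩
    -- If the move had happened before time `k`, the token would have left this place and be back on
    -- it at time `k`.
    by_contra hlt
    refine h.ne_of_left σ.isOccurrenceNet (g := fun k => f k i) (fun l => ?_)
      (not_le.1 hlt) e1.symm e3.symm ?_
    · rcases ht : (π.mapSequence s).step l with _ | u
      · left; rw [(hf l).2.2.2 ht]
      · obtain ⟨a1, a2⟩ := (hf l).2.2.1 _ ht
        by_cases hi : i = owner (src u)
        · right
          refine ⟨u, ?_, ?_⟩
          · rw [hi, a1]
          · rw [a2, hi, Function.update_self]
        · left; rw [a2, Function.update_of_ne hi]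
    · rw [e1, hsrc]

end PetriGames

namespace PetriGames

/-! ### Building fair runs inside a set of states -/

section BadRuns

variable {P T : Type} {n : ℕ} {src dst : T → P}

/-- There is a fair run from `s` all of whose states satisfy `Bad`. -/
def HasRunWithin (src dst : T → P) (Bad : (Fin n → P) → Prop) (s : Fin n → P) : Prop :=
  ∃ f τ m, IsFairRun src dst f τ m ∧ f 0 = s ∧ ∀ k, Bad (f k)

/-- Fairness concerns only the tail of a run: a player who can move at the start has either made the
added move or still waits on the same place when the old run begins. -/
theorem HasRunWithin.cons {Bad : (Fin n → P) → Prop} {s : Fin n → P} {i : Fin n} {t : T}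
    (hs : Bad s) (ht : src t = s i)
    (h : HasRunWithin src dst Bad (Function.update s i (dst t))) :
    HasRunWithin src dst Bad s := by
  obtain ⟨f, τ, m, hr, h0, hb⟩ := h
  refine ⟨fun k => Nat.casesOn k s f, fun k => Nat.casesOn k t τ, fun k => Nat.casesOn k i m,
    ⟨?_, ?_, ?_⟩, rfl, ?_⟩
  · rintro (_ | k)
    · exact ht
    · exact hr.src_eq k
  · rintro (_ | k)
    · exact h0
    · exact hr.next k
  · rintro (_ | k) l hl
    · by_cases hi : l = i
      · exact ⟨0, le_rfl, hi.symm⟩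
      · obtain ⟨j, -, hj⟩ := hr.fair 0 l (by
          rw [h0, Function.update_of_ne hi]; exact hl)
        exact ⟨j + 1, Nat.zero_le _, hj⟩
    · obtain ⟨j, hkj, hj⟩ := hr.fair k l hl
      exact ⟨j + 1, Nat.succ_le_succ hkj, hj⟩
  · rintro (_ | k)
    · exact hs
    · exact hb k

theorem HasRunWithin.mono {Bad Bad' : (Fin n → P) → Prop} {s : Fin n → P}
    (hb : ∀ s, Bad s → Bad' s) (h : HasRunWithin src dst Bad s) :
    HasRunWithin src dst Bad' s := by
  obtain ⟨f, τ, m, hr, h0, h1⟩ := h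
  exact ⟨f, τ, m, hr, h0, fun k => hb _ (h1 k)⟩

/-- If in every situation of an invariant some player can move within the invariant, in such a way
that any given player who can move gets closer to its move, then there is a fair run within the
invariant. -/
theorem hasRunWithin_of_invariant {α : Type} {Inv : α → Prop} (state : α → Fin n → P)
    (rank : α → Fin n → ℕ)
    (H : ∀ a i, Inv a → ∃ a' t j, src t = state a j ∧
      state a' = Function.update (state a) j (dst t) ∧ Inv a' ∧
      (j = i ∨ (∀ u, src u ≠ state a i) ∨ rank a' i < rank a i))
    {a : α} (ha : Inv a) (i₀ : Fin n) :
    HasRunWithin src dst (fun s => ∃ a, Inv a ∧ state a = s) (state a) := by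
  classical
  have hn : 0 < n := i₀.pos
  have : Nonempty α := ⟨a⟩
  have : Nonempty T := ⟨(H a i₀ ha).choose_spec.choose⟩
  choose! ma mt mj h1 h1' h2 h3 using H
  -- Round robin: a counter names the player whose turn it is, and it advances only when this player
  -- has moved or cannot move.
  let turn : ℕ → Fin n := fun c => ⟨c % n, Nat.mod_lt _ hn⟩
  let nxt : α × ℕ → α × ℕ := fun x => (ma x.1 (turn x.2),
      if mj x.1 (turn x.2) = turn x.2 ∨ ∀ u, src u ≠ state x.1 (turn x.2) then x.2 + 1 else x.2)
  let st : ℕ → α × ℕ := fun k => nxt^[k] (a, 0)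
  have hst : ∀ k, st (k + 1) = nxt (st k) := fun k => Function.iterate_succ_apply' _ _ _
  have hinv : ∀ k, Inv (st k).1 := by
    intro k
    induction k with
    | zero => exact ha
    | succ k ih => rw [hst]; exact h2 _ _ ih
  let m : ℕ → Fin n := fun k => mj (st k).1 (turn (st k).2)
  have hnext : ∀ k, state (st (k + 1)).1 =
      Function.update (state (st k).1) (m k) (dst (mt (st k).1 (turn (st k).2))) := by
    intro k; rw [hst]; exact h1' _ _ (hinv k)
  -- While the counter stands still, the rank of the player in turn decreases, so the turn ends.
  have hadv : ∀ r k, rank (st k).1 (turn (st k).2) ≤ r → ∃ k', k ≤ k' ∧ (st k').2 = (st k).2 ∧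
      (st (k' + 1)).2 = (st k).2 + 1 ∧
      (m k' = turn (st k).2 ∨ ∀ u, src u ≠ state (st k').1 (turn (st k).2)) := by
    intro r
    induction r with
    | zero =>
      intro k hk
      have h4 : m k = turn (st k).2 ∨ ∀ u, src u ≠ state (st k).1 (turn (st k).2) := by
        rcases h3 _ (turn (st k).2) (hinv k) with h | h | h
        · exact Or.inl h
        · exact Or.inr h
        · omega
      exact ⟨k, le_rfl, rfl, by rw [hst]; exact if_pos h4, h4⟩
    | succ r ih =>
      intro k hk
      by_cases h4 : m k = turn (st k).2 ∨ ∀ u, src u ≠ state (st k).1 (turn (st k).2)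
      · exact ⟨k, le_rfl, rfl, by rw [hst]; exact if_pos h4, h4⟩
      · have h5 : (st (k + 1)).2 = (st k).2 := by rw [hst]; exact if_neg h4
        have h6 : rank (st (k + 1)).1 (turn (st k).2) < rank (st k).1 (turn (st k).2) := by
          rcases h3 _ (turn (st k).2) (hinv k) with h | h | h
          · exact absurd (Or.inl h) h4
          · exact absurd (Or.inr h) h4
          · rw [hst]; exact h
        obtain ⟨k', a, b, c, d⟩ := ih (k + 1) (by rw [h5]; omega)
        rw [h5] at b c d
        exact ⟨k', by omega, b, c, d⟩
  have hcount : ∀ d k, ∃ k', k ≤ k' ∧ (st k').2 = (st k).2 + d := by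
    intro d
    induction d with
    | zero => exact fun k => ⟨k, le_rfl, rfl⟩
    | succ d ih =>
      intro k
      obtain ⟨k', a, b⟩ := ih k
      obtain ⟨k'', c, -, d, -⟩ := hadv _ k' le_rfl
      exact ⟨k'' + 1, by omega, by rw [d, b, Nat.add_assoc]⟩
  refine ⟨fun k => state (st k).1, fun k => mt (st k).1 (turn (st k).2), m,
    ⟨fun k => h1 _ _ (hinv k), hnext, ?_⟩, rfl, fun k => ⟨_, hinv k, rfl⟩⟩
  rintro k i ⟨u, hu⟩
  by_contra hcon
  push Not at hcon
  have hstay : ∀ d, state (st (k + d)).1 i = state (st k).1 i := by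
    intro d
    induction d with
    | zero => rfl
    | succ d ih =>
      rw [← Nat.add_assoc, hnext, Function.update_of_ne (hcon _ (by omega)).symm, ih]
  -- With `c` for the present counter, this advances it to `n * c + i`, which is at least `c` and is
  -- a turn of player `i`.
  obtain ⟨k₁, hk₁, hc⟩ := hcount (n * (st k).2 + i - (st k).2) k
  have hle : (st k).2 ≤ n * (st k).2 := Nat.le_mul_of_pos_left _ hn
  have hturn : turn (st k₁).2 = i := by
    apply Fin.ext
    change (st k₁).2 % n = i
    rw [hc, show (st k).2 + (n * (st k).2 + ↑i - (st k).2) = ↑i + n * (st k).2 by omega,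
      Nat.add_mul_mod_self_left, Nat.mod_eq_of_lt i.2]
  obtain ⟨k₂, hk₂, -, -, h4⟩ := hadv _ k₁ le_rfl
  rw [hturn] at h4
  rcases h4 with h4 | h4
  · exact hcon k₂ (by omega) h4
  · apply h4 u
    rw [hu]
    obtain ⟨d, rfl⟩ := Nat.exists_eq_add_of_le (hk₁.trans hk₂)
    exact (hstay d).symm

end BadRuns

/-! ### The strategy whose nodes are the histories of the players -/

section Unfolding

variable {P T : Type} {n : ℕ}

/-- The place reached by player `i` after the transitions of `l`, the last one first. -/
def endPlace (dst : T → P) (s₀ : Fin n → P) (i : Fin n) : List T → P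
  | [] => s₀ i
  | t :: _ => dst t

/-- The list `l` of transitions, the last one first, is a history of player `i` in which every
transition `t` was allowed by `A` after the transitions before it. -/
def IsHistory (src dst : T → P) (s₀ : Fin n → P) (A : List T → T → Prop) (i : Fin n) :
    List T → Prop
  | [] => True
  | t :: l => IsHistory src dst s₀ A i l ∧ src t = endPlace dst s₀ i l ∧ A l t

variable (src dst : T → P) (s₀ : Fin n → P) (A : List T → T → Prop)

/-- The net of the histories of all players. -/
def historyNet : PetriNet {x : Fin n × List T // IsHistory src dst s₀ A x.1 x.2}
    {x : Fin n × T × List T // IsHistory src dst s₀ A x.1 (x.2.1 :: x.2.2)} where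
  pre x := {⟨(x.1.1, x.1.2.2), x.2.1⟩}
  post x := {⟨(x.1.1, x.1.2.1 :: x.1.2.2), x.2⟩}
  init := stateMarking fun i => ⟨(i, []), trivial⟩

theorem historyNet_isAutonomous : IsAutonomous (historyNet src dst s₀ A) (fun p => p.1.1)
    (fun x => ⟨(x.1.1, x.1.2.2), x.2.1⟩) (fun x => ⟨(x.1.1, x.1.2.1 :: x.1.2.2), x.2⟩)
    (fun i => ⟨(i, []), trivial⟩) where
  pre_eq _ := rfl
  post_eq _ := rfl
  init_eq := rfl
  owner_init _ := rfl
  owner_dst _ := rfl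

/-- The player and the history belonging to a node of the net of histories. -/
def nodeHistory :
    {x : Fin n × List T // IsHistory src dst s₀ A x.1 x.2} ⊕
    {x : Fin n × T × List T // IsHistory src dst s₀ A x.1 (x.2.1 :: x.2.2)} → Fin n × List T
  | Sum.inl p => p.1
  | Sum.inr t => (t.1.1, t.1.2.1 :: t.1.2.2)

/-- Each flow step keeps the player and either keeps the history or adds its newest transition at
the front. Causal predecessors are therefore suffixes, which excludes conflicts within a history. -/
theorem nodeHistory_of_causalLE {x y} (h : (historyNet src dst s₀ A).CausalLE x y) :
    (nodeHistory src dst s₀ A x).1 = (nodeHistory src dst s₀ A y).1 ∧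
    (nodeHistory src dst s₀ A x).2 <:+ (nodeHistory src dst s₀ A y).2 := by
  induction h with
  | refl => exact ⟨rfl, List.suffix_rfl⟩
  | @tail y z _ hyz ih =>
    refine ⟨ih.1.trans ?_, ih.2.trans ?_⟩ <;> rcases y with p | t <;> rcases z with q | u <;>
      first
      | exact hyz.elim
      | (obtain rfl := Multiset.mem_singleton.1 hyz
         first
         | rfl
         | exact List.suffix_rfl
         | exact List.suffix_cons _ _)

theorem historyNet_isOccurrenceNet : (historyNet src dst s₀ A).IsOccurrenceNet where
  pre_nodup _ := Multiset.nodup_singleton _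
  post_nodup _ := Multiset.nodup_singleton _
  init_nodup := Multiset.Nodup.map (f := fun i =>
    (⟨(i, []), trivial⟩ : {x : Fin n × List T // IsHistory src dst s₀ A x.1 x.2}))
    (fun _ _ h => congrArg (fun x => x.1.1) h) Finset.univ.nodup
  mem_init_iff := by
    rintro ⟨⟨i, l⟩, hl⟩
    refine mem_stateMarking.trans ⟨?_, fun h => ?_⟩
    · rintro ⟨j, hj⟩ t ht
      have h1 := congrArg (fun x => x.1.2) hj
      have h2 := congrArg (fun x => x.1.2) (Multiset.mem_singleton.1 ht)
      dsimp only at h1 h2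
      rw [← h1] at h2
      cases h2
    · rcases l with _ | ⟨t, l⟩
      · exact ⟨i, rfl⟩
      · exact absurd (Multiset.mem_singleton.2 rfl) (h ⟨(i, t, l), hl⟩)
  existsUnique_producer := by
    rintro ⟨⟨i, l⟩, hl⟩ hp
    rcases l with _ | ⟨t, l⟩
    · exact absurd (mem_stateMarking.2 ⟨i, rfl⟩) hp
    · refine ⟨⟨(i, t, l), hl⟩, Multiset.mem_singleton.2 rfl, ?_⟩
      rintro ⟨⟨j, u, l'⟩, hu⟩ h
      have := congrArg (fun x => x.1) (Multiset.mem_singleton.1 h)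
      simp only [Prod.mk.injEq, List.cons.injEq] at this
      obtain ⟨rfl, rfl, rfl⟩ := this
      rfl
  wellFounded_flow := by
    -- Twice the length of a history ranks its place, and the odd numbers rank the transitions
    -- between places.
    refine Subrelation.wf (r := InvImage (· < ·) (Sum.elim (fun p => 2 * p.1.2.length)
      (fun t => 2 * t.1.2.2.length + 1))) ?_ (InvImage.wf _ wellFounded_lt)
    rintro (p | t) (q | u) h
    · exact h.elim
    · obtain rfl := Multiset.mem_singleton.1 h
      simp [InvImage]
    · obtain rfl := Multiset.mem_singleton.1 h
      simp [InvImage]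
      omega
    · exact h.elim
  no_self_conflict := by
    rintro t ⟨p, t₁, t₂, hne, h1, h2, h3, h4⟩
    have e1 := Multiset.mem_singleton.1 h1
    have e2 := Multiset.mem_singleton.1 h2
    have e := e1.symm.trans e2
    obtain ⟨⟨i, a, l⟩, ha⟩ := t₁
    obtain ⟨⟨j, b, l'⟩, hb⟩ := t₂
    simp only [Subtype.mk.injEq, Prod.mk.injEq] at e
    obtain ⟨rfl, rfl⟩ := e
    -- Two transitions from the same place that both precede `t` give suffixes of equal length of
    -- one history, so they coincide.
    have s1 := (nodeHistory_of_causalLE _ _ _ _ h3).2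
    have s2 := (nodeHistory_of_causalLE _ _ _ _ h4).2
    have := List.suffix_of_suffix_length_le s1 s2 le_rfl
    have := this.eq_of_length rfl
    simp only [nodeHistory, List.cons.injEq] at this
    obtain ⟨rfl, -⟩ := this
    exact hne rfl

variable {src dst s₀ A} {N : PetriNet P T} {owner : P → Fin n}

/-- The branching process of all histories of the players. -/
abbrev historyProcess (h : IsAutonomous N owner src dst s₀) (A : List T → T → Prop) :
    BranchingProcess N where
  Place := _
  Trans := _
  net := historyNet src dst s₀ A
  placeLabel x := endPlace dst s₀ x.1.1 x.1.2
  transLabel x := x.1.2.1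
  isOccurrenceNet := historyNet_isOccurrenceNet _ _ _ _
  map_pre t := by
    rw [h.pre_eq, t.2.2.1]; rfl
  map_post t := by
    rw [h.post_eq]; rfl
  map_init := by
    rw [h.init_eq]
    exact stateMarking_map _ _
  trans_injective := by
    rintro ⟨⟨i, a, l⟩, ha⟩ ⟨⟨j, b, l'⟩, hb⟩ h1 h2
    have e := Multiset.singleton_inj.1 h1
    simp only [Subtype.mk.injEq, Prod.mk.injEq] at e
    obtain ⟨rfl, rfl⟩ := e
    obtain rfl : a = b := h2
    rfl

/-- Preconditions are single places, so a missing transition was forbidden by `A` at a system place,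
which justifies the refusal. Determinism holds because a system place has at most one outgoing
transition altogether. -/
theorem historyProcess_isStrategy {G : PetriGame P T}
    (h : IsAutonomous G.toPetriNet owner src dst s₀)
    (henv : ∀ l t, src t ∉ G.system → A l t)
    (hsys : ∀ l t t', src t = src t' → src t ∈ G.system → A l t → A l t' → t = t') :
    IsStrategy G (historyProcess h A) where
  justifiedRefusal C t _ hC := by
    rw [h.pre_eq, Multiset.map_eq_singleton] at hC
    obtain ⟨⟨⟨i, l⟩, hl⟩, hp, hpt⟩ := hC
    change endPlace dst s₀ i l = src t at hpt
    by_cases hA : A l t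
    · exact Or.inl ⟨⟨(i, t, l), hl, hpt.symm, hA⟩, rfl, hp.symm⟩
    · refine Or.inr ⟨⟨(i, l), hl⟩, ?_, ?_, ?_⟩
      · change _ ∈ C.val
        rw [hp]
        exact Multiset.mem_singleton_self _
      · change endPlace dst s₀ i l ∈ _
        rw [hpt]
        by_contra hs
        exact hA (henv l t hs)
      · rintro ⟨⟨j, u, l'⟩, hu⟩ hm rfl
        have e := Multiset.mem_singleton.1 hm
        simp only [Subtype.mk.injEq, Prod.mk.injEq] at e
        obtain ⟨rfl, rfl⟩ := e
        exact hA hu.2.2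
  deterministic := by
    rintro M - ⟨⟨i, l⟩, hl⟩ - hs ⟨⟨j, a, l₁⟩, ha⟩ ⟨⟨k, b, l₂⟩, hb⟩ h1 h2 - -
    have e1 := Multiset.mem_singleton.1 h1
    have e2 := Multiset.mem_singleton.1 h2
    simp only [Subtype.mk.injEq, Prod.mk.injEq] at e1 e2
    obtain ⟨rfl, rfl⟩ := e1
    obtain ⟨rfl, rfl⟩ := e2
    obtain rfl := hsys l a b (ha.2.1.trans hb.2.1.symm) (by rw [ha.2.1]; exact hs) ha.2.2 hb.2.2
    rfl

/-- The places of a run carry their histories, so fairness can be stated as growth in length: a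
player with a possible extension eventually has a longer history. -/
theorem historyProcess_isWinning {G : PetriGame P T}
    (h : IsAutonomous G.toPetriNet owner src dst s₀)
    (H : ∀ g : ℕ → Fin n → List T, (∀ i, g 0 i = []) →
      (∀ k i, IsHistory src dst s₀ A i (g k i)) →
      (∀ k, g (k + 1) = g k ∨ ∃ i t, IsHistory src dst s₀ A i (t :: g k i) ∧
        g (k + 1) = Function.update (g k) i (t :: g k i)) →
      (∀ k i t, IsHistory src dst s₀ A i (t :: g k i) → ∃ j, (g k i).length < (g j i).length) →
      ∃ k, stateMarking (fun i => endPlace dst s₀ i (g k i)) ∈ G.good) :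
    IsWinning G (historyProcess h A) := by
  refine isWinning_of_states (σ := historyProcess h A) (historyNet_isAutonomous src dst s₀ A) ?_
  intro f hf0 hstep hfair
  have hown : ∀ k i, (f k i).1.1 = i := by
    intro k
    induction k with
    | zero => intro i; rw [hf0]
    | succ k ih =>
      intro i
      rcases hstep k with h1 | ⟨t, j, h1, h2⟩
      · rw [h1, ih]
      · rw [h2]
        by_cases hi : i = j
        · subst hi
          rw [Function.update_self]
          have : t.1.1 = (f k i).1.1 := congrArg (fun x => x.1.1) h1
          exact this.trans (ih i)
        · rw [Function.update_of_ne hi, ih]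
  suffices hgood : ∃ k, stateMarking (fun i => endPlace dst s₀ i (f k i).1.2) ∈ G.good by
    obtain ⟨k, hk⟩ := hgood
    refine ⟨k, ?_⟩
    convert hk using 3 with i
    change endPlace dst s₀ (f k i).1.1 (f k i).1.2 = _
    rw [hown]
  refine H (fun k i => (f k i).1.2) ?_ ?_ ?_ ?_
  · intro i
    rw [hf0]
  · intro k i
    have := (f k i).2
    rwa [hown] at this
  · intro k
    rcases hstep k with h1 | ⟨t, j, h1, h2⟩
    · left; rw [h1]
    · right
      have e1 : t.1.1 = (f k j).1.1 := congrArg (fun x => x.1.1) h1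
      have e2 : t.1.2.2 = (f k j).1.2 := congrArg (fun x => x.1.2) h1
      have e3 := t.2
      rw [e1, e2, hown] at e3
      refine ⟨j, t.1.2.1, e3, ?_⟩
      funext i
      rw [h2]
      by_cases hi : i = j
      · subst hi
        rw [Function.update_self, Function.update_self, ← e2]
      · rw [Function.update_of_ne hi, Function.update_of_ne hi]
  · intro k i t ht
    obtain ⟨j, -, t', h1, h2⟩ := hfair k i ⟨((f k i).1.1, t, (f k i).1.2), by
      rw [hown]; exact ht⟩ rfl
    refine ⟨j + 1, ?_⟩
    have e2 : t'.1.2.2 = (f k i).1.2 := congrArg (fun x => x.1.2) h1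
    rw [h2, ← e2]
    simp

end Unfolding

end PetriGames

/-! ### The tiling problem and its game -/

namespace PetriGames

/-- A system of tiles that are laid along a helix: `hor` relates a tile to the next one, `ver` to
the one above it; the first turn of the helix consists of initial tiles. -/
structure TileSystem (L : Type) where
  start : L
  initial : L → Bool
  hor : L → L → Bool
  ver : L → L → Bool
  accept : L → Bool

/-- Tiles from the list `letters` can be laid along a helix with turns of length `d`, from the start
tile to an accepting one. -/
def TileSystem.Solvable {L : Type} (S : TileSystem L) (letters : List L) : Prop :=
  ∃ (m d : ℕ) (x : ℕ → L), 0 < d ∧ d ≤ m ∧ Even d ∧ x 0 = S.start ∧ (∀ j ≤ m, x j ∈ letters) ∧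
    (∀ j ≤ m, S.initial (x j) = true ↔ j < d) ∧
    (∀ j < m, x (j + 1) ≠ S.start ∧ S.hor (x j) (x (j + 1)) = true) ∧
    (∀ j, j + d ≤ m → S.ver (x j) (x (j + d)) = true) ∧ S.accept (x m) = true

/-- The positions of a writing player: `none` after its last tile; `some (σ, c, false)` when it has
written the tile `σ`, and `some (σ, c, true)` when it is to choose the next one. The bit `c` is the
parity of the number of tiles before `σ`. -/
abbrev Pos (L : Type) : Type := Option (L × Bool × Bool)

/-- The states of the automata of all players: `Sum.inl` is used for the environment player and for
the players that do not write. -/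
abbrev Loc (L : Type) : Type := Fin 8 ⊕ Pos L

section Positions

variable {L : Type} [DecidableEq L] (S : TileSystem L)

/-- The second player is one step ahead, modulo four. -/
def ahead : Pos L → Pos L → Bool
  | none, _ => false
  | some x, none => x.2.2
  | some x, some y => (y.2.1 == (x.2.1 ^^ x.2.2)) && (y.2.2 == !x.2.2)

/-- The tile `τ` may follow the tile `σ` written at a place of parity `c`. -/
def TileSystem.follows (c : Bool) (σ τ : L) : Bool :=
  S.hor σ τ && (!(S.initial τ) || S.initial σ) && !(decide (τ = S.start)) &&
    -- The last initial tile must have an odd index. So the first turn has even length, tiles one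
    -- above the other carry equal parity bits, and a turn takes a multiple of four steps.
    (!(S.initial σ) || S.initial τ || c)

/-- The tiles just written by the players differ, or the one of the first player may not follow the
one of the second player. -/
def TileSystem.mismatch : Pos L → Pos L → Bool
  | none, _ => false
  -- The second player may not have finished when the first has just written a further tile.
  | some x, none => !x.2.2
  | some x, some y => !x.2.2 && !y.2.2 &&
      -- In step, equal parity bits mean the same index; different bits mean that the first player
      -- is exactly one tile ahead.
      (if x.2.1 = y.2.1 then !(decide (x.1 = y.1)) else !(S.follows y.2.1 y.1 x.1))

/-- The first player is at most two steps ahead, not counting its initial tiles. -/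
def TileSystem.inStep (p q : Pos L) : Bool :=
  match p with
  | none => true
  | some x => if S.initial x.1 = true then decide (q = some (S.start, false, false))
      else !(ahead p q)

/-- The tile of the first player may not lie above the one of the second player. -/
def TileSystem.verMismatch : Pos L → Pos L → Bool
  | none, _ => false
  | some _, none => false
  | some x, some y => !x.2.2 && !y.2.2 && !(S.initial x.1) && (x.2.1 == y.2.1) && !(S.ver y.1 x.1)

def isChoice : Pos L → Bool
  | none => false
  | some x => x.2.2

/-- The winning condition. The environment player first chooses between comparing the tiles (state
`1`) and checking the vertical relation (state `3`). It claims a violation in the states `2` and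
`4`, and that a player has stopped writing in the states `5` and `6`. -/
def TileSystem.goodPos (a : Fin 8) (p q : Pos L) : Bool :=
  (decide (a = 0) && !(decide (p = some (S.start, false, false)) &&
      decide (q = some (S.start, false, false)))) ||
  -- A lead of 0, 1 or 2 steps is not good, the residue 3 is. A second player who overtakes and a
  -- first player who gets three steps ahead both produce this residue.
  (decide (a = 1) && (decide (p = none) || ahead p q)) ||
  (decide (a = 2) && !(S.mismatch p q)) ||
  (decide (a = 3) && (decide (p = none) || !(S.inStep p q))) ||
  (decide (a = 4) && !(S.verMismatch p q)) ||
  -- A false claim of having stopped is refuted by fairness: a writer who can move leaves its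
  -- choice.
  (decide (a = 5) && !(isChoice p)) ||
  (decide (a = 6) && !(isChoice q))

/-- The transitions of the environment player. -/
def envEdge (a b : Fin 8) : Bool :=
  -- Idling keeps every run extendable to an infinite one. In state 7, which is never left, no
  -- marking is good.
  decide (a = b ∨ (a, b) ∈ ([(0, 1), (0, 3), (1, 2), (1, 5), (1, 6), (2, 7), (3, 4), (4, 7)] :
    List (Fin 8 × Fin 8)))

/-- The transitions of the writing players. -/
def TileSystem.posEdge : Pos L → Pos L → Bool
  | none, _ => false
  | some x, none => x.2.2 && S.accept x.1 && !(S.initial x.1)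
  -- Any tile may be chosen next: the tile relations are not built into the moves but enforced by
  -- the claims of the environment player.
  | some x, some y => (!x.2.2 && decide (y = (x.1, x.2.1, true))) ||
      (x.2.2 && !y.2.2 && (y.2.1 == !x.2.1))

/-- The transitions of player `i`: player `0` is the environment player, the players `1` and `2`
write, and all other players can only move to the state `1`. -/
def TileSystem.locEdge (i : ℕ) : Loc L → Loc L → Bool
  | Sum.inl a, Sum.inl b => (decide (i = 0) && envEdge a b) ||
      (decide (3 ≤ i) && decide (a = 0) && decide (b = 1))
  | Sum.inr p, Sum.inr q => decide (i = 1 ∨ i = 2) && S.posEdge p q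
  | _, _ => false

/-- The system places. -/
def isSystem (i : ℕ) : Loc L → Bool
  | Sum.inl a => decide (3 ≤ i) && decide (a = 0)
  | Sum.inr p => decide (i = 1 ∨ i = 2) && isChoice p

/-- The initial places. -/
def TileSystem.initLoc (i : ℕ) : Loc L :=
  if i = 1 ∨ i = 2 then Sum.inr (some (S.start, false, false)) else Sum.inl 0

/-- The good states. -/
def TileSystem.IsGood {r : ℕ} (s : Fin (r + 3) → Loc L) : Prop :=
  ∃ a p q, s 0 = Sum.inl a ∧ s 1 = Sum.inr p ∧ s 2 = Sum.inr q ∧ S.goodPos a p q = true ∧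
    ∀ i : Fin (r + 3), 3 ≤ i.val → s i = Sum.inl 0

end Positions

/-- The parity bits of a writing player after `h` steps. -/
def clock (h : ℕ) : Bool × Bool := (decide (h / 2 % 2 = 1), decide (h % 2 = 1))

/-- The two bits of a position are the number of steps modulo four, written in binary, so `ahead`
can be evaluated on the sixteen pairs of residues. -/
theorem ahead_clock {L : Type} (a b : ℕ) (σ τ : L) :
    ahead (some (σ, clock a)) (some (τ, clock b)) = decide (b % 4 = (a + 1) % 4) := by
  have key : ∀ a : ℕ, clock a = clock (a % 4) := by
    intro a
    simp only [clock, Prod.mk.injEq, decide_eq_decide]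
    omega
  rw [key a, key b, Nat.add_mod a 1 4]
  have ha : a % 4 < 4 := Nat.mod_lt _ (by norm_num)
  have hb : b % 4 < 4 := Nat.mod_lt _ (by norm_num)
  generalize a % 4 = a' at *
  generalize b % 4 = b' at *
  interval_cases a' <;> interval_cases b' <;> rfl

/-- The game `G`, whose places are labelled by players and states, is the game played for the tiles
`letters` of `S`. -/
structure IsTileGame {L P T : Type} [DecidableEq L] {r : ℕ} (S : TileSystem L) (letters : List L)
    (G : PetriGame P T) (lab : P → Fin (r + 3) × Loc L) (src dst : T → P)
    (s₀ : Fin (r + 3) → P) : Prop where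
  lab_injective : Function.Injective lab
  mem_letters : ∀ p σ c, (lab p).2 = Sum.inr (some (σ, c)) → σ ∈ letters
  autonomous : IsAutonomous G.toPetriNet (fun p => (lab p).1) src dst s₀
  lab_init : ∀ i, lab (s₀ i) = (i, S.initLoc i)
  edge : ∀ t, S.locEdge (lab (src t)).1 (lab (src t)).2 (lab (dst t)).2 = true
  exists_edge : ∀ p y, S.locEdge (lab p).1 (lab p).2 y = true →
    (∀ σ c, y = Sum.inr (some (σ, c)) → σ ∈ letters) →
    ∃ t, src t = p ∧ (lab (dst t)).2 = y
  trans_ext : ∀ t t', src t = src t' → dst t = dst t' → t = t'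
  mem_system : ∀ p, p ∈ G.system ↔ isSystem (lab p).1 (lab p).2 = true
  good_state : ∀ M ∈ G.good, ∃ s : Fin (r + 3) → P, (∀ i, (lab (s i)).1 = i) ∧ M = stateMarking s
  mem_good : ∀ s : Fin (r + 3) → P, (∀ i, (lab (s i)).1 = i) →
    (stateMarking s ∈ G.good ↔ S.IsGood fun i => (lab (s i)).2)

end PetriGames

/-! ### What a winning strategy cannot avoid -/

namespace PetriGames

/-- An unfolding of the game for the tiles `letters` of `S`, labelled by players and states, in which
every transition of the environment is possible and every fair run visits a good state. -/
structure IsWonUnfolding {L P T : Type} [DecidableEq L] {r : ℕ} (S : TileSystem L)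
    (letters : List L) (lab : P → Fin (r + 3) × Loc L) (src dst : T → P)
    (s₀ : Fin (r + 3) → P) : Prop where
  mem_letters : ∀ p σ c, (lab p).2 = Sum.inr (some (σ, c)) → σ ∈ letters
  owner_dst : ∀ t, (lab (dst t)).1 = (lab (src t)).1
  lab_init : ∀ i, lab (s₀ i) = (i, S.initLoc i)
  edge : ∀ t, S.locEdge (lab (src t)).1 (lab (src t)).2 (lab (dst t)).2 = true
  exists_edge : ∀ p y, isSystem (lab p).1 (lab p).2 = false →
    S.locEdge (lab p).1 (lab p).2 y = true →
    (∀ σ c, y = Sum.inr (some (σ, c)) → σ ∈ letters) →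
    ∃ t, src t = p ∧ (lab (dst t)).2 = y
  no_run : ¬ HasRunWithin src dst (fun s => ¬ S.IsGood fun i => (lab (s i)).2) s₀

/-- The place reached by an arbitrary transition from `p`, or `p` if there is none. -/
noncomputable def nextPlace {P T : Type} (src dst : T → P) (p : P) : P := by
  classical exact if h : ∃ t, src t = p then dst h.choose else p

/-- The place reached from `p` after `k` transitions. -/
noncomputable def pathPlace {P T : Type} (src dst : T → P) (p : P) (k : ℕ) : P :=
  (nextPlace src dst)^[k] p

theorem pathPlace_succ {P T : Type} (src dst : T → P) (p : P) (k : ℕ) :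
    (∃ t, src t = pathPlace src dst p k ∧ dst t = pathPlace src dst p (k + 1)) ∨
    ((∀ t, src t ≠ pathPlace src dst p k) ∧
      pathPlace src dst p (k + 1) = pathPlace src dst p k) := by
  have h1 : pathPlace src dst p (k + 1) = nextPlace src dst (pathPlace src dst p k) :=
    Function.iterate_succ_apply' _ _ _
  rw [h1]
  by_cases h : ∃ t, src t = pathPlace src dst p k
  · left
    refine ⟨h.choose, h.choose_spec, ?_⟩
    rw [nextPlace, dif_pos h]
  · right
    refine ⟨fun t ht => h ⟨t, ht⟩, ?_⟩
    rw [nextPlace, dif_neg h]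

/-- The state in which the first three players are on the places `x`, `p`, `q` and all others are on
the places given by `s`. -/
def state3 {P : Type} {r : ℕ} (s : Fin (r + 3) → P) (x p q : P) : Fin (r + 3) → P := fun i =>
  if i = 0 then x else if i = 1 then p else if i = 2 then q else s i

section State3

variable {P : Type} {r : ℕ} (s : Fin (r + 3) → P) (x p q y : P)

theorem fin_one_ne_zero : (1 : Fin (r + 3)) ≠ 0 := by simp

theorem val_fin_two : (2 : Fin (r + 3)).val = 2 :=
  Nat.mod_eq_of_lt (by omega : 2 < r + 3)

theorem fin_two_ne_zero : (2 : Fin (r + 3)) ≠ 0 := by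
  rw [Ne, Fin.ext_iff, val_fin_two]; simp

theorem fin_two_ne_one : (2 : Fin (r + 3)) ≠ 1 := by
  rw [Ne, Fin.ext_iff, val_fin_two]; simp

theorem state3_zero : state3 s x p q 0 = x := by simp [state3]

theorem state3_one : state3 s x p q 1 = p := by simp [state3]

theorem state3_two : state3 s x p q 2 = q := by
  simp [state3, fin_two_ne_zero, fin_two_ne_one]

theorem update_state3_zero : Function.update (state3 s x p q) 0 y = state3 s y p q := by
  funext i
  by_cases h : i = 0
  · subst h; simp [state3]
  · rw [Function.update_of_ne h]; simp [state3, h]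

theorem update_state3_one : Function.update (state3 s x p q) 1 y = state3 s x y q := by
  funext i
  by_cases h : i = 1
  · subst h; simp [state3]
  · rw [Function.update_of_ne h]; simp [state3, h]

theorem update_state3_two : Function.update (state3 s x p q) 2 y = state3 s x p y := by
  funext i
  by_cases h : i = 2
  · subst h; simp [state3, fin_two_ne_zero, fin_two_ne_one]
  · rw [Function.update_of_ne h]; simp [state3, h]

theorem state3_self : state3 s (s 0) (s 1) (s 2) = s := by
  funext i
  simp only [state3]
  split_ifs with h0 h1 h2
  · rw [h0]
  · rw [h1]
  · rw [h2]
  · rfl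

end State3

namespace IsWonUnfolding

variable {L P T : Type} [DecidableEq L] {r : ℕ} {S : TileSystem L}
  {letters : List L} {lab : P → Fin (r + 3) × Loc L} {src dst : T → P} {s₀ : Fin (r + 3) → P}

/-- The position of a writing player. -/
def posOf (lab : P → Fin (r + 3) × Loc L) (p : P) : Pos L := (lab p).2.elim (fun _ => none) id

theorem exists_env_edge (H : IsWonUnfolding S letters lab src dst s₀) {x : P} {a b : Fin 8}
    (hx : lab x = (0, Sum.inl a)) (hab : envEdge a b = true) :
    ∃ t, src t = x ∧ lab (dst t) = (0, Sum.inl b) := by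
  obtain ⟨t, h1, h2⟩ := H.exists_edge x (Sum.inl b) (by simp [hx, isSystem])
    (by simp [hx, TileSystem.locEdge, hab]) (by simp)
  exact ⟨t, h1, Prod.ext (by rw [H.owner_dst, h1, hx]) h2⟩

theorem env_dst (H : IsWonUnfolding S letters lab src dst s₀) {t : T} {a : Fin 8}
    (hx : lab (src t) = (0, Sum.inl a)) :
    ∃ b, lab (dst t) = (0, Sum.inl b) ∧ envEdge a b = true := by
  have h1 := H.owner_dst t
  have h2 := H.edge t
  rw [hx] at h1 h2
  rcases h : lab (dst t) with ⟨i, b | q⟩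
  · rw [h] at h1 h2
    dsimp only at h1 h2
    subst h1
    simp [TileSystem.locEdge] at h2
    exact ⟨b, rfl, h2⟩
  · rw [h] at h2
    simp [TileSystem.locEdge] at h2

theorem writer_dst (H : IsWonUnfolding S letters lab src dst s₀) {t : T} {i : Fin (r + 3)}
    {p : Pos L} (hx : lab (src t) = (i, Sum.inr p)) :
    ∃ q, lab (dst t) = (i, Sum.inr q) ∧ S.posEdge p q = true := by
  have h1 := H.owner_dst t
  have h2 := H.edge t
  rw [hx] at h1 h2
  rcases h : lab (dst t) with ⟨j, b | q⟩
  · rw [h] at h2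
    simp [TileSystem.locEdge] at h2
  · rw [h] at h1 h2
    dsimp only at h1 h2
    subst h1
    simp only [TileSystem.locEdge, Bool.and_eq_true] at h2
    exact ⟨q, rfl, h2.2⟩

theorem lab_path (H : IsWonUnfolding S letters lab src dst s₀) {i : Fin (r + 3)}
    (hi : i = 1 ∨ i = 2) (k : ℕ) : lab (pathPlace src dst (s₀ i) k) =
      (i, Sum.inr (posOf lab (pathPlace src dst (s₀ i) k))) := by
  have hi' : i.val = 1 ∨ i.val = 2 := by
    rcases hi with rfl | rfl <;> simp
  induction k with
  | zero =>
    change lab (s₀ i) = (i, Sum.inr (posOf lab (s₀ i)))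
    simp [H.lab_init, posOf, TileSystem.initLoc, hi']
  | succ k ih =>
    rcases pathPlace_succ src dst (s₀ i) k with ⟨t, h1, h2⟩ | ⟨h1, h2⟩
    · rw [← h1] at ih
      obtain ⟨q, hq, -⟩ := H.writer_dst ih
      rw [← h2, hq, posOf, hq]
      rfl
    · rw [h2, ih]

theorem posOf_path_zero (H : IsWonUnfolding S letters lab src dst s₀) {i : Fin (r + 3)}
    (hi : i = 1 ∨ i = 2) :
    posOf lab (pathPlace src dst (s₀ i) 0) = some (S.start, false, false) := by
  have hi' : i.val = 1 ∨ i.val = 2 := by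
    rcases hi with rfl | rfl <;> simp
  change posOf lab (s₀ i) = _
  simp [H.lab_init, posOf, TileSystem.initLoc, hi']

theorem path_step (H : IsWonUnfolding S letters lab src dst s₀) {i : Fin (r + 3)}
    (hi : i = 1 ∨ i = 2) (k : ℕ) (hk : ∃ t, src t = pathPlace src dst (s₀ i) k) :
    ∃ t, src t = pathPlace src dst (s₀ i) k ∧ dst t = pathPlace src dst (s₀ i) (k + 1) ∧
      S.posEdge (posOf lab (pathPlace src dst (s₀ i) k))
        (posOf lab (pathPlace src dst (s₀ i) (k + 1))) = true := by
  rcases pathPlace_succ src dst (s₀ i) k with ⟨t, h1, h2⟩ | ⟨h1, h2⟩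
  · refine ⟨t, h1, h2, ?_⟩
    have h3 := H.lab_path hi k
    rw [← h1] at h3
    obtain ⟨q, hq, hq'⟩ := H.writer_dst h3
    rw [← h2, ← h1]
    have : posOf lab (dst t) = q := by rw [posOf, hq]; rfl
    rwa [this]
  · obtain ⟨t, ht⟩ := hk
    exact absurd ht (h1 t)

/-- A place where a tile has just been written belongs to the environment, so the move from it
cannot be refused, and `posEdge` allows only one target. -/
theorem path_step_letter (H : IsWonUnfolding S letters lab src dst s₀) {i : Fin (r + 3)}
    (hi : i = 1 ∨ i = 2) {k : ℕ} {σ : L} {c : Bool}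
    (hk : posOf lab (pathPlace src dst (s₀ i) k) = some (σ, c, false)) :
    posOf lab (pathPlace src dst (s₀ i) (k + 1)) = some (σ, c, true) ∧
    ∃ t, src t = pathPlace src dst (s₀ i) k ∧ dst t = pathPlace src dst (s₀ i) (k + 1) := by
  have hi' : i.val = 1 ∨ i.val = 2 := by
    rcases hi with rfl | rfl <;> simp
  have hl := H.lab_path hi k
  rw [hk] at hl
  obtain ⟨t, ht, -⟩ := H.exists_edge (pathPlace src dst (s₀ i) k) (Sum.inr (some (σ, c, true)))
    (by simp [hl, isSystem, isChoice])
    (by simp [hl, TileSystem.locEdge, TileSystem.posEdge, hi'])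
    (by
      intro τ b h
      simp only [Sum.inr.injEq, Option.some.injEq, Prod.mk.injEq] at h
      exact H.mem_letters _ σ (c, false) (by rw [hl]) |> (h.1 ▸ ·))
  obtain ⟨t, h1, h2, h3⟩ := H.path_step hi k ⟨t, ht⟩
  refine ⟨?_, t, h1, h2⟩
  rw [hk] at h3
  rcases h : posOf lab (pathPlace src dst (s₀ i) (k + 1)) with _ | y
  · rw [h] at h3; simp [TileSystem.posEdge] at h3
  · rw [h] at h3; simp [TileSystem.posEdge] at h3; rw [h3]

theorem path_step_choice (H : IsWonUnfolding S letters lab src dst s₀) {i : Fin (r + 3)}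
    (hi : i = 1 ∨ i = 2) {k : ℕ} {σ : L} {c : Bool}
    (hk : posOf lab (pathPlace src dst (s₀ i) k) = some (σ, c, true))
    (hex : ∃ t, src t = pathPlace src dst (s₀ i) k) :
    ((posOf lab (pathPlace src dst (s₀ i) (k + 1)) = none ∧ S.accept σ = true ∧
      S.initial σ = false) ∨
      ∃ τ, posOf lab (pathPlace src dst (s₀ i) (k + 1)) = some (τ, !c, false)) ∧
    ∃ t, src t = pathPlace src dst (s₀ i) k ∧ dst t = pathPlace src dst (s₀ i) (k + 1) := by
  obtain ⟨t, h1, h2, h3⟩ := H.path_step hi k hex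
  refine ⟨?_, t, h1, h2⟩
  rw [hk] at h3
  rcases h : posOf lab (pathPlace src dst (s₀ i) (k + 1)) with _ | ⟨τ, c', b⟩
  · rw [h] at h3
    simp [TileSystem.posEdge] at h3
    exact Or.inl ⟨rfl, h3⟩
  · rw [h] at h3
    simp [TileSystem.posEdge] at h3
    exact Or.inr ⟨τ, by rw [h3.1, h3.2]⟩

/-- There is no way for the environment to win from the given places of the first three
players. -/
def Safe (S : TileSystem L) (lab : P → Fin (r + 3) × Loc L) (src dst : T → P)
    (s₀ : Fin (r + 3) → P) (x p q : P) : Prop :=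
  ¬ HasRunWithin src dst (fun s => ¬ S.IsGood fun i => (lab (s i)).2) (state3 s₀ x p q)

theorem not_isGood {s : Fin (r + 3) → P} {a : Fin 8} (h0 : lab (s 0) = (0, Sum.inl a))
    (h : S.goodPos a (posOf lab (s 1)) (posOf lab (s 2)) = false) :
    ¬ S.IsGood fun i => (lab (s i)).2 := by
  rintro ⟨a', p, q, e0, e1, e2, e3, -⟩
  dsimp only at e0 e1 e2
  rw [h0, Sum.inl.injEq] at e0
  subst e0
  rw [posOf, posOf, e1, e2] at h
  simp [e3] at h

/-- A run without good states after the move would become one before the move by prefixing the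
present state, which is not good. So the environment may steer through such states, and the strategy
must stay safe. -/
theorem Safe.move {x p q : P} {a : Fin 8} (hs : Safe S lab src dst s₀ x p q)
    (h0 : lab x = (0, Sum.inl a)) (h : S.goodPos a (posOf lab p) (posOf lab q) = false)
    {i : Fin (r + 3)} {t : T} (ht : src t = state3 s₀ x p q i) :
    ¬ HasRunWithin src dst (fun s => ¬ S.IsGood fun i => (lab (s i)).2)
      (Function.update (state3 s₀ x p q) i (dst t)) := fun hr =>
  hs (hr.cons (not_isGood (by rw [state3_zero, h0]) (by rw [state3_one, state3_two, h])) ht)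

theorem Safe.move_env (H : IsWonUnfolding S letters lab src dst s₀) {x p q : P} {a b : Fin 8}
    (hs : Safe S lab src dst s₀ x p q) (h0 : lab x = (0, Sum.inl a))
    (h : S.goodPos a (posOf lab p) (posOf lab q) = false) (hab : envEdge a b = true) :
    ∃ y, lab y = (0, Sum.inl b) ∧ Safe S lab src dst s₀ y p q := by
  obtain ⟨t, ht, hb⟩ := H.exists_env_edge h0 hab
  refine ⟨dst t, hb, ?_⟩
  have := hs.move h0 h (i := 0) (t := t) (by rw [state3_zero, ht])
  rwa [update_state3_zero] at this

theorem Safe.move_one {x p q : P} {a : Fin 8} (hs : Safe S lab src dst s₀ x p q)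
    (h0 : lab x = (0, Sum.inl a)) (h : S.goodPos a (posOf lab p) (posOf lab q) = false)
    {p' : P} (ht : ∃ t, src t = p ∧ dst t = p') : Safe S lab src dst s₀ x p' q := by
  obtain ⟨t, ht, rfl⟩ := ht
  have := hs.move h0 h (i := 1) (t := t) (by rw [state3_one, ht])
  rwa [update_state3_one] at this

theorem Safe.move_two {x p q : P} {a : Fin 8} (hs : Safe S lab src dst s₀ x p q)
    (h0 : lab x = (0, Sum.inl a)) (h : S.goodPos a (posOf lab p) (posOf lab q) = false)
    {q' : P} (ht : ∃ t, src t = q ∧ dst t = q') : Safe S lab src dst s₀ x p q' := by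
  obtain ⟨t, ht, rfl⟩ := ht
  have := hs.move h0 h (i := 2) (t := t) (by rw [state3_two, ht])
  rwa [update_state3_two] at this

/-- The environment wins if it controls an invariant without good states that no transition
leaves. -/
theorem not_safe_of_trap (H : IsWonUnfolding S letters lab src dst s₀)
    {Inv : (Fin (r + 3) → P) → Prop}
    (henv : ∀ s, Inv s → ∃ a, lab (s 0) = (0, Sum.inl a) ∧
      S.goodPos a (posOf lab (s 1)) (posOf lab (s 2)) = false)
    (hclosed : ∀ s i t, Inv s → src t = s i → Inv (Function.update s i (dst t)))
    {x p q : P} (h : Inv (state3 s₀ x p q)) : ¬ Safe S lab src dst s₀ x p q := by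
  intro hs
  refine hs (HasRunWithin.mono ?_ (hasRunWithin_of_invariant (Inv := Inv) id (fun _ _ => 0) ?_ h 0))
  · rintro s ⟨s', hs', rfl⟩
    obtain ⟨a, h1, h2⟩ := henv s' hs'
    exact not_isGood h1 h2
  · intro s i hs
    by_cases hi : ∃ t, src t = s i
    · obtain ⟨t, ht⟩ := hi
      exact ⟨_, t, i, ht, rfl, hclosed s i t hs ht, Or.inl rfl⟩
    · obtain ⟨a, h1, -⟩ := henv s hs
      obtain ⟨t, ht, -⟩ := H.exists_env_edge h1 (b := a) (by simp [envEdge])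
      exact ⟨_, t, 0, ht, rfl, hclosed s 0 t hs ht, Or.inr (Or.inl fun u hu => hi ⟨u, hu⟩)⟩

theorem goodPos_seven (p q : Pos L) : S.goodPos 7 p q = false := by
  simp [TileSystem.goodPos]

theorem envEdge_of_final {a b : Fin 8} (ha : a = 5 ∨ a = 6 ∨ a = 7) (h : envEdge a b = true) :
    b = a := by
  revert a b
  decide

/-- The environment wins if it has correctly claimed a violation. -/
theorem not_safe_dead (H : IsWonUnfolding S letters lab src dst s₀) {x p q : P}
    (hx : lab x = (0, Sum.inl 7)) : ¬ Safe S lab src dst s₀ x p q := by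
  refine H.not_safe_of_trap (Inv := fun s => lab (s 0) = (0, Sum.inl 7))
    (fun s hs => ⟨7, hs, goodPos_seven _ _⟩) (fun s i t hs ht => ?_) (by rwa [state3_zero])
  by_cases hi : i = 0
  · subst hi
    rw [Function.update_self]
    obtain ⟨b, hb, hab⟩ := H.env_dst (t := t) (by rw [ht, hs])
    rw [hb, envEdge_of_final (by simp) hab]
  · rwa [Function.update_of_ne (Ne.symm hi)]

/-- The environment wins if it has correctly claimed that player `j` stopped writing. -/
theorem not_safe_stuck (H : IsWonUnfolding S letters lab src dst s₀) {x p q : P} {a : Fin 8}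
    {j : Fin (r + 3)} (ha : a = 5 ∧ j = 1 ∨ a = 6 ∧ j = 2) (hx : lab x = (0, Sum.inl a))
    (hp : isChoice (posOf lab (state3 s₀ x p q j)) = true)
    (hst : ∀ t, src t ≠ state3 s₀ x p q j) :
    ¬ Safe S lab src dst s₀ x p q := by
  have hj : j ≠ 0 := by
    rcases ha with ⟨-, rfl⟩ | ⟨-, rfl⟩
    · exact fin_one_ne_zero
    · exact fin_two_ne_zero
  refine H.not_safe_of_trap (Inv := fun s => lab (s 0) = (0, Sum.inl a) ∧
      isChoice (posOf lab (s j)) = true ∧ ∀ t, src t ≠ s j)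
    (fun s hs => ⟨a, hs.1, ?_⟩) (fun s i t hs ht => ?_) ⟨by rwa [state3_zero], hp, hst⟩
  · rcases ha with ⟨rfl, rfl⟩ | ⟨rfl, rfl⟩ <;> simp [TileSystem.goodPos, hs.2.1]
  · have hij : i ≠ j := by
      rintro rfl
      exact hs.2.2 t ht
    rw [Function.update_of_ne (Ne.symm hij)]
    refine ⟨?_, hs.2⟩
    by_cases hi : i = 0
    · subst hi
      rw [Function.update_self]
      obtain ⟨b, hb, hab⟩ := H.env_dst (t := t) (by rw [ht, hs.1])
      rw [hb, envEdge_of_final (by rcases ha with h | h <;> simp [h.1]) hab]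
    · rw [Function.update_of_ne (Ne.symm hi)]
      exact hs.1

/-- If the first writer were stuck at its choice, the environment player would move to state 5 and
rest there: no other player can change the place on which the claim depends. -/
theorem Safe.exists_one (H : IsWonUnfolding S letters lab src dst s₀) {x p q : P}
    (hs : Safe S lab src dst s₀ x p q) (h0 : lab x = (0, Sum.inl 1))
    (h : S.goodPos 1 (posOf lab p) (posOf lab q) = false)
    (hp : isChoice (posOf lab p) = true) : ∃ t, src t = p := by
  obtain ⟨y, hy, hs'⟩ := hs.move_env H h0 h (b := 5) (by decide)
  by_contra hcon
  push Not at hcon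
  exact H.not_safe_stuck (j := 1) (Or.inl ⟨rfl, rfl⟩) hy (by rwa [state3_one])
    (by rwa [state3_one]) hs'

theorem Safe.exists_two (H : IsWonUnfolding S letters lab src dst s₀) {x p q : P}
    (hs : Safe S lab src dst s₀ x p q) (h0 : lab x = (0, Sum.inl 1))
    (h : S.goodPos 1 (posOf lab p) (posOf lab q) = false)
    (hp : isChoice (posOf lab q) = true) : ∃ t, src t = q := by
  obtain ⟨y, hy, hs'⟩ := hs.move_env H h0 h (b := 6) (by decide)
  by_contra hcon
  push Not at hcon
  exact H.not_safe_stuck (j := 2) (Or.inr ⟨rfl, rfl⟩) hy (by rwa [state3_two])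
    (by rwa [state3_two]) hs'

/-- In case of a mismatch the environment player would pass through state 2, which then is not good,
to state 7, where nothing can become good any more. -/
theorem Safe.not_mismatch (H : IsWonUnfolding S letters lab src dst s₀) {x p q : P}
    (hs : Safe S lab src dst s₀ x p q) (h0 : lab x = (0, Sum.inl 1))
    (h : S.goodPos 1 (posOf lab p) (posOf lab q) = false) :
    S.mismatch (posOf lab p) (posOf lab q) = false := by
  by_contra hcon
  rw [Bool.not_eq_false] at hcon
  obtain ⟨y, hy, hs'⟩ := hs.move_env H h0 h (b := 2) (by decide)
  obtain ⟨z, hz, hs''⟩ := hs'.move_env H hy (by simp [TileSystem.goodPos, hcon]) (b := 7)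
    (by decide)
  exact H.not_safe_dead hz hs''

theorem Safe.not_verMismatch (H : IsWonUnfolding S letters lab src dst s₀) {x p q : P}
    (hs : Safe S lab src dst s₀ x p q) (h0 : lab x = (0, Sum.inl 3))
    (h : S.goodPos 3 (posOf lab p) (posOf lab q) = false) :
    S.verMismatch (posOf lab p) (posOf lab q) = false := by
  by_contra hcon
  rw [Bool.not_eq_false] at hcon
  obtain ⟨y, hy, hs'⟩ := hs.move_env H h0 h (b := 4) (by decide)
  obtain ⟨z, hz, hs''⟩ := hs'.move_env H hy (by simp [TileSystem.goodPos, hcon]) (b := 7)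
    (by decide)
  exact H.not_safe_dead hz hs''

end IsWonUnfolding

end PetriGames

/-! ### Reading the tiling off a winning strategy -/

namespace PetriGames

/-- The parity of `k`. -/
def parity (k : ℕ) : Bool := decide (k % 2 = 1)

theorem clock_two_mul (k : ℕ) : clock (2 * k) = (parity k, false) := by
  simp only [clock, parity, Prod.mk.injEq, decide_eq_decide, decide_eq_false_iff_not]
  omega

theorem clock_two_mul_add_one (k : ℕ) : clock (2 * k + 1) = (parity k, true) := by
  simp only [clock, parity, Prod.mk.injEq, decide_eq_decide, decide_eq_true_eq]
  omega

theorem parity_succ (k : ℕ) : parity (k + 1) = !parity k := by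
  unfold parity
  rcases Nat.mod_two_eq_zero_or_one k with h | h
  · have : (k + 1) % 2 = 1 := by omega
    simp [h, this]
  · have : (k + 1) % 2 = 0 := by omega
    simp [h, this]

section

variable {L : Type} [DecidableEq L] (S : TileSystem L)

theorem goodPos_one_clock {a b : ℕ} (σ τ : L) (h : b % 4 ≠ (a + 1) % 4) :
    S.goodPos 1 (some (σ, clock a)) (some (τ, clock b)) = false := by
  simp [TileSystem.goodPos, ahead_clock, h]

theorem goodPos_three_clock {a b : ℕ} {σ : L} (τ : L) (hσ : S.initial σ = false)
    (h : b % 4 ≠ (a + 1) % 4) :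
    S.goodPos 3 (some (σ, clock a)) (some (τ, clock b)) = false := by
  simp [TileSystem.goodPos, TileSystem.inStep, ahead_clock, h, hσ]

theorem follows_iff (c : Bool) (σ τ : L) : S.follows c σ τ = true ↔ S.hor σ τ = true ∧
    (S.initial τ = true → S.initial σ = true) ∧ τ ≠ S.start ∧
    (S.initial σ = true → S.initial τ = false → c = true) := by
  simp only [TileSystem.follows, Bool.and_eq_true, Bool.or_eq_true, Bool.not_eq_true',
    decide_eq_false_iff_not]
  cases S.initial σ <;> cases S.initial τ <;> simp [and_assoc]

end

namespace IsWonUnfolding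

variable {L P T : Type} [DecidableEq L] {r : ℕ} {S : TileSystem L}
  {letters : List L} {lab : P → Fin (r + 3) × Loc L} {src dst : T → P} {s₀ : Fin (r + 3) → P}

/-- Both writing players have written `k` tiles after the first one, and the last ones agree. -/
structure Synced (S : TileSystem L) (lab : P → Fin (r + 3) × Loc L) (src dst : T → P)
    (s₀ : Fin (r + 3) → P) (x : P) (k : ℕ) (σ : L) : Prop where
  safe : Safe S lab src dst s₀ x (pathPlace src dst (s₀ 1) (2 * k))
    (pathPlace src dst (s₀ 2) (2 * k))
  one : posOf lab (pathPlace src dst (s₀ 1) (2 * k)) = some (σ, clock (2 * k))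
  two : posOf lab (pathPlace src dst (s₀ 2) (2 * k)) = some (σ, clock (2 * k))

/-- Let the first writer make two steps and then the second writer two. The lead takes the values 1,
2, 1, 0, so no marking on the way ends the test unless the first writer finishes. Refusals at the
choices are excluded by the states 5 and 6. The mismatch test at lead 2 gives that the new tile may
follow the old one, and at lead 0 that both new tiles agree. -/
theorem Synced.succ (H : IsWonUnfolding S letters lab src dst s₀) {x : P} {k : ℕ} {σ : L}
    (h0 : lab x = (0, Sum.inl 1)) (h : Synced S lab src dst s₀ x k σ) :
    (posOf lab (pathPlace src dst (s₀ 1) (2 * k + 1)) = some (σ, clock (2 * k + 1)) ∧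
      (∃ t, src t = pathPlace src dst (s₀ 1) (2 * k + 1) ∧
        dst t = pathPlace src dst (s₀ 1) (2 * k + 2))) ∧
    ((posOf lab (pathPlace src dst (s₀ 1) (2 * k + 2)) = none ∧ S.accept σ = true ∧
      S.initial σ = false) ∨
    ∃ τ, S.follows (parity k) σ τ = true ∧ Synced S lab src dst s₀ x (k + 1) τ ∧
      (posOf lab (pathPlace src dst (s₀ 2) (2 * k + 1)) = some (σ, clock (2 * k + 1)) ∧
      (∃ t, src t = pathPlace src dst (s₀ 2) (2 * k + 1) ∧
        dst t = pathPlace src dst (s₀ 2) (2 * k + 2)))) := by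
  obtain ⟨hs, h1, h2⟩ := h
  have g00 : S.goodPos 1 (posOf lab (pathPlace src dst (s₀ 1) (2 * k)))
      (posOf lab (pathPlace src dst (s₀ 2) (2 * k))) = false := by
    rw [h1, h2]; exact goodPos_one_clock S _ _ (by omega)
  have h1' := h1
  rw [clock_two_mul] at h1'
  obtain ⟨p1, m1⟩ := H.path_step_letter (Or.inl rfl) h1'
  have p1' := p1
  rw [← clock_two_mul_add_one] at p1'
  have hs := hs.move_one h0 g00 m1
  have g10 : S.goodPos 1 (posOf lab (pathPlace src dst (s₀ 1) (2 * k + 1)))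
      (posOf lab (pathPlace src dst (s₀ 2) (2 * k))) = false := by
    rw [p1', h2]; exact goodPos_one_clock S _ _ (by omega)
  obtain ⟨h3, m2⟩ := H.path_step_choice (Or.inl rfl) p1
    (hs.exists_one H h0 g10 (by rw [p1]; rfl))
  refine ⟨⟨p1', m2⟩, ?_⟩
  rcases h3 with h3 | ⟨τ, h3⟩
  · exact Or.inl h3
  right
  rw [← parity_succ, ← clock_two_mul] at h3
  have hs := hs.move_one h0 g10 m2
  have g20 : S.goodPos 1 (posOf lab (pathPlace src dst (s₀ 1) (2 * k + 2)))
      (posOf lab (pathPlace src dst (s₀ 2) (2 * k))) = false := by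
    rw [h3, h2]; exact goodPos_one_clock S _ _ (by omega)
  have hf := hs.not_mismatch H h0 g20
  rw [h3, h2, clock_two_mul, clock_two_mul, parity_succ] at hf
  have hf : S.follows (parity k) σ τ = true := by
    simpa [TileSystem.mismatch] using hf
  refine ⟨τ, hf, ?_⟩
  have h2' := h2
  rw [clock_two_mul] at h2'
  obtain ⟨p2, m3⟩ := H.path_step_letter (Or.inr rfl) h2'
  have p2' := p2
  rw [← clock_two_mul_add_one] at p2'
  have hs := hs.move_two h0 g20 m3
  have g21 : S.goodPos 1 (posOf lab (pathPlace src dst (s₀ 1) (2 * k + 2)))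
      (posOf lab (pathPlace src dst (s₀ 2) (2 * k + 1))) = false := by
    rw [h3, p2']; exact goodPos_one_clock S _ _ (by omega)
  obtain ⟨h4, m4⟩ := H.path_step_choice (Or.inr rfl) p2
    (hs.exists_two H h0 g21 (by rw [p2]; rfl))
  have hs := hs.move_two h0 g21 m4
  refine ⟨⟨hs, h3, ?_⟩, p2', m4⟩
  -- Not even a second writer who has finished makes this marking good, so the mismatch test is
  -- available in both cases.
  have g22 : S.goodPos 1 (posOf lab (pathPlace src dst (s₀ 1) (2 * k + 2)))
      (posOf lab (pathPlace src dst (s₀ 2) (2 * k + 2))) = false := by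
    rcases h4 with h4 | ⟨τ', h4⟩
    · rw [h3, h4.1, clock_two_mul]; simp [TileSystem.goodPos, ahead]
    · rw [h3, h4, ← parity_succ, ← clock_two_mul]
      exact goodPos_one_clock S _ _ (by omega)
  have hm := hs.not_mismatch H h0 g22
  rcases h4 with h4 | ⟨τ', h4⟩
  · rw [h3, h4.1, clock_two_mul] at hm
    simp [TileSystem.mismatch] at hm
  · rw [← parity_succ] at h4
    change posOf lab (pathPlace src dst (s₀ 2) (2 * k + 2)) = some (τ, clock (2 * (k + 1)))
    rw [h3, h4, clock_two_mul] at hm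
    simp [TileSystem.mismatch] at hm
    rw [h4, hm, clock_two_mul]

/-- Both players cannot write the same tiles forever. -/
theorem not_forall_synced (H : IsWonUnfolding S letters lab src dst s₀) {x : P}
    (h0 : lab x = (0, Sum.inl 1)) (h : ∀ k, ∃ σ, Synced S lab src dst s₀ x k σ) : False := by
  have hwrite : ∀ j, ∃ σ, posOf lab (pathPlace src dst (s₀ 1) j) = some (σ, clock j) ∧
      posOf lab (pathPlace src dst (s₀ 2) j) = some (σ, clock j) ∧
      (∃ t, src t = pathPlace src dst (s₀ 1) j ∧ dst t = pathPlace src dst (s₀ 1) (j + 1)) ∧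
      (∃ t, src t = pathPlace src dst (s₀ 2) j ∧ dst t = pathPlace src dst (s₀ 2) (j + 1)) := by
    intro j
    obtain ⟨k, hk⟩ := j.even_or_odd'
    obtain ⟨σ, hσ⟩ := h k
    rcases hk with rfl | rfl
    · refine ⟨σ, hσ.one, hσ.two, ?_, ?_⟩
      · have := hσ.one
        rw [clock_two_mul] at this
        exact (H.path_step_letter (Or.inl rfl) this).2
      · have := hσ.two
        rw [clock_two_mul] at this
        exact (H.path_step_letter (Or.inr rfl) this).2
    · obtain ⟨⟨a, b⟩, c⟩ := hσ.succ H h0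
      rcases c with c | ⟨τ, -, -, c, d⟩
      · obtain ⟨σ', hσ'⟩ := h (k + 1)
        have e1 := hσ'.one
        have e2 : posOf lab (pathPlace src dst (s₀ 1) (2 * (k + 1))) = none := c.1
        rw [e2] at e1
        cases e1
      · exact ⟨σ, a, c, b, d⟩
  obtain ⟨σ, hσ⟩ := h 0
  refine hσ.safe (HasRunWithin.mono ?_ (hasRunWithin_of_invariant
    (α := (Fin (r + 3) → P) × ℕ × ℕ) (state := fun z => z.1)
    (Inv := fun z => lab (z.1 0) = (0, Sum.inl 1) ∧ z.1 1 = pathPlace src dst (s₀ 1) z.2.1 ∧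
      z.1 2 = pathPlace src dst (s₀ 2) z.2.2 ∧ z.2.2 ≤ z.2.1 ∧ z.2.1 ≤ z.2.2 + 2)
    -- The first writer waits until its lead drops below 2, the second until the lead is positive;
    -- each rank counts the moves of the other writer that bring this about.
    (fun z i => if i = 1 then z.2.1 - z.2.2 else 2 + z.2.2 - z.2.1) ?_
    (a := (state3 s₀ x (pathPlace src dst (s₀ 1) (2 * 0)) (pathPlace src dst (s₀ 2) (2 * 0)),
      0, 0)) ?_ 0))
  · rintro _ ⟨⟨s, a, b⟩, ⟨h1, h2, h3, h4, h5⟩, rfl⟩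
    refine not_isGood h1 ?_
    dsimp only at *
    obtain ⟨σ, e1, -⟩ := hwrite a
    obtain ⟨τ, -, e2, -⟩ := hwrite b
    rw [h2, h3, e1, e2]
    exact goodPos_one_clock S _ _ (by omega)
  · rintro ⟨s, a, b⟩ i ⟨h1, h2, h3, h4, h5⟩
    dsimp only at *
    have henv : ∃ t, src t = s 0 ∧ lab (dst t) = (0, Sum.inl 1) :=
      H.exists_env_edge h1 (by simp [envEdge])
    have hone : a < b + 2 → ∃ (a' : (Fin (r + 3) → P) × ℕ × ℕ) (t : T), src t = s 1 ∧ a'.1 = Function.update s 1 (dst t) ∧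
        (lab (a'.1 0) = (0, Sum.inl 1) ∧ a'.1 1 = pathPlace src dst (s₀ 1) a'.2.1 ∧
          a'.1 2 = pathPlace src dst (s₀ 2) a'.2.2 ∧ a'.2.2 ≤ a'.2.1 ∧ a'.2.1 ≤ a'.2.2 + 2) ∧
        a'.2.1 = a + 1 ∧ a'.2.2 = b := by
      intro hab
      obtain ⟨σ, -, -, ⟨t, ht, ht'⟩, -⟩ := hwrite a
      refine ⟨(Function.update s 1 (dst t), a + 1, b), t, by rw [ht, h2], rfl,
        ⟨?_, ?_, ?_, ?_, ?_⟩, rfl, rfl⟩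
      · dsimp only; rw [Function.update_of_ne fin_one_ne_zero.symm, h1]
      · dsimp only; rw [Function.update_self, ht']
      · dsimp only; rw [Function.update_of_ne fin_two_ne_one, h3]
      · dsimp only; omega
      · dsimp only; omega
    have htwo : b < a → ∃ (a' : (Fin (r + 3) → P) × ℕ × ℕ) (t : T), src t = s 2 ∧ a'.1 = Function.update s 2 (dst t) ∧
        (lab (a'.1 0) = (0, Sum.inl 1) ∧ a'.1 1 = pathPlace src dst (s₀ 1) a'.2.1 ∧
          a'.1 2 = pathPlace src dst (s₀ 2) a'.2.2 ∧ a'.2.2 ≤ a'.2.1 ∧ a'.2.1 ≤ a'.2.2 + 2) ∧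
        a'.2.1 = a ∧ a'.2.2 = b + 1 := by
      intro hab
      obtain ⟨σ, -, -, -, ⟨t, ht, ht'⟩⟩ := hwrite b
      refine ⟨(Function.update s 2 (dst t), a, b + 1), t, by rw [ht, h3], rfl,
        ⟨?_, ?_, ?_, ?_, ?_⟩, rfl, rfl⟩
      · dsimp only; rw [Function.update_of_ne fin_two_ne_zero.symm, h1]
      · dsimp only; rw [Function.update_of_ne fin_two_ne_one.symm, h2]
      · dsimp only; rw [Function.update_self, ht']
      · dsimp only; omega
      · dsimp only; omega
    have hidle : ∃ (a' : (Fin (r + 3) → P) × ℕ × ℕ) (t : T), src t = s 0 ∧ a'.1 = Function.update s 0 (dst t) ∧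
        (lab (a'.1 0) = (0, Sum.inl 1) ∧ a'.1 1 = pathPlace src dst (s₀ 1) a'.2.1 ∧
          a'.1 2 = pathPlace src dst (s₀ 2) a'.2.2 ∧ a'.2.2 ≤ a'.2.1 ∧ a'.2.1 ≤ a'.2.2 + 2) := by
      obtain ⟨t, ht, ht'⟩ := henv
      refine ⟨(Function.update s 0 (dst t), a, b), t, ht, rfl, ?_, ?_, ?_, h4, h5⟩
      · dsimp only; rw [Function.update_self, ht']
      · dsimp only; rw [Function.update_of_ne fin_one_ne_zero, h2]
      · dsimp only; rw [Function.update_of_ne fin_two_ne_zero, h3]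
    by_cases hi0 : i = 0
    · subst hi0
      obtain ⟨a', t, e1, e2, e3⟩ := hidle
      exact ⟨a', t, 0, e1, e2, e3, Or.inl rfl⟩
    by_cases hi1 : i = 1
    · subst hi1
      by_cases hab : a < b + 2
      · obtain ⟨a', t, e1, e2, e3, -⟩ := hone hab
        exact ⟨a', t, 1, e1, e2, e3, Or.inl rfl⟩
      · obtain ⟨a', t, e1, e2, e3, e4, e5⟩ := htwo (by omega)
        refine ⟨a', t, 2, e1, e2, e3, Or.inr (Or.inr ?_)⟩
        rw [if_pos rfl, if_pos rfl, e4, e5]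
        omega
    by_cases hi2 : i = 2
    · subst hi2
      by_cases hab : b < a
      · obtain ⟨a', t, e1, e2, e3, -⟩ := htwo hab
        exact ⟨a', t, 2, e1, e2, e3, Or.inl rfl⟩
      · obtain ⟨a', t, e1, e2, e3, e4, e5⟩ := hone (by omega)
        refine ⟨a', t, 1, e1, e2, e3, Or.inr (Or.inr ?_)⟩
        rw [if_neg hi1, if_neg hi1, e4, e5]
        omega
    by_cases hex : ∃ t, src t = s i
    · obtain ⟨t, ht⟩ := hex
      refine ⟨(Function.update s i (dst t), a, b), t, i, ht, rfl, ⟨?_, ?_, ?_, h4, h5⟩, Or.inl rfl⟩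
      · dsimp only; rw [Function.update_of_ne (Ne.symm hi0), h1]
      · dsimp only; rw [Function.update_of_ne (Ne.symm hi1), h2]
      · dsimp only; rw [Function.update_of_ne (Ne.symm hi2), h3]
    · obtain ⟨a', t, e1, e2, e3⟩ := hidle
      exact ⟨a', t, 0, e1, e2, e3, Or.inr (Or.inl fun u hu => hex ⟨u, hu⟩)⟩
  · refine ⟨?_, ?_, ?_, le_rfl, Nat.zero_le _⟩
    · dsimp only; rw [state3_zero, h0]
    · dsimp only; rw [state3_one]
    · dsimp only; rw [state3_two]

/-- The first test yields a finite common sequence `x 0, …, x m`, because the writers cannot stay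
synchronized forever. Its initial tiles form a prefix, whose length is the length of a turn, and the
second test is then played with this lead. -/
theorem solvable (H : IsWonUnfolding S letters lab src dst s₀) (hstart : S.initial S.start = true) :
    S.Solvable letters := by
  classical
  have hsafe : Safe S lab src dst s₀ (s₀ 0) (pathPlace src dst (s₀ 1) 0)
      (pathPlace src dst (s₀ 2) 0) := by
    change ¬ HasRunWithin src dst _ (state3 s₀ (s₀ 0) (s₀ 1) (s₀ 2))
    rw [state3_self]
    exact H.no_run
  have p10 := H.posOf_path_zero (i := 1) (Or.inl rfl)
  have p20 := H.posOf_path_zero (i := 2) (Or.inr rfl)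
  have hl0 : lab (s₀ 0) = (0, Sum.inl 0) := by simp [H.lab_init, TileSystem.initLoc]
  have g0 : S.goodPos 0 (posOf lab (pathPlace src dst (s₀ 1) 0))
      (posOf lab (pathPlace src dst (s₀ 2) 0)) = false := by
    rw [p10, p20]; simp [TileSystem.goodPos]
  obtain ⟨y, hy, hsy⟩ := hsafe.move_env H hl0 g0 (b := 1) (by decide)
  obtain ⟨z, hz, hsz⟩ := hsafe.move_env H hl0 g0 (b := 3) (by decide)
  have hsync0 : Synced S lab src dst s₀ y 0 S.start := ⟨hsy, p10, p20⟩
  -- the common sequence of tiles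
  have hex : ∃ k, ¬ ∃ σ, Synced S lab src dst s₀ y k σ := by
    by_contra hcon
    push Not at hcon
    exact H.not_forall_synced hy hcon
  obtain ⟨m, hm⟩ : ∃ m, Nat.find hex = m + 1 := by
    refine Nat.exists_eq_succ_of_ne_zero fun h => ?_
    have := Nat.find_spec hex
    rw [h] at this
    exact this ⟨_, hsync0⟩
  have hsync : ∀ k ≤ m, ∃ σ, Synced S lab src dst s₀ y k σ := fun k hk =>
    not_not.1 (Nat.find_min hex (by omega))
  have hlast : ¬ ∃ σ, Synced S lab src dst s₀ y (m + 1) σ := hm ▸ Nat.find_spec hex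
  have hx : ∃ x : ℕ → L, ∀ k ≤ m, Synced S lab src dst s₀ y k (x k) := by
    have : ∀ k, ∃ σ, k ≤ m → Synced S lab src dst s₀ y k σ := by
      intro k
      by_cases hk : k ≤ m
      · obtain ⟨σ, hσ⟩ := hsync k hk
        exact ⟨σ, fun _ => hσ⟩
      · exact ⟨S.start, fun h => absurd h hk⟩
    choose x hx using this
    exact ⟨x, hx⟩
  obtain ⟨x, hx⟩ := hx
  have huniq : ∀ {k σ}, k ≤ m → Synced S lab src dst s₀ y k σ → σ = x k := by
    intro k σ hk hσ
    have e := (hx k hk).one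
    rw [hσ.one] at e
    simp only [Option.some.injEq, Prod.mk.injEq] at e
    exact e.1
  have hx0 : x 0 = S.start := (huniq (Nat.zero_le _) hsync0).symm
  have hfollows : ∀ k < m, S.follows (parity k) (x k) (x (k + 1)) = true ∧
      posOf lab (pathPlace src dst (s₀ 1) (2 * k + 1)) = some (x k, clock (2 * k + 1)) ∧
      posOf lab (pathPlace src dst (s₀ 2) (2 * k + 1)) = some (x k, clock (2 * k + 1)) ∧
      (∃ t, src t = pathPlace src dst (s₀ 1) (2 * k + 1) ∧
        dst t = pathPlace src dst (s₀ 1) (2 * k + 2)) ∧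
      (∃ t, src t = pathPlace src dst (s₀ 2) (2 * k + 1) ∧
        dst t = pathPlace src dst (s₀ 2) (2 * k + 2)) := by
    intro k hk
    obtain ⟨⟨a, b⟩, c⟩ := (hx k hk.le).succ H hy
    rcases c with c | ⟨τ, c, d, e, f⟩
    · have e1 := (hx (k + 1) hk).one
      have e2 : posOf lab (pathPlace src dst (s₀ 1) (2 * (k + 1))) = none := c.1
      rw [e2] at e1
      cases e1
    · rw [huniq hk d] at c
      exact ⟨c, a, e, b, f⟩
  -- Synchrony breaks after `x m`, and the only way to break it is that the first writer finishes.
  have hacc : S.accept (x m) = true ∧ S.initial (x m) = false := by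
    obtain ⟨-, c | ⟨τ, -, d, -⟩⟩ := (hx m le_rfl).succ H hy
    · exact c.2
    · exact absurd ⟨τ, d⟩ hlast
  -- the length of the first turn
  have hexd : ∃ d, S.initial (x d) = false := ⟨m, hacc.2⟩
  let d := Nat.find hexd
  have hd : S.initial (x d) = false := Nat.find_spec hexd
  have hdm : d ≤ m := Nat.find_min' hexd hacc.2
  have hlt : ∀ j < d, S.initial (x j) = true := fun j hj =>
    by simpa using Nat.find_min hexd hj
  have hd0 : 0 < d := by
    rw [Nat.pos_iff_ne_zero]
    intro h0
    rw [h0, hx0, hstart] at hd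
    cases hd
  have hge : ∀ j, d ≤ j → j ≤ m → S.initial (x j) = false := by
    intro j hj
    induction j, hj using Nat.le_induction with
    | base => exact fun _ => hd
    | succ j hj ih =>
      intro hjm
      have h1 := ((follows_iff S _ _ _).1 (hfollows j (by omega)).1).2.1
      have h2 := ih (by omega)
      by_contra hcon
      rw [h1 (by simpa using hcon)] at h2
      cases h2
  -- The step from the last initial tile, of index `d - 1`, to a tile that is not initial is allowed
  -- only at odd parity.
  have heven : Even d := by
    obtain ⟨e, he⟩ := Nat.exists_eq_succ_of_ne_zero hd0.ne'
    have h1 := ((follows_iff S _ _ _).1 (hfollows e (by omega)).1).2.2.2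
      (hlt e (by omega)) (by have := hd; rw [he] at this; exact this)
    simp only [parity, decide_eq_true_eq] at h1
    rw [he, Nat.even_iff]
    omega
  -- the check of the vertical relation
  have hclock : ∀ h ≤ 2 * m, posOf lab (pathPlace src dst (s₀ 1) h) = some (x (h / 2), clock h) ∧
      posOf lab (pathPlace src dst (s₀ 2) h) = some (x (h / 2), clock h) := by
    intro h hh
    obtain ⟨k, rfl | rfl⟩ := h.even_or_odd'
    · rw [Nat.mul_div_cancel_left _ (by norm_num)]
      exact ⟨(hx k (by omega)).one, (hx k (by omega)).two⟩
    · rw [show (2 * k + 1) / 2 = k by omega]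
      exact ⟨(hfollows k (by omega)).2.1, (hfollows k (by omega)).2.2.1⟩
  have hmove : ∀ i : Fin (r + 3), i = 1 ∨ i = 2 → ∀ h < 2 * m,
      ∃ t, src t = pathPlace src dst (s₀ i) h ∧ dst t = pathPlace src dst (s₀ i) (h + 1) := by
    intro i hi h hh
    obtain ⟨k, rfl | rfl⟩ := h.even_or_odd'
    · have e := hx k (by omega)
      rcases hi with rfl | rfl
      · have := e.one
        rw [clock_two_mul] at this
        exact (H.path_step_letter (Or.inl rfl) this).2
      · have := e.two
        rw [clock_two_mul] at this
        exact (H.path_step_letter (Or.inr rfl) this).2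
    · rcases hi with rfl | rfl
      · exact (hfollows k (by omega)).2.2.2.1
      · exact (hfollows k (by omega)).2.2.2.2
  -- The first writer lays its first turn while the second stays on the start tile, as `inStep`
  -- demands for initial tiles.
  have hfirst : ∀ h ≤ 2 * d, Safe S lab src dst s₀ z (pathPlace src dst (s₀ 1) h)
      (pathPlace src dst (s₀ 2) 0) := by
    intro h
    induction h with
    | zero => exact fun _ => hsz
    | succ h ih =>
      intro hh
      refine (ih (by omega)).move_one hz ?_ (hmove 1 (Or.inl rfl) h (by omega))
      rw [(hclock h (by omega)).1, p20]
      simp [TileSystem.goodPos, TileSystem.inStep, hlt (h / 2) (by omega)]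
  have hgood : ∀ a b, 2 * d ≤ a → a ≤ 2 * m → b ≤ 2 * m → b % 4 ≠ (a + 1) % 4 →
      S.goodPos 3 (posOf lab (pathPlace src dst (s₀ 1) a))
        (posOf lab (pathPlace src dst (s₀ 2) b)) = false := by
    intro a b h1 h2 h3 h4
    rw [(hclock a h2).1, (hclock b h3).2]
    exact goodPos_three_clock S _ (hge _ (by omega) (by omega)) h4
  -- From now on the writers move alternately. As 2`d` is divisible by four, `ahead` cannot
  -- distinguish this lead from being level.
  have hsecond : ∀ h, 2 * d + h ≤ 2 * m → Safe S lab src dst s₀ z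
      (pathPlace src dst (s₀ 1) (2 * d + h)) (pathPlace src dst (s₀ 2) h) := by
    have hd2 : d % 2 = 0 := Nat.even_iff.1 heven
    intro h
    induction h with
    | zero => exact fun _ => hfirst (2 * d) le_rfl
    | succ h ih =>
      intro hh
      refine Safe.move_two (q := pathPlace src dst (s₀ 2) h) ?_ hz
        (hgood _ _ (by omega) hh (by omega) (by omega)) (hmove 2 (Or.inr rfl) h (by omega))
      exact (ih (by omega)).move_one hz (hgood _ _ (by omega) (by omega) (by omega) (by omega))
        (hmove 1 (Or.inl rfl) (2 * d + h) (by omega))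
  refine ⟨m, d, x, hd0, hdm, heven, hx0, ?_, ?_, ?_, ?_, hacc.1⟩
  · intro j hj
    have h1 := H.lab_path (i := 1) (Or.inl rfl) (2 * j)
    rw [(hx j hj).one] at h1
    exact H.mem_letters _ _ _ (by rw [h1])
  · intro j hj
    refine ⟨fun h => ?_, hlt j⟩
    by_contra hcon
    rw [hge j (not_lt.1 hcon) hj] at h
    cases h
  · intro j hj
    have := (follows_iff S _ _ _).1 (hfollows j hj).1
    exact ⟨this.2.2.1, this.1⟩
  · intro j hj
    have hd2 : d % 2 = 0 := Nat.even_iff.1 heven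
    have h1 := (hsecond (2 * j) (by omega)).not_verMismatch H hz
      (hgood _ _ (by omega) (by omega) (by omega) (by omega))
    rw [(hclock _ (by omega)).1, (hclock _ (by omega)).2, show (2 * d + 2 * j) / 2 = j + d by omega,
      show 2 * j / 2 = j by omega, show 2 * d + 2 * j = 2 * (d + j) by ring, clock_two_mul,
      clock_two_mul, show parity (d + j) = parity j by
        simp only [parity, decide_eq_decide]; omega] at h1
    simpa [TileSystem.verMismatch, hge (j + d) (by omega) hj] using h1

end IsWonUnfolding

end PetriGames

/-! ### From a tiling to a winning strategy -/

namespace PetriGames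

/-- The position after `h` steps of a player who writes the tiles `x 0, …, x m`. -/
def writePos {L : Type} (m : ℕ) (x : ℕ → L) (h : ℕ) : Pos L :=
  if h ≤ 2 * m + 1 then some (x (h / 2), clock h) else none

section

variable {L : Type} {m : ℕ} {x : ℕ → L}

theorem writePos_two_mul {j : ℕ} (hj : j ≤ m) :
    writePos m x (2 * j) = some (x j, parity j, false) := by
  rw [writePos, if_pos (by omega), clock_two_mul, show 2 * j / 2 = j by omega]

theorem writePos_two_mul_add_one {j : ℕ} (hj : j ≤ m) :
    writePos m x (2 * j + 1) = some (x j, parity j, true) := by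
  rw [writePos, if_pos (by omega), clock_two_mul_add_one, show (2 * j + 1) / 2 = j by omega]

theorem writePos_last : writePos m x (2 * m + 2) = none := by
  rw [writePos, if_neg (by omega)]

end

namespace IsTileGame

variable {L P T : Type} [DecidableEq L] {r : ℕ} {S : TileSystem L} {letters : List L}
  {G : PetriGame P T} {lab : P → Fin (r + 3) × Loc L} {src dst : T → P} {s₀ : Fin (r + 3) → P}

/-- Justified refusal makes all transitions from environment places available in the branching
process, and winning excludes fair runs without good states. These two facts are all that the
extraction of the tiling needs from the strategy. -/
theorem solvable (hG : IsTileGame S letters G lab src dst s₀) (hstart : S.initial S.start = true)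
    (hw : HasWinningStrategy G) : S.Solvable letters := by
  obtain ⟨σ, hσ, hwin⟩ := hw
  obtain ⟨src', dst', s₀', h, hsrc, hdst, hinit⟩ := σ.exists_isAutonomous hG.autonomous
  refine IsWonUnfolding.solvable (lab := fun p => lab (σ.placeLabel p)) (src := src')
    (dst := dst') (s₀ := s₀') ⟨?_, ?_, ?_, ?_, ?_, ?_⟩ hstart
  · exact fun p => hG.mem_letters _
  · exact h.owner_dst
  · intro i
    rw [hinit, hG.lab_init]
  · intro t
    rw [hsrc, hdst]
    exact hG.edge _
  · intro p y hp hy hl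
    obtain ⟨t, ht, ht'⟩ := hG.exists_edge _ y hy hl
    rcases hσ.justifiedRefusal {p} t (by
      intro a ha b hb hab
      rw [Finset.mem_singleton] at ha hb
      exact absurd (ha.trans hb.symm) hab) (by rw [hG.autonomous.pre_eq, ht]; simp) with
      ⟨u, rfl, hu'⟩ | ⟨q, hq, hq', -⟩
    · rw [h.pre_eq] at hu'
      refine ⟨u, Multiset.singleton_inj.1 hu', ?_⟩
      rw [hdst, ht']
    · rw [Finset.mem_singleton] at hq
      subst hq
      rw [hG.mem_system, hp] at hq'
      cases hq'
  · rintro ⟨f, τ, m, hr, h0, hbad⟩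
    obtain ⟨k, hk⟩ := hwin.visits_good h hr h0
    rw [hG.mem_good _ (hr.owner_eq h h0 k)] at hk
    exact hbad k hk

section Strategy

variable {m d : ℕ} {x : ℕ → L}

/-- The choices of a player who writes the tiles `x 0, …, x m`; the players who do not write never
move. -/
def writeChoice (G : PetriGame P T) (lab : P → Fin (r + 3) × Loc L) (src dst : T → P) (m : ℕ)
    (x : ℕ → L) (l : List T) (t : T) : Prop :=
  src t ∈ G.system → (lab (src t)).1.val < 3 ∧
    (lab (dst t)).2 = Sum.inr (writePos m x (l.length + 1))

/-- The only freedom of a writer is at its choices, which `writeChoice` fixes. So the length of its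
history determines its position. -/
theorem lab_endPlace_writer (hG : IsTileGame S letters G lab src dst s₀) (hx0 : x 0 = S.start)
    {i : Fin (r + 3)} (hi : i = 1 ∨ i = 2) (l : List T)
    (hl : IsHistory src dst s₀ (writeChoice G lab src dst m x) i l) :
    l.length ≤ 2 * m + 2 ∧
      lab (endPlace dst s₀ i l) = (i, Sum.inr (writePos m x l.length)) := by
  have hi' : i.val = 1 ∨ i.val = 2 := by
    rcases hi with rfl | rfl <;> simp
  induction l with
  | nil =>
    refine ⟨Nat.zero_le _, ?_⟩
    change lab (s₀ i) = _
    have := writePos_two_mul (m := m) (x := x) (Nat.zero_le m)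
    simp only [Nat.mul_zero, hx0, parity] at this
    simp [hG.lab_init, TileSystem.initLoc, hi', this]
  | cons t l ih =>
    obtain ⟨h1, h2, h3⟩ := hl
    obtain ⟨h4, h5⟩ := ih h1
    rw [← h2] at h5
    have e1 := hG.autonomous.owner_dst t
    have e2 := hG.edge t
    rw [h5] at e1 e2
    have hlen : l.length < 2 * m + 2 := by
      rcases h4.lt_or_eq with h | h
      · exact h
      · rw [h, writePos_last] at e2
        rcases hd : (lab (dst t)).2 with b | q <;> rw [hd] at e2 <;>
          simp [TileSystem.locEdge, TileSystem.posEdge] at e2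
    refine ⟨hlen, Prod.ext e1 ?_⟩
    obtain ⟨j, hj | hj⟩ := l.length.even_or_odd'
    · rw [hj, writePos_two_mul (by omega)] at e2
      change (lab (dst t)).2 = Sum.inr (writePos m x (l.length + 1))
      rw [hj, writePos_two_mul_add_one (by omega)]
      rcases hd : (lab (dst t)).2 with b | q | y
      · rw [hd] at e2; simp [TileSystem.locEdge] at e2
      · rw [hd] at e2; simp [TileSystem.locEdge, TileSystem.posEdge] at e2
      · rw [hd] at e2
        simp [TileSystem.locEdge, TileSystem.posEdge] at e2
        rw [e2.2]
    · refine (h3 ?_).2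
      rw [hG.mem_system, h5, hj, writePos_two_mul_add_one (by omega)]
      simp [isSystem, isChoice, hi']

/-- The prescribed moves really exist in the game, so by fairness both writers come to the end. The
last one, to `none`, needs that the final tile is accepting and not initial. -/
theorem exists_write (hG : IsTileGame S letters G lab src dst s₀) (hx0 : x 0 = S.start)
    (hletters : ∀ j ≤ m, x j ∈ letters) (hacc : S.accept (x m) = true)
    (hlast : S.initial (x m) = false)
    {i : Fin (r + 3)} (hi : i = 1 ∨ i = 2) (l : List T)
    (hl : IsHistory src dst s₀ (writeChoice G lab src dst m x) i l) (hlen : l.length < 2 * m + 2) :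
    ∃ t, IsHistory src dst s₀ (writeChoice G lab src dst m x) i (t :: l) := by
  have hi' : i.val = 1 ∨ i.val = 2 := by
    rcases hi with rfl | rfl <;> simp
  have hlab := (hG.lab_endPlace_writer hx0 hi l hl).2
  suffices hex : ∃ t, src t = endPlace dst s₀ i l ∧
      (lab (dst t)).2 = Sum.inr (writePos m x (l.length + 1)) by
    obtain ⟨t, ht, ht'⟩ := hex
    refine ⟨t, hl, ht, fun _ => ⟨?_, ht'⟩⟩
    rw [ht, hlab]
    dsimp only
    omega
  refine hG.exists_edge _ _ ?_ ?_
  · rw [hlab]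
    simp only [TileSystem.locEdge, hi', decide_true, Bool.true_and]
    obtain ⟨j, hj | hj⟩ := l.length.even_or_odd'
    · rw [hj, writePos_two_mul (by omega), writePos_two_mul_add_one (by omega)]
      simp [TileSystem.posEdge]
    · rw [hj, writePos_two_mul_add_one (by omega)]
      rcases (show j ≤ m by omega).lt_or_eq with h | rfl
      · rw [show 2 * j + 1 + 1 = 2 * (j + 1) by ring, writePos_two_mul (by omega), parity_succ]
        simp [TileSystem.posEdge]
      · rw [writePos_last]
        simp [TileSystem.posEdge, hacc, hlast]
  · intro σ c h
    rw [Sum.inr.injEq, writePos] at h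
    split_ifs at h
    simp only [Option.some.injEq, Prod.mk.injEq] at h
    rw [← h.1]
    exact hletters _ (by omega)

end Strategy

end IsTileGame

end PetriGames

namespace PetriGames

section

variable {L : Type} {m : ℕ} {x : ℕ → L}

theorem writePos_of_le {h : ℕ} (hh : h ≤ 2 * m + 1) :
    writePos m x h = some (x (h / 2), clock h) := if_pos hh

theorem writePos_ne_none {h : ℕ} : writePos m x h ≠ none ↔ h ≤ 2 * m + 1 := by
  unfold writePos
  split_ifs with h1 <;> simp [h1]

theorem ahead_writePos {a b : ℕ} (ha : a ≤ 2 * m + 1)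
    (h : ahead (writePos m x a) (writePos m x b) = false) :
    (b ≤ 2 * m + 1 → b % 4 ≠ (a + 1) % 4) ∧ (2 * m + 1 < b → a % 2 = 0) := by
  rw [writePos_of_le ha] at h
  refine ⟨fun hb => ?_, fun hb => ?_⟩
  · rw [writePos_of_le hb, ahead_clock] at h
    simpa using h
  · rw [writePos, if_neg (not_le.2 hb)] at h
    simp [ahead, clock] at h
    omega

/-- The start tile is never repeated, so the markings that mention it pin the step counter to zero
and not merely to zero modulo four. -/
theorem writePos_eq_start {S : TileSystem L} (hne : ∀ j < m, x (j + 1) ≠ S.start) {h : ℕ}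
    (hh : writePos m x h = some (S.start, false, false)) : h = 0 := by
  have h1 : h ≤ 2 * m + 1 := writePos_ne_none.1 (by rw [hh]; simp)
  rw [writePos_of_le h1] at hh
  simp only [Option.some.injEq, Prod.mk.injEq, clock, decide_eq_false_iff_not] at hh
  by_contra h0
  obtain ⟨j, hj⟩ := Nat.exists_eq_succ_of_ne_zero (show h / 2 ≠ 0 by omega)
  rw [hj] at hh
  exact hne j (by omega) hh.1

end

section WritingIsGood

variable {L : Type} [DecidableEq L] {S : TileSystem L} {m d : ℕ} {x : ℕ → L}

/-- If both players write the tiles of a solution, then every fair sequence of moves visits a good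
state. -/
theorem exists_goodPos (hd0 : 0 < d) (hev : Even d)
    (hinit : ∀ j ≤ m, S.initial (x j) = true ↔ j < d)
    (hhor : ∀ j < m, x (j + 1) ≠ S.start ∧ S.hor (x j) (x (j + 1)) = true)
    (hver : ∀ j, j + d ≤ m → S.ver (x j) (x (j + d)) = true)
    {a : ℕ → Fin 8} {p q : ℕ → ℕ} (ha0 : a 0 = 0)
    (hstep : ∀ k, (envEdge (a k) (a (k + 1)) = true ∧ p (k + 1) = p k ∧ q (k + 1) = q k) ∨
      (a (k + 1) = a k ∧ p (k + 1) = p k + 1 ∧ q (k + 1) = q k) ∨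
      (a (k + 1) = a k ∧ p (k + 1) = p k ∧ q (k + 1) = q k + 1))
    (hpfair : ∀ k, p k < 2 * m + 2 → ∃ j, p k < p j)
    (hqfair : ∀ k, q k < 2 * m + 2 → ∃ j, q k < q j) :
    ∃ k, S.goodPos (a k) (writePos m x (p k)) (writePos m x (q k)) = true := by
  by_contra hcon
  push Not at hcon
  replace hcon : ∀ k, S.goodPos (a k) (writePos m x (p k)) (writePos m x (q k)) = false := by
    simpa using hcon
  have hev2 : d % 2 = 0 := Nat.even_iff.1 hev
  have hstart := fun {h} => writePos_eq_start (S := S) (h := h) fun j hj => (hhor j hj).1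
  -- evaluation of the winning condition in the states of the environment player
  have bad0 : ∀ k, a k = 0 → p k = 0 ∧ q k = 0 := by
    intro k hk
    have := hcon k
    rw [hk] at this
    simp [TileSystem.goodPos] at this
    exact ⟨hstart this.1, hstart this.2⟩
  have bad1 : ∀ k, a k = 1 → p k ≤ 2 * m + 1 ∧ (q k ≤ 2 * m + 1 → q k % 4 ≠ (p k + 1) % 4) ∧
      (2 * m + 1 < q k → p k % 2 = 0) := by
    intro k hk
    have := hcon k
    rw [hk] at this
    simp [TileSystem.goodPos] at this
    have h1 := writePos_ne_none.1 this.1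
    exact ⟨h1, ahead_writePos h1 this.2⟩
  have bad3 : ∀ k, a k = 3 → p k ≤ 2 * m + 1 ∧ (p k < 2 * d → q k = 0) ∧
      (2 * d ≤ p k → (q k ≤ 2 * m + 1 → q k % 4 ≠ (p k + 1) % 4) ∧
      (2 * m + 1 < q k → p k % 2 = 0)) := by
    intro k hk
    have := hcon k
    rw [hk] at this
    simp [TileSystem.goodPos] at this
    have h1 := writePos_ne_none.1 this.1
    have h2 := this.2
    rw [writePos_of_le h1, TileSystem.inStep] at h2
    have h3 := hinit (p k / 2) (by omega)
    refine ⟨h1, fun h => ?_, fun h => ?_⟩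
    · dsimp only at h2
      rw [if_pos (h3.2 (by omega)), decide_eq_true_eq] at h2
      exact hstart h2
    · dsimp only at h2
      rw [if_neg (fun h4 => by have := h3.1 h4; omega), ← writePos_of_le h1, Bool.not_eq_true'] at h2
      exact ahead_writePos h1 h2
  have bad2 : ∀ k, a k = 2 → q k ≤ p k → p k ≤ q k + 2 → p k ≤ 2 * m + 1 → False := by
    intro k hk h1 h2 h3
    have := hcon k
    rw [hk, writePos_of_le h3, writePos_of_le (by omega)] at this
    simp [TileSystem.goodPos, TileSystem.mismatch, clock] at this
    obtain ⟨⟨e1, e2⟩, e3⟩ := this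
    -- Both counters are even here because both tiles have just been written; the lead is therefore
    -- 0 or 2.
    by_cases e : p k = q k
    · simp [e] at e3
    · have e4 : p k = q k + 2 := by omega
      have e5 : p k / 2 = q k / 2 + 1 := by omega
      rw [if_neg (by omega), e5] at e3
      have e6 := (follows_iff S (decide (q k / 2 % 2 = 1)) (x (q k / 2)) (x (q k / 2 + 1))).2
        ⟨(hhor _ (by omega)).2, ?_, (hhor _ (by omega)).1, ?_⟩
      · rw [e6] at e3; simp at e3
      · rw [hinit _ (by omega), hinit _ (by omega)]
        omega
      · intro e7 e8
        rw [hinit _ (by omega)] at e7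
        have e9 : ¬ (q k / 2 + 1 < d) := by
          rw [← hinit _ (by omega), e8]; simp
        rw [decide_eq_true_eq]
        omega
  have bad4 : ∀ k, a k = 4 → p k ≤ 2 * m + 1 → q k ≤ 2 * m + 1 →
      (p k < 2 * d ∨ 2 * d + q k ≤ p k ∧ p k ≤ 2 * d + q k + 2) → False := by
    intro k hk h1 h2 h3
    have := hcon k
    rw [hk, writePos_of_le h1, writePos_of_le h2] at this
    simp [TileSystem.goodPos, TileSystem.verMismatch, clock] at this
    obtain ⟨⟨⟨⟨e1, e2⟩, e3⟩, e4⟩, e5⟩ := this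
    have e6 : ¬ (p k / 2 < d) := by
      rw [← hinit _ (by omega), e3]; simp
    -- Both counters are even, so the lead is 2`d` or 2`d` + 2; equal parity bits and even `d`
    -- exclude the latter.
    have e7 : p k / 2 = q k / 2 + d := by omega
    rw [e7, hver _ (by omega)] at e5
    cases e5
  -- The states 2, 4 and 7 are absent: entering 2 or 4 would be a false claim, whose marking is
  -- good, and 7 is entered only from these.
  have hinv : ∀ k, (a k = 0) ∨ (a k = 1 ∧ q k ≤ p k ∧ p k ≤ q k + 2) ∨
      (a k = 3 ∧ (p k < 2 * d ∨ 2 * d + q k ≤ p k ∧ p k ≤ 2 * d + q k + 2)) ∨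
      a k = 5 ∨ a k = 6 := by
    intro k
    induction k with
    | zero => exact Or.inl ha0
    | succ k ih =>
      rcases hstep k with ⟨s1, s2, s3⟩ | ⟨s1, s2, s3⟩ | ⟨s1, s2, s3⟩
      · have hedge : ∀ b c : Fin 8, envEdge b c = true → (b = 0 → c = 0 ∨ c = 1 ∨ c = 3) ∧
            (b = 1 → c = 1 ∨ c = 2 ∨ c = 5 ∨ c = 6) ∧ (b = 3 → c = 3 ∨ c = 4) ∧
            (b = 5 → c = 5) ∧ (b = 6 → c = 6) := by decide
        obtain ⟨f0, f1, f3, f5, f6⟩ := hedge _ _ s1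
        rcases ih with ih | ih | ih | ih | ih
        · obtain ⟨g1, g2⟩ := bad0 k ih
          rcases f0 ih with e | e | e
          · exact Or.inl e
          · exact Or.inr (Or.inl ⟨e, by omega, by omega⟩)
          · exact Or.inr (Or.inr (Or.inl ⟨e, by omega⟩))
        · have g := bad1 k ih.1
          rcases f1 ih.1 with e | e | e | e
          · exact Or.inr (Or.inl ⟨e, by omega, by omega⟩)
          · exact (bad2 _ e (by omega) (by omega) (by omega)).elim
          · simp [e]
          · simp [e]
        · have g := bad3 k ih.1
          rcases f3 ih.1 with e | e
          · exact Or.inr (Or.inr (Or.inl ⟨e, by omega⟩))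
          · exact (bad4 _ e (by omega) (by omega) (by omega)).elim
        · simp [f5 ih]
        · simp [f6 ih]
      · rcases ih with ih | ih | ih | ih | ih
        · have g := bad0 k ih
          have g' := bad0 (k + 1) (s1.trans ih)
          omega
        · have g := bad1 k ih.1
          -- The next marking is not good either, so a single step cannot take the lead out of its
          -- bounds.
          have g' := bad1 (k + 1) (s1.trans ih.1)
          exact Or.inr (Or.inl ⟨s1.trans ih.1, by omega, by omega⟩)
        · have g := bad3 k ih.1
          have g' := bad3 (k + 1) (s1.trans ih.1)
          exact Or.inr (Or.inr (Or.inl ⟨s1.trans ih.1, by omega⟩))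
        · simp [s1.trans ih]
        · simp [s1.trans ih]
      · rcases ih with ih | ih | ih | ih | ih
        · have g := bad0 k ih
          have g' := bad0 (k + 1) (s1.trans ih)
          omega
        · have g := bad1 k ih.1
          have g' := bad1 (k + 1) (s1.trans ih.1)
          exact Or.inr (Or.inl ⟨s1.trans ih.1, by omega, by omega⟩)
        · have g := bad3 k ih.1
          have g' := bad3 (k + 1) (s1.trans ih.1)
          exact Or.inr (Or.inr (Or.inl ⟨s1.trans ih.1, by omega⟩))
        · simp [s1.trans ih]
        · simp [s1.trans ih]
  -- both players finish
  have hreach : ∀ f : ℕ → ℕ, (∀ k, f k < 2 * m + 2 → ∃ j, f k < f j) → ∃ k, 2 * m + 2 ≤ f k := by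
    intro f hf
    have : ∀ n, n ≤ 2 * m + 2 → ∃ k, n ≤ f k := by
      intro n
      induction n with
      | zero => exact fun _ => ⟨0, Nat.zero_le _⟩
      | succ n ih =>
        intro hn
        obtain ⟨k, hk⟩ := ih (by omega)
        by_cases h : n + 1 ≤ f k
        · exact ⟨k, h⟩
        · obtain ⟨j, hj⟩ := hf k (by omega)
          exact ⟨j, by omega⟩
    exact this _ le_rfl
  have hpm : Monotone p := monotone_nat_of_le_succ fun k => by rcases hstep k with h | h | h <;> omega
  have hqm : Monotone q := monotone_nat_of_le_succ fun k => by rcases hstep k with h | h | h <;> omega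
  obtain ⟨k₁, hk₁⟩ := hreach p hpfair
  obtain ⟨k₂, hk₂⟩ := hreach q hqfair
  have e1 : 2 * m + 2 ≤ p (max k₁ k₂) := hk₁.trans (hpm (le_max_left _ _))
  have e2 : 2 * m + 2 ≤ q (max k₁ k₂) := hk₂.trans (hqm (le_max_right _ _))
  generalize max k₁ k₂ = k at e1 e2
  have w1 : writePos m x (p k) = none := if_neg (by omega)
  have w2 : writePos m x (q k) = none := if_neg (by omega)
  have hk := hcon k
  rw [w1, w2] at hk
  rcases hinv k with h | h | h | h | h
  · have := bad0 k h; omega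
  · have := bad1 k h.1; omega
  · have := bad3 k h.1; omega
  · rw [h] at hk; simp [TileSystem.goodPos, isChoice] at hk
  · rw [h] at hk; simp [TileSystem.goodPos, isChoice] at hk

end WritingIsGood

namespace IsTileGame

variable {L P T : Type} [DecidableEq L] {r : ℕ} {S : TileSystem L} {letters : List L}
  {G : PetriGame P T} {lab : P → Fin (r + 3) × Loc L} {src dst : T → P} {s₀ : Fin (r + 3) → P}

theorem owner_endPlace (hG : IsTileGame S letters G lab src dst s₀) {A : List T → T → Prop}
    {i : Fin (r + 3)} (l : List T) (hl : IsHistory src dst s₀ A i l) :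
    (lab (endPlace dst s₀ i l)).1 = i := by
  induction l with
  | nil => change (lab (s₀ i)).1 = i; rw [hG.lab_init]
  | cons t l ih =>
    have := hG.autonomous.owner_dst t
    change (lab (dst t)).1 = i
    rw [this, hl.2.1, ih hl.1]

theorem lab_endPlace_zero (hG : IsTileGame S letters G lab src dst s₀) {A : List T → T → Prop}
    (l : List T) (hl : IsHistory src dst s₀ A 0 l) :
    ∃ a, lab (endPlace dst s₀ 0 l) = (0, Sum.inl a) := by
  induction l with
  | nil =>
    exact ⟨0, by change lab (s₀ 0) = _; simp [hG.lab_init, TileSystem.initLoc]⟩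
  | cons t l ih =>
    obtain ⟨a, ha⟩ := ih hl.1
    have h1 := hG.owner_endPlace (t :: l) hl
    have h2 := hG.edge t
    rw [hl.2.1, ha] at h2
    rcases h : (lab (dst t)).2 with b | q
    · exact ⟨b, Prod.ext h1 h⟩
    · rw [h] at h2; simp [TileSystem.locEdge] at h2

/-- Such a player starts on a system place, where `writeChoice` allows moves to writers only. -/
theorem history_eq_nil (hG : IsTileGame S letters G lab src dst s₀) {m : ℕ} {x : ℕ → L}
    {i : Fin (r + 3)} (hi : 3 ≤ i.val) (l : List T)
    (hl : IsHistory src dst s₀ (writeChoice G lab src dst m x) i l) : l = [] := by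
  induction l with
  | nil => rfl
  | cons t l ih =>
    obtain rfl := ih hl.1
    have h1 : src t = s₀ i := hl.2.1
    have h2 := hl.2.2
    rw [writeChoice, hG.mem_system, h1, hG.lab_init] at h2
    have h3 : ¬ (i.val = 1 ∨ i.val = 2) := by omega
    have := (h2 (by simp [isSystem, TileSystem.initLoc, h3, hi])).1
    dsimp only at this
    omega

/-- Both writers lay the given tiling blindly, and the padding players never move. The lengths of
the two writing histories serve as the step counters of `exists_goodPos`. -/
theorem hasWinningStrategy (hG : IsTileGame S letters G lab src dst s₀)
    (hS : S.Solvable letters) : HasWinningStrategy G := by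
  obtain ⟨m, d, x, hd0, hdm, hev, hx0, hlet, hinit, hhor, hver, hacc⟩ := hS
  refine ⟨historyProcess hG.autonomous (writeChoice G lab src dst m x),
    historyProcess_isStrategy hG.autonomous (fun l t ht hs => absurd hs ht) ?_,
    historyProcess_isWinning hG.autonomous ?_⟩
  · intro l t t' hst hs h1 h2
    refine hG.trans_ext t t' hst (hG.lab_injective (Prod.ext ?_ ?_))
    · have e1 := hG.autonomous.owner_dst t
      have e2 := hG.autonomous.owner_dst t'
      rw [e1, e2, hst]
    · rw [(h1 hs).2, (h2 (hst ▸ hs)).2]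
  intro g hg0 hg hstep hfair
  have hlast : S.initial (x m) = false := by
    by_contra h
    have := (hinit m le_rfl).1 (by simpa using h)
    omega
  have h1 := fun k => hG.lab_endPlace_writer hx0 (Or.inl rfl) (g k 1) (hg k 1)
  have h2 := fun k => hG.lab_endPlace_writer hx0 (Or.inr rfl) (g k 2) (hg k 2)
  choose a ha using fun k => hG.lab_endPlace_zero (g k 0) (hg k 0)
  obtain ⟨k, hk⟩ := exists_goodPos (S := S) (a := a) (p := fun k => (g k 1).length)
    (q := fun k => (g k 2).length) hd0 hev hinit hhor hver
    (by
      have := ha 0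
      rw [hg0] at this
      change lab (s₀ 0) = _ at this
      simp [hG.lab_init, TileSystem.initLoc] at this
      exact this.symm)
    (by
      intro k
      rcases hstep k with h | ⟨i, t, ht, h⟩
      · left
        have := ha (k + 1)
        rw [h, ha k] at this
        simp only [Prod.mk.injEq, Sum.inl.injEq, true_and] at this
        rw [h, this]
        exact ⟨by simp [envEdge], rfl, rfl⟩
      · by_cases hi0 : i = 0
        · subst hi0
          left
          rw [h, Function.update_of_ne fin_one_ne_zero, Function.update_of_ne fin_two_ne_zero]
          refine ⟨?_, rfl, rfl⟩
          have e1 := ha (k + 1)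
          rw [h, Function.update_self] at e1
          have e2 := hG.edge t
          have e3 : lab (dst t) = _ := e1
          rw [ht.2.1, ha k, e3] at e2
          simpa [TileSystem.locEdge] using e2
        by_cases hi1 : i = 1
        · subst hi1
          right; left
          have e1 := ha (k + 1)
          rw [h, Function.update_of_ne fin_one_ne_zero.symm, ha k] at e1
          simp only [Prod.mk.injEq, Sum.inl.injEq, true_and] at e1
          rw [h, Function.update_self, Function.update_of_ne fin_two_ne_one, e1]
          exact ⟨rfl, rfl, rfl⟩
        by_cases hi2 : i = 2
        · subst hi2
          right; right
          have e1 := ha (k + 1)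
          rw [h, Function.update_of_ne fin_two_ne_zero.symm, ha k] at e1
          simp only [Prod.mk.injEq, Sum.inl.injEq, true_and] at e1
          rw [h, Function.update_self, Function.update_of_ne fin_two_ne_one.symm, e1]
          exact ⟨rfl, rfl, rfl⟩
        · have hi3 : 3 ≤ i.val := by
            have e0 : i.val ≠ 0 := fun h => hi0 (Fin.ext h)
            have e1 : i.val ≠ 1 := fun h => hi1 (Fin.ext h)
            have e2 : i.val ≠ 2 := fun h => hi2 (Fin.ext (h.trans val_fin_two.symm))
            omega
          cases hG.history_eq_nil hi3 _ ht)
    (by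
      intro k hk
      obtain ⟨t, ht⟩ := hG.exists_write hx0 hlet hacc hlast (Or.inl rfl) _ (hg k 1) hk
      exact hfair k 1 t ht)
    (by
      intro k hk
      obtain ⟨t, ht⟩ := hG.exists_write hx0 hlet hacc hlast (Or.inr rfl) _ (hg k 2) hk
      exact hfair k 2 t ht)
  refine ⟨k, (hG.mem_good _ fun i => hG.owner_endPlace _ (hg k i)).2 ⟨a k, _, _, ?_, ?_, ?_, hk, ?_⟩⟩
  · exact congrArg Prod.snd (ha k)
  · exact congrArg Prod.snd (h1 k).2
  · exact congrArg Prod.snd (h2 k).2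
  · intro i hi
    have := hG.history_eq_nil hi _ (hg k i)
    dsimp only
    rw [this]
    change (lab (s₀ i)).2 = _
    have h3 : ¬ (i.val = 1 ∨ i.val = 2) := by omega
    simp [hG.lab_init, TileSystem.initLoc, h3]

end IsTileGame

end PetriGames

/-! ### Tile games meet the restrictions on the players -/

namespace PetriGames

namespace IsTileGame

variable {L P T : Type} [DecidableEq L] {r : ℕ} {S : TileSystem L} {letters : List L}
  {G : PetriGame P T} {lab : P → Fin (r + 3) × Loc L} {src dst : T → P} {s₀ : Fin (r + 3) → P}

/-- Player `i` can move its token to the place labelled by `y`. -/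
def CanReach (lab : P → Fin (r + 3) × Loc L) (src dst : T → P) (s₀ : Fin (r + 3) → P)
    (i : Fin (r + 3)) (y : Loc L) : Prop :=
  ∃ q, lab q = (i, y) ∧ Relation.ReflTransGen (fun p q => ∃ t, src t = p ∧ dst t = q) (s₀ i) q

theorem canReach_init (hG : IsTileGame S letters G lab src dst s₀) (i : Fin (r + 3)) :
    CanReach lab src dst s₀ i (S.initLoc i) :=
  ⟨s₀ i, hG.lab_init i, Relation.ReflTransGen.refl⟩

theorem canReach_step (hG : IsTileGame S letters G lab src dst s₀) {i : Fin (r + 3)} {y z : Loc L}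
    (h : CanReach lab src dst s₀ i y) (he : S.locEdge i y z = true)
    (hz : ∀ σ c, z = Sum.inr (some (σ, c)) → σ ∈ letters) : CanReach lab src dst s₀ i z := by
  obtain ⟨q, hq, hs⟩ := h
  obtain ⟨t, rfl, ht⟩ := hG.exists_edge q z (by rw [hq]; exact he) hz
  refine ⟨dst t, Prod.ext ?_ ht, hs.tail ⟨t, rfl, rfl⟩⟩
  exact (hG.autonomous.owner_dst t).trans (by rw [hq])

theorem canReach_env (hG : IsTileGame S letters G lab src dst s₀) (a : Fin 8) :
    CanReach lab src dst s₀ 0 (Sum.inl a) := by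
  have step : ∀ {a b : Fin 8}, CanReach lab src dst s₀ 0 (Sum.inl a) → envEdge a b = true →
      CanReach lab src dst s₀ 0 (Sum.inl b) := fun h he =>
    hG.canReach_step h (by simpa [TileSystem.locEdge] using he) (by simp)
  have r0 : CanReach lab src dst s₀ 0 (Sum.inl 0) := by
    simpa [TileSystem.initLoc] using hG.canReach_init 0
  have r1 := step (b := 1) r0 rfl
  have r2 := step (b := 2) r1 rfl
  have r3 := step (b := 3) r0 rfl
  have r4 := step (b := 4) r3 rfl
  fin_cases a
  exacts [r0, r1, r2, r3, r4, step r1 rfl, step r1 rfl, step r2 rfl]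

theorem canReach_choice (hG : IsTileGame S letters G lab src dst s₀) {i : Fin (r + 3)}
    (hi : i.val = 1 ∨ i.val = 2) {σ : L} {c : Bool} (hσ : σ ∈ letters)
    (h : CanReach lab src dst s₀ i (Sum.inr (some (σ, c, false)))) :
    CanReach lab src dst s₀ i (Sum.inr (some (σ, c, true))) :=
  hG.canReach_step h (by simp [TileSystem.locEdge, TileSystem.posEdge, hi])
    (by rintro _ _ ⟨⟩; exact hσ)

theorem canReach_tile (hG : IsTileGame S letters G lab src dst s₀) {i : Fin (r + 3)}
    (hi : i.val = 1 ∨ i.val = 2) {σ τ : L} {c : Bool} (hτ : τ ∈ letters)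
    (h : CanReach lab src dst s₀ i (Sum.inr (some (σ, c, true)))) :
    CanReach lab src dst s₀ i (Sum.inr (some (τ, !c, false))) :=
  hG.canReach_step h (by simp [TileSystem.locEdge, TileSystem.posEdge, hi])
    (by rintro _ _ ⟨⟩; exact hτ)

/-- As the moves ignore the tile relations, any tile can be written next, and writing it a second
time corrects the parity bit. The end `none` needs an accepting tile that is not initial. -/
theorem canReach_writer (hG : IsTileGame S letters G lab src dst s₀) (hst : S.start ∈ letters)
    (hacc : ∃ σ ∈ letters, S.accept σ = true ∧ S.initial σ = false) {i : Fin (r + 3)}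
    (hi : i.val = 1 ∨ i.val = 2) {p : Pos L} (hp : ∀ σ c, p = some (σ, c) → σ ∈ letters) :
    CanReach lab src dst s₀ i (Sum.inr p) := by
  have r0 : CanReach lab src dst s₀ i (Sum.inr (some (S.start, false, false))) := by
    simpa [TileSystem.initLoc, hi] using hG.canReach_init i
  have tile : ∀ τ ∈ letters, ∀ c, CanReach lab src dst s₀ i (Sum.inr (some (τ, c, false))) := by
    intro τ hτ c
    have r1 := hG.canReach_tile hi hτ (hG.canReach_choice hi hst r0)
    cases c
    · exact hG.canReach_tile hi hτ (hG.canReach_choice hi hτ r1)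
    · exact r1
  have choice := fun τ hτ c => hG.canReach_choice hi hτ (tile τ hτ c)
  rcases p with _ | ⟨σ, c, _ | _⟩
  · obtain ⟨σ, hσ, h1, h2⟩ := hacc
    exact hG.canReach_step (choice σ hσ false)
      (by simp [TileSystem.locEdge, TileSystem.posEdge, hi, h1, h2]) (by rintro _ _ ⟨⟩)
  · exact tile σ (hp σ _ rfl) c
  · exact choice σ (hp σ _ rfl) c

theorem reachable_of_canReach (hG : IsTileGame S letters G lab src dst s₀) {s : Fin (r + 3) → P}
    (hs : ∀ i, (lab (s i)).1 = i) (h : ∀ i, CanReach lab src dst s₀ i (lab (s i)).2) :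
    G.Reachable (stateMarking s) := by
  refine hG.autonomous.reachable_stateMarking s fun i => ?_
  obtain ⟨q, hq, hr⟩ := h i
  have e : lab (s i) = lab q := hq ▸ Prod.ext (hs i) rfl
  rwa [hG.lab_injective e]

theorem exists_reachable (hG : IsTileGame S letters G lab src dst s₀) {i : Fin (r + 3)} {y : Loc L}
    (h : CanReach lab src dst s₀ i y) : ∃ M, G.Reachable M ∧ ∃ p ∈ M, lab p = (i, y) := by
  obtain ⟨q, hq, hr⟩ := h
  refine ⟨stateMarking (Function.update s₀ i q),
    hG.reachable_of_canReach (fun j => ?_) fun j => ?_, q,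
    mem_stateMarking.2 ⟨i, Function.update_self ..⟩, hq⟩
  · by_cases hj : j = i
    · subst hj; rw [Function.update_self, hq]
    · rw [Function.update_of_ne hj, hG.lab_init]
  · by_cases hj : j = i
    · subst hj; rw [Function.update_self, hq]; exact ⟨q, hq, hr⟩
    · rw [Function.update_of_ne hj, hG.lab_init]; exact hG.canReach_init j

theorem reachable_of_mem_good (hG : IsTileGame S letters G lab src dst s₀)
    (hst : S.start ∈ letters)
    (hacc : ∃ σ ∈ letters, S.accept σ = true ∧ S.initial σ = false) {M : Multiset P}
    (hM : M ∈ G.good) : G.Reachable M := by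
  obtain ⟨s, hs, rfl⟩ := hG.good_state M hM
  obtain ⟨a, p, q, ha, hp, hq, -, hd⟩ := (hG.mem_good s hs).1 hM
  refine hG.reachable_of_canReach hs fun i => ?_
  have hw : ∀ (j : Fin (r + 3)) (p : Pos L), (lab (s j)).2 = Sum.inr p → (j.val = 1 ∨ j.val = 2) →
      CanReach lab src dst s₀ j (lab (s j)).2 := by
    intro j p hp hj
    rw [hp]
    exact hG.canReach_writer hst hacc hj fun σ c h => hG.mem_letters (s j) σ c (by rw [hp, h])
  by_cases h0 : i = 0
  · subst h0; dsimp only at ha; rw [ha]; exact hG.canReach_env a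
  by_cases h1 : i = 1
  · subst h1; exact hw 1 p hp (Or.inl rfl)
  by_cases h2 : i = 2
  · subst h2; exact hw 2 q hq (Or.inr val_fin_two)
  have e0 : i.val ≠ 0 := fun h => h0 (Fin.ext h)
  have e1 : i.val ≠ 1 := fun h => h1 (Fin.ext h)
  have e2 : i.val ≠ 2 := fun h => h2 (Fin.ext (h.trans val_fin_two.symm))
  have := hG.canReach_init i
  rw [TileSystem.initLoc, if_neg (by omega)] at this
  have hd := hd i (by omega)
  dsimp only at hd
  rwa [hd]

/-- A writer passes from a written tile, an environment place, to a choice, a system place, and from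
there to a written tile or to `none`, again environment places. A padding player has a single move.
-/
theorem isSystem_iff_of_locEdge {i : ℕ} (hi : i ≠ 0) {y z : Loc L} (h : S.locEdge i y z = true) :
    isSystem i y = true ↔ ¬ isSystem i z = true := by
  rcases y with a | _ | ⟨σ, c, b⟩ <;> rcases z with a' | _ | ⟨σ', c', b'⟩ <;>
    simp [TileSystem.locEdge, TileSystem.posEdge, hi] at h
  · obtain ⟨⟨h1, rfl⟩, rfl⟩ := h
    simp [isSystem, h1]
  · obtain ⟨h1, h2⟩ := h
    simp [isSystem, isChoice, h1, h2]
  · obtain ⟨h1, h2⟩ := h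
    rcases h2 with h2 | h2 <;> simp [isSystem, isChoice, h1, h2]

theorem isAlternatingGame (hG : IsTileGame S letters G lab src dst s₀) (hst : S.start ∈ letters)
    (hacc : ∃ σ ∈ letters, S.accept σ = true ∧ S.initial σ = false) :
    IsAlternatingGame G (r + 3) := by
  refine ⟨fun M hM => hG.reachable_of_mem_good hst hacc hM, fun p => (lab p).1, ⟨?_, ?_, ?_⟩, 0,
    ?_, ?_⟩
  · intro i
    rw [hG.autonomous.init_eq, stateMarking_map]
    simp only [hG.lab_init, stateMarking, Multiset.map_id']
    exact Multiset.count_eq_one_of_mem Finset.univ.nodup (by simp)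
  · intro t
    rw [hG.autonomous.pre_eq, hG.autonomous.post_eq]
    simpa using (hG.autonomous.owner_dst t).symm
  · intro t
    rw [hG.autonomous.pre_eq]
    simp
  · intro p (hp : (lab p).1 = 0) hs
    rw [hG.mem_system, hp] at hs
    rcases h : (lab p).2 with a | x <;> simp [h, isSystem] at hs
  · intro i hi
    have hi0 : i.val ≠ 0 := fun h => hi (Fin.ext h)
    refine ⟨?_, ?_, ?_⟩
    · intro t p hp q hq h1 h2
      rw [hG.autonomous.pre_eq, Multiset.mem_singleton] at hp
      rw [hG.autonomous.post_eq, Multiset.mem_singleton] at hq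
      subst hp hq
      rw [hG.mem_system, hG.mem_system, h1, h2]
      refine isSystem_iff_of_locEdge hi0 (S := S) ?_
      have := hG.edge t
      rwa [h1] at this
    · suffices h : ∃ y, CanReach lab src dst s₀ i y ∧ isSystem i y = true by
        obtain ⟨y, hy, hs⟩ := h
        obtain ⟨M, hM, p, hp, e⟩ := hG.exists_reachable hy
        exact ⟨M, hM, p, hp, by rw [e], by rw [hG.mem_system, e]; exact hs⟩
      by_cases hw : i.val = 1 ∨ i.val = 2
      · exact ⟨_, hG.canReach_writer hst hacc hw (p := some (S.start, false, true))
          (by rintro _ _ ⟨⟩; exact hst), by simp [isSystem, isChoice, hw]⟩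
      · refine ⟨_, hG.canReach_init i, ?_⟩
        simp [TileSystem.initLoc, hw, isSystem]
        omega
    · suffices h : ∃ y, CanReach lab src dst s₀ i y ∧ isSystem i y = false by
        obtain ⟨y, hy, hs⟩ := h
        obtain ⟨M, hM, p, hp, e⟩ := hG.exists_reachable hy
        exact ⟨M, hM, p, hp, by rw [e], by rw [hG.mem_system, e, hs]; simp⟩
      by_cases hw : i.val = 1 ∨ i.val = 2
      · exact ⟨_, hG.canReach_init i, by simp [isSystem, isChoice, hw, TileSystem.initLoc]⟩
      · refine ⟨Sum.inl 1, hG.canReach_step (hG.canReach_init i) ?_ (by simp), by simp [isSystem]⟩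
        simp [TileSystem.initLoc, hw, TileSystem.locEdge, hi0]
        omega

end IsTileGame

end PetriGames

/-! ### Finite descriptions of the tile games -/

namespace PetriGames

/-- The position of a place in the list of all places. -/
def placeIdx {A : Type} [DecidableEq A] (places : List A) (x : A) : ℕ := places.idxOf x

/-- The code of the game with the places `places` and, for every pair in `edges`, a transition from
the first place to the second one. -/
def codeOf {A : Type} [DecidableEq A] (places : List A) (sys : A → Bool) (edges : List (A × A))
    (init : List A) (good : List (List A)) : GameCode :=
  (places.map sys,
    edges.map fun e => ([placeIdx places e.1], [placeIdx places e.2]),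
    init.map (placeIdx places),
    good.map fun l => l.map (placeIdx places))

section CodeOf

variable {A : Type} {places : List A} {sys : A → Bool}

/-- The name of a place of `codeOf`. -/
def placeName (places : List A) (sys : A → Bool) (p : Fin (places.map sys).length) : A :=
  places.get (p.cast (List.length_map ..))

theorem placeName_injective (h : places.Nodup) : Function.Injective (placeName places sys) := by
  intro p q hpq
  have := List.nodup_iff_injective_get.1 h hpq
  simpa [Fin.ext_iff] using this

theorem placeName_mem (p : Fin (places.map sys).length) : placeName places sys p ∈ places :=
  List.get_mem ..

variable [DecidableEq A]

theorem exists_placeName {x : A} (hx : x ∈ places) :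
    ∃ p : Fin (places.map sys).length, placeName places sys p = x ∧ p.val = placeIdx places x :=
  ⟨⟨placeIdx places x, by simpa [placeIdx, List.idxOf_lt_length_iff] using hx⟩,
    by simp [placeName, placeIdx], rfl⟩

theorem map_toMarking {l : List A} (hl : ∀ x ∈ l, x ∈ places) :
    (toMarking (places.map sys).length (l.map (placeIdx places))).map
      (placeName places sys) = (l : Multiset A) := by
  rw [toMarking, Multiset.map_coe, Multiset.coe_eq_coe]
  refine List.Perm.of_eq ?_
  induction l with
  | nil => rfl
  | cons x l ih =>
    obtain ⟨p, hp, hv⟩ := exists_placeName (sys := sys) (hl x (by simp))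
    have h : placeIdx places x < (places.map sys).length := hv ▸ p.isLt
    rw [List.map_cons, List.filterMap_cons_some (b := p) (by rw [dif_pos h]; simp only [← hv])]
    rw [List.map_cons, hp, ih fun y hy => hl y (by simp [hy])]

/-- With distinct places, naming is injective, so equations between coded markings can be checked on
the names. -/
theorem toMarking_eq_iff (hn : places.Nodup) {l : List A} (hl : ∀ x ∈ l, x ∈ places)
    (M : Multiset (Fin (places.map sys).length)) :
    M = toMarking (places.map sys).length (l.map (placeIdx places)) ↔
      M.map (placeName places sys) = (l : Multiset A) := by
  rw [← map_toMarking (sys := sys) hl]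
  exact ((Multiset.map_injective (placeName_injective hn)).eq_iff).symm

end CodeOf

section TileCode

variable {L : Type} (r : ℕ) (letters : List L)

/-- The positions of the writing players. -/
def positions : List (Pos L) :=
  none :: (letters.product [(false, false), (false, true), (true, false), (true, true)]).map some

/-- The states of the automata. -/
def locs : List (Loc L) := (List.finRange 8).map Sum.inl ++ (positions letters).map Sum.inr

/-- The places of the game for a tile system. -/
def tilePlaces : List (Fin (r + 3) × Loc L) := (List.finRange (r + 3)).product (locs letters)

/-- The state in which only the first three players have moved. -/
def tileState (x y z : Loc L) : List (Fin (r + 3) × Loc L) :=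
  (List.finRange (r + 3)).map fun i =>
    (i, if i = 0 then x else if i = 1 then y else if i = 2 then z else Sum.inl 0)

variable {r letters}

theorem mem_positions {p : Pos L} :
    p ∈ positions letters ↔ ∀ σ c, p = some (σ, c) → σ ∈ letters := by
  rcases p with _ | ⟨σ, c, b⟩
  · simp [positions]
  · simp only [positions, List.mem_cons, reduceCtorEq, false_or, List.mem_map, Option.some.injEq,
      exists_eq_right, List.pair_mem_product, Prod.mk.injEq]
    constructor
    · rintro h _ _ ⟨rfl, -⟩
      exact h.1
    · intro h
      exact ⟨h σ (c, b) ⟨rfl, rfl⟩, by cases c <;> cases b <;> simp⟩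

theorem mem_locs {y : Loc L} :
    y ∈ locs letters ↔ ∀ σ c, y = Sum.inr (some (σ, c)) → σ ∈ letters := by
  rcases y with a | p
  · simp [locs]
  · have : Sum.inr p ∈ locs letters ↔ p ∈ positions letters := by simp [locs]
    rw [this, mem_positions]
    simp

theorem nodup_positions (h : letters.Nodup) : (positions letters).Nodup := by
  rw [positions, List.nodup_cons]
  exact ⟨by simp, List.Nodup.map (Option.some_injective _) (h.product (by decide))⟩

theorem nodup_locs (h : letters.Nodup) : (locs letters).Nodup := by
  rw [locs, List.nodup_append']
  refine ⟨(List.nodup_finRange 8).map Sum.inl_injective,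
    (nodup_positions h).map Sum.inr_injective, ?_⟩
  intro x hx hy
  obtain ⟨a, -, rfl⟩ := List.mem_map.1 hx
  simp at hy

theorem mem_tilePlaces {x : Fin (r + 3) × Loc L} :
    x ∈ tilePlaces r letters ↔ x.2 ∈ locs letters := by
  obtain ⟨i, y⟩ := x
  rw [tilePlaces, List.pair_mem_product]
  simp

theorem nodup_tilePlaces (h : letters.Nodup) : (tilePlaces r letters).Nodup :=
  (List.nodup_finRange _).product (nodup_locs h)

theorem mem_tileState {x y z : Loc L} (hx : x ∈ locs letters) (hy : y ∈ locs letters)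
    (hz : z ∈ locs letters) : ∀ p ∈ tileState r x y z, p ∈ tilePlaces r letters := by
  intro p hp
  obtain ⟨i, -, rfl⟩ := List.mem_map.1 hp
  rw [mem_tilePlaces]
  dsimp only
  split_ifs
  exacts [hx, hy, hz, mem_locs.2 (by simp)]

/-- Each place name contains its player, so the multiset of names determines the place of each
player. -/
theorem map_stateMarking_eq_tileState {P : Type} {lab : P → Fin (r + 3) × Loc L}
    {s : Fin (r + 3) → P} (hs : ∀ i, (lab (s i)).1 = i) {x y z : Loc L} :
    (stateMarking s).map lab = (tileState r x y z : Multiset (Fin (r + 3) × Loc L)) ↔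
      (lab (s 0)).2 = x ∧ (lab (s 1)).2 = y ∧ (lab (s 2)).2 = z ∧
        ∀ i : Fin (r + 3), 3 ≤ i.val → (lab (s i)).2 = Sum.inl 0 := by
  set f : Fin (r + 3) → Loc L := fun i =>
    if i = 0 then x else if i = 1 then y else if i = 2 then z else Sum.inl 0 with hf
  have h1 : (tileState r x y z : Multiset (Fin (r + 3) × Loc L)) = stateMarking fun i => (i, f i) := by
    rw [tileState, ← Multiset.map_coe, stateMarking]
    rfl
  have h2 : (stateMarking s).map lab = stateMarking fun i => (i, (lab (s i)).2) := by
    rw [stateMarking_map]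
    congr 1
    funext i
    exact Prod.ext (hs i) rfl
  have h3 : (stateMarking s).map lab = (tileState r x y z : Multiset (Fin (r + 3) × Loc L)) ↔
      ∀ i, (lab (s i)).2 = f i := by
    rw [h1, h2]
    constructor
    · intro h i
      have : (i, (lab (s i)).2) ∈ stateMarking fun i => (i, f i) :=
        h ▸ mem_stateMarking.2 ⟨i, rfl⟩
      obtain ⟨j, hj⟩ := mem_stateMarking.1 this
      simp only [Prod.mk.injEq] at hj
      obtain ⟨rfl, hj⟩ := hj
      exact hj.symm
    · intro h
      simp only [h]
  rw [h3]
  constructor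
  · intro h
    refine ⟨(h 0).trans (by simp [hf]), (h 1).trans (by simp [hf]),
      (h 2).trans (by simp [hf, fin_two_ne_zero, fin_two_ne_one]), fun i hi => (h i).trans ?_⟩
    have h0 : i ≠ 0 := by rintro rfl; simp at hi
    have h1 : i ≠ 1 := by rintro rfl; simp at hi
    have h2 : i ≠ 2 := by rintro rfl; rw [val_fin_two] at hi; omega
    simp [hf, h0, h1, h2]
  · rintro ⟨h0, h1, h2, h3⟩ i
    simp only [hf]
    split_ifs with e0 e1 e2
    · rw [e0, h0]
    · rw [e1, h1]
    · rw [e2, h2]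
    · have e0 : i.val ≠ 0 := fun h => e0 (Fin.ext h)
      have e1 : i.val ≠ 1 := fun h => e1 (Fin.ext h)
      have e2 : i.val ≠ 2 := fun h => e2 (Fin.ext (h.trans val_fin_two.symm))
      exact h3 i (by omega)

variable [DecidableEq L] (r letters) (S : TileSystem L)

/-- The transitions of the game for a tile system. -/
def tileEdges : List ((Fin (r + 3) × Loc L) × (Fin (r + 3) × Loc L)) :=
  ((tilePlaces r letters).product (tilePlaces r letters)).filter fun e =>
    decide (e.1.1 = e.2.1) && S.locEdge e.1.1 e.1.2 e.2.2

/-- The good markings of the game for a tile system. -/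
def tileGoods : List (List (Fin (r + 3) × Loc L)) :=
  (((List.finRange 8).product ((positions letters).product (positions letters))).filter fun e =>
    S.goodPos e.1 e.2.1 e.2.2).map fun e =>
      tileState r (Sum.inl e.1) (Sum.inr e.2.1) (Sum.inr e.2.2)

/-- The code of the game for a tile system. -/
def tileCode : GameCode :=
  codeOf (tilePlaces r letters) (fun x => isSystem x.1 x.2) (tileEdges r letters S)
    (tileState r (Sum.inl 0) (Sum.inr (some (S.start, false, false)))
      (Sum.inr (some (S.start, false, false))))
    (tileGoods r letters S)

variable {r letters S}

theorem mem_tileEdges {e : (Fin (r + 3) × Loc L) × (Fin (r + 3) × Loc L)} :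
    e ∈ tileEdges r letters S ↔ (e.1.2 ∈ locs letters ∧ e.2.2 ∈ locs letters) ∧ e.1.1 = e.2.1 ∧
      S.locEdge e.1.1 e.1.2 e.2.2 = true := by
  obtain ⟨x, y⟩ := e
  rw [tileEdges, List.mem_filter, List.pair_mem_product, mem_tilePlaces, mem_tilePlaces]
  simp

theorem mem_tileGoods {l : List (Fin (r + 3) × Loc L)} :
    l ∈ tileGoods r letters S ↔ ∃ a p q, p ∈ positions letters ∧ q ∈ positions letters ∧
      S.goodPos a p q = true ∧ l = tileState r (Sum.inl a) (Sum.inr p) (Sum.inr q) := by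
  rw [tileGoods, List.mem_map]
  constructor
  · rintro ⟨⟨a, p, q⟩, h, rfl⟩
    obtain ⟨h1, h2⟩ := List.mem_filter.1 h
    have h3 := List.pair_mem_product.1 (List.pair_mem_product.1 h1).2
    exact ⟨a, p, q, h3.1, h3.2, h2, rfl⟩
  · rintro ⟨a, p, q, hp, hq, h, rfl⟩
    refine ⟨(a, p, q), List.mem_filter.2 ⟨?_, h⟩, rfl⟩
    exact List.pair_mem_product.2 ⟨List.mem_finRange a, List.pair_mem_product.2 ⟨hp, hq⟩⟩

/-- Distinct letters make the lists of places and edges free of repetitions, so positions in them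
correspond to places and transitions one to one. This gives the injectivity of `lab` and
`trans_ext`. -/
theorem isTileGame_tileCode (hn : letters.Nodup) (hst : S.start ∈ letters) :
    ∃ src dst s₀, IsTileGame S letters (tileCode r letters S).toGame
      (placeName (tilePlaces r letters) fun x => isSystem x.1 x.2) src dst s₀ := by
  set sys : Fin (r + 3) × Loc L → Bool := fun x => isSystem x.1 x.2 with hsys
  set lab := placeName (tilePlaces r letters) sys with hlab
  have hnd : (tilePlaces r letters).Nodup := nodup_tilePlaces hn
  have hinj : Function.Injective lab := placeName_injective hnd
  have hplace : ∀ i, ∀ y ∈ locs letters, ∃ p, lab p = (i, y) := fun i y hy =>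
    (exists_placeName (sys := sys) (mem_tilePlaces.2 hy)).imp fun p hp => hp.1
  have hloc : ∀ p, (lab p).2 ∈ locs letters := fun p => mem_tilePlaces.1 (placeName_mem p)
  have hpos : ∀ {p : Pos L}, p ∈ positions letters → Sum.inr p ∈ locs letters := fun hp =>
    List.mem_append_right _ (List.mem_map_of_mem hp)
  have hpos' : ∀ {p : Pos L}, Sum.inr p ∈ locs letters → p ∈ positions letters := by
    intro p hp
    simpa [locs] using hp
  have hsloc : Sum.inr (some (S.start, false, false)) ∈ locs letters :=
    mem_locs.2 (by rintro _ _ ⟨⟩; exact hst)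
  have hlen : (tileCode r letters S).2.1.length = (tileEdges r letters S).length :=
    List.length_map ..
  let E : Fin (tileCode r letters S).2.1.length → _ := fun t =>
    (tileEdges r letters S).get (t.cast hlen)
  have hE : ∀ t, E t ∈ tileEdges r letters S := fun t => List.get_mem ..
  have hE' := fun t => mem_tileEdges.1 (hE t)
  have hEinj : Function.Injective E := by
    intro t t' h
    have := List.nodup_iff_injective_get.1 ((hnd.product hnd).filter _) h
    exact Fin.cast_injective hlen this
  have hcode : ∀ t, (tileCode r letters S).2.1.get t =
      ([placeIdx (tilePlaces r letters) (E t).1], [placeIdx (tilePlaces r letters) (E t).2]) := by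
    intro t
    exact List.getElem_map (l := tileEdges r letters S) (i := t.val)
      (f := fun e : (Fin (r + 3) × Loc L) × (Fin (r + 3) × Loc L) =>
        ([placeIdx (tilePlaces r letters) e.1], [placeIdx (tilePlaces r letters) e.2]))
      (h := t.isLt)
  choose src hsrc using fun t => hplace (E t).1.1 (E t).1.2 (hE' t).1.1
  choose dst hdst using fun t => hplace (E t).2.1 (E t).2.2 (hE' t).1.2
  choose s₀ hs₀ using fun i : Fin (r + 3) => hplace i (S.initLoc i) (by
    rw [TileSystem.initLoc]
    split_ifs
    · exact hsloc
    · exact mem_locs.2 (by simp))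
  have hgood : ∀ M : Multiset (Fin ((tilePlaces r letters).map sys).length), M ∈ (tileCode r letters S).toGame.good ↔
      ∃ l ∈ tileGoods r letters S, M.map lab = (l : Multiset _) := by
    intro M
    change (∃ l ∈ (tileGoods r letters S).map _, M = toMarking _ l) ↔ _
    have key : ∀ l ∈ tileGoods r letters S, (M = toMarking ((tilePlaces r letters).map sys).length
        (l.map (placeIdx (tilePlaces r letters))) ↔ M.map lab = (l : Multiset _)) := by
      intro l hl
      obtain ⟨a, p, q, hp, hq, -, rfl⟩ := mem_tileGoods.1 hl
      have ha : Sum.inl a ∈ locs letters := mem_locs.2 (by simp)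
      exact toMarking_eq_iff (sys := sys) hnd (mem_tileState ha (hpos hp) (hpos hq)) M
    constructor
    · rintro ⟨l', hl', h⟩
      obtain ⟨l, hl, rfl⟩ := List.mem_map.1 hl'
      exact ⟨l, hl, (key l hl).1 h⟩
    · rintro ⟨l, hl, h⟩
      exact ⟨_, List.mem_map.2 ⟨l, hl, rfl⟩, (key l hl).2 h⟩
  refine ⟨src, dst, s₀, hinj, fun p σ c h => mem_locs.1 (hloc p) σ c h, ⟨?_, ?_, ?_, ?_, ?_⟩, hs₀, ?_,
    ?_, ?_, ?_, ?_, ?_⟩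
  · intro t
    change toMarking ((tilePlaces r letters).map sys).length ((tileCode r letters S).2.1.get t).1 = _
    rw [hcode]
    refine ((toMarking_eq_iff (sys := sys) hnd (l := [(E t).1]) ?_ _).2 ?_).symm
    · simpa using mem_tilePlaces.2 (hE' t).1.1
    · exact (Multiset.map_singleton _ _).trans (congrArg _ (hsrc t))
  · intro t
    change toMarking ((tilePlaces r letters).map sys).length ((tileCode r letters S).2.1.get t).2 = _
    rw [hcode]
    refine ((toMarking_eq_iff (sys := sys) hnd (l := [(E t).2]) ?_ _).2 ?_).symm
    · simpa using mem_tilePlaces.2 (hE' t).1.2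
    · exact (Multiset.map_singleton _ _).trans (congrArg _ (hdst t))
  · refine Eq.symm ?_
    refine (toMarking_eq_iff (sys := sys) hnd
      (mem_tileState (x := Sum.inl 0) (mem_locs.2 (by simp)) hsloc hsloc) _).2 ?_
    refine (map_stateMarking_eq_tileState fun i => by rw [← hlab, hs₀]).2 ?_
    refine ⟨?_, ?_, ?_, fun i hi => ?_⟩ <;> rw [← hlab, hs₀]
    · simp [TileSystem.initLoc]
    · simp [TileSystem.initLoc]
    · simp [TileSystem.initLoc]
    · exact if_neg (by omega)
  · intro i
    rw [hs₀]
  · intro t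
    rw [hsrc, hdst]
    exact (hE' t).2.1.symm
  · intro t
    rw [hsrc, hdst]
    exact (hE' t).2.2
  · intro p y h hy
    have h1 := hloc p
    have h2 := mem_locs.2 hy
    have h3 : (lab p, ((lab p).1, y)) ∈ tileEdges r letters S :=
      mem_tileEdges.2 ⟨⟨h1, h2⟩, rfl, h⟩
    obtain ⟨k, hk⟩ := List.get_of_mem h3
    have hEk : E (k.cast hlen.symm) = (lab p, ((lab p).1, y)) := hk
    refine ⟨k.cast hlen.symm, hinj ?_, ?_⟩
    · rw [hsrc, hEk]
    · rw [hdst, hEk]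
  · intro t t' h1 h2
    refine hEinj (Prod.ext ?_ ?_)
    · exact (hsrc t).symm.trans ((congrArg lab h1).trans (hsrc t'))
    · exact (hdst t).symm.trans ((congrArg lab h2).trans (hdst t'))
  · intro p
    change ((tilePlaces r letters).map sys).get p = true ↔ _
    rw [← show sys (lab p) = ((tilePlaces r letters).map sys).get p from
      (List.getElem_map (l := tilePlaces r letters) (i := p.val) (h := p.isLt) sys).symm]
  · intro M hM
    obtain ⟨l, hl, hMl⟩ := (hgood M).1 hM
    obtain ⟨a, p, q, hp, hq, -, rfl⟩ := mem_tileGoods.1 hl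
    have ha : Sum.inl a ∈ locs letters := mem_locs.2 (by simp)
    choose s hs using fun i : Fin (r + 3) => hplace i
      (if i = 0 then Sum.inl a else if i = 1 then Sum.inr p else if i = 2 then Sum.inr q
        else Sum.inl 0) (by
          split_ifs
          exacts [ha, hpos hp, hpos hq, mem_locs.2 (by simp)])
    refine ⟨s, fun i => by rw [hs], Multiset.map_injective hinj ?_⟩
    rw [hMl]
    refine Eq.symm ?_
    refine (map_stateMarking_eq_tileState fun i => by rw [hs]).2 ?_
    refine ⟨?_, ?_, ?_, fun i hi => ?_⟩ <;> rw [hs]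
    · simp
    · simp
    · simp [fin_two_ne_zero, fin_two_ne_one]
    · have h0 : i ≠ 0 := by rintro rfl; simp at hi
      have h1 : i ≠ 1 := by rintro rfl; simp at hi
      have h2 : i ≠ 2 := by rintro rfl; rw [val_fin_two] at hi; omega
      simp [h0, h1, h2]
  · intro s hs
    refine (hgood _).trans ⟨?_, ?_⟩
    · rintro ⟨l, hl, hMl⟩
      obtain ⟨a, p, q, hp, hq, h, rfl⟩ := mem_tileGoods.1 hl
      obtain ⟨h1, h2, h3, h4⟩ := (map_stateMarking_eq_tileState hs).1 hMl
      exact ⟨a, p, q, h1, h2, h3, h, h4⟩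
    · rintro ⟨a, p, q, h1, h2, h3, h, h4⟩
      dsimp only at h1 h2 h3
      exact ⟨_, mem_tileGoods.2 ⟨a, p, q, hpos' (h2 ▸ hloc _), hpos' (h3 ▸ hloc _), h, rfl⟩,
        (map_stateMarking_eq_tileState hs).2 ⟨h1, h2, h3, h4⟩⟩

end TileCode

end PetriGames

/-! ### The code of a tile game is primitive recursive in the tile system -/

namespace PetriGames

section Primrec

variable {α β γ σ : Type} [Primcodable α] [Primcodable β] [Primcodable γ] [Primcodable σ]

theorem primrec_and {f g : α → Bool} (hf : Primrec f) (hg : Primrec g) :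
    Primrec fun a => f a && g a := Primrec.and.comp hf hg

theorem primrec_or {f g : α → Bool} (hf : Primrec f) (hg : Primrec g) :
    Primrec fun a => f a || g a := Primrec.or.comp hf hg

theorem primrec_not {f : α → Bool} (hf : Primrec f) : Primrec fun a => !f a := Primrec.not.comp hf

theorem primrec_bxor {f g : α → Bool} (hf : Primrec f) (hg : Primrec g) :
    Primrec fun a => f a ^^ g a :=
  (Primrec.dom_finite fun x : Bool × Bool => x.1 ^^ x.2).comp (hf.pair hg)

theorem primrec_beq [DecidableEq β] {f g : α → β} (hf : Primrec f) (hg : Primrec g) :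
    Primrec fun a => f a == g a := Primrec.beq.comp hf hg

theorem primrec_decide_eq [DecidableEq β] {f g : α → β} (hf : Primrec f) (hg : Primrec g) :
    Primrec fun a => decide (f a = g a) := (Primrec.eq.comp hf hg).decide

theorem primrec_option_cases {f : α → Option β → σ} (h0 : Primrec fun a => f a none)
    (h1 : Primrec fun x : α × β => f x.1 (some x.2)) : Primrec fun x : α × Option β => f x.1 x.2 :=
  (Primrec.option_casesOn Primrec.snd (h0.comp Primrec.fst)
    (h1.comp ((Primrec.fst.comp Primrec.fst).pair Primrec.snd)).to₂).of_eq
      fun x => by rcases x with ⟨a, _ | b⟩ <;> rfl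

theorem primrec_sum_cases {f : α → β ⊕ γ → σ} (h0 : Primrec fun x : α × β => f x.1 (Sum.inl x.2))
    (h1 : Primrec fun x : α × γ => f x.1 (Sum.inr x.2)) : Primrec fun x : α × (β ⊕ γ) => f x.1 x.2 :=
  (Primrec.sumCasesOn Primrec.snd
    (h0.comp ((Primrec.fst.comp Primrec.fst).pair Primrec.snd)).to₂
    (h1.comp ((Primrec.fst.comp Primrec.fst).pair Primrec.snd)).to₂).of_eq
      fun x => by rcases x with ⟨a, b | c⟩ <;> rfl

theorem primrec_list_filter {f : α → List β} {p : α → β → Bool} (hf : Primrec f)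
    (hp : Primrec₂ p) : Primrec fun a => (f a).filter (p a) := by
  have h : Primrec₂ fun a b => bif p a b then [b] else [] :=
    Primrec.cond hp (Primrec.list_cons.comp Primrec.snd (Primrec.const [])) (Primrec.const [])
  refine (Primrec.list_flatMap hf h).of_eq fun a => ?_
  induction f a with
  | nil => rfl
  | cons b l ih => cases h : p a b <;> simp [h, ih]

theorem primrec_list_product {f : α → List β} {g : α → List γ} (hf : Primrec f)
    (hg : Primrec g) : Primrec fun a => (f a).product (g a) :=
  Primrec.list_flatMap hf (Primrec.list_map (hg.comp Primrec.fst)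
    ((Primrec.snd.comp Primrec.fst).pair Primrec.snd).to₂).to₂

theorem primrec_codeOf [DecidableEq β] {places : α → List β} {sys : β → Bool}
    {edges : α → List (β × β)} {init : α → List β} {good : α → List (List β)}
    (h1 : Primrec places) (h2 : Primrec sys) (h3 : Primrec edges) (h4 : Primrec init)
    (h5 : Primrec good) :
    Primrec fun a => codeOf (places a) sys (edges a) (init a) (good a) := by
  have hidx : Primrec fun x : α × β => placeIdx (places x.1) x.2 :=
    (Primrec.list_idxOf (α := β)).comp Primrec.snd (h1.comp Primrec.fst)
  have hsing : ∀ {f : α × β × β → β}, Primrec f →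
      Primrec fun x => [placeIdx (places x.1) (f x)] := fun hf =>
    Primrec.list_cons.comp (hidx.comp (Primrec.fst.pair hf)) (Primrec.const [])
  refine (Primrec.list_map h1 (h2.comp Primrec.snd).to₂).pair
    (Primrec.pair ?_ (Primrec.pair (Primrec.list_map h4 hidx.to₂) ?_))
  · exact Primrec.list_map h3 ((hsing (Primrec.fst.comp Primrec.snd)).pair
      (hsing (Primrec.snd.comp Primrec.snd))).to₂
  · exact Primrec.list_map h5 (Primrec.list_map Primrec.snd
      (hidx.comp ((Primrec.fst.comp Primrec.fst).pair Primrec.snd)).to₂).to₂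

end Primrec

/-- The tile systems `S k` are given uniformly by primitive recursive functions. -/
structure TileSystem.IsPrimrec {L : Type} [Primcodable L] (S : ℕ → TileSystem L) : Prop where
  start : Primrec fun k => (S k).start
  initial : Primrec fun x : ℕ × L => (S x.1).initial x.2
  hor : Primrec fun x : ℕ × L × L => (S x.1).hor x.2.1 x.2.2
  ver : Primrec fun x : ℕ × L × L => (S x.1).ver x.2.1 x.2.2
  accept : Primrec fun x : ℕ × L => (S x.1).accept x.2

section TilePrimrec

open Primrec

variable {L : Type} [Primcodable L]

theorem primrec_positions {letters : ℕ → List L} (h : Primrec letters) :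
    Primrec fun k => positions (letters k) :=
  list_cons.comp (const _) (list_map (primrec_list_product h (const _)) (option_some.comp snd).to₂)

theorem primrec_locs {letters : ℕ → List L} (h : Primrec letters) :
    Primrec fun k => locs (letters k) :=
  list_append.comp (const _) (list_map (primrec_positions h) (sumInr.comp snd).to₂)

theorem primrec_tilePlaces {r : ℕ} {letters : ℕ → List L} (h : Primrec letters) :
    Primrec fun k => tilePlaces r (letters k) :=
  primrec_list_product (const _) (primrec_locs h)

theorem primrec_isChoice : Primrec (isChoice : Pos L → Bool) :=
  (primrec_option_cases (f := fun (_ : Unit) (p : Pos L) => isChoice p) (const false)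
    (snd.comp (snd.comp snd))).comp ((const ()).pair Primrec.id)

theorem primrec_isSystem {r : ℕ} :
    Primrec fun x : Fin (r + 3) × Loc L => isSystem x.1 x.2 := by
  refine primrec_sum_cases (f := fun (i : Fin (r + 3)) (y : Loc L) => isSystem i y) ?_ ?_
  · exact dom_finite _
  · exact primrec_and ((dom_finite fun i : Fin (r + 3) => decide (i.val = 1 ∨ i.val = 2)).comp fst)
      (primrec_isChoice.comp snd)

theorem primrec_ahead : Primrec fun x : Pos L × Pos L => ahead x.1 x.2 := by
  refine Primrec.comp (f := fun x : Pos L × Pos L => ahead x.2 x.1) ?_ (snd.pair fst)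
  refine primrec_option_cases (f := fun (q p : Pos L) => ahead p q) (const false) ?_
  refine Primrec.comp (f := fun x : (L × Bool × Bool) × Pos L => ahead (some x.1) x.2) ?_
    (snd.pair fst)
  refine primrec_option_cases (f := fun x (q : Pos L) => ahead (some x) q) (snd.comp snd) ?_
  exact primrec_and (primrec_beq (fst.comp (snd.comp snd))
      (primrec_bxor (fst.comp (snd.comp fst)) (snd.comp (snd.comp fst))))
    (primrec_beq (snd.comp (snd.comp snd)) (primrec_not (snd.comp (snd.comp fst))))

/-- A criterion for predicates that are defined by cases on two positions. -/
theorem primrec_pos_cases {f : ℕ → Pos L → Pos L → Bool} (h0 : ∀ k q, f k none q = f k none none)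
    (h00 : Primrec fun k => f k none none)
    (h1 : Primrec fun x : ℕ × L × Bool × Bool => f x.1 (some x.2) none)
    (h2 : Primrec fun x : (ℕ × L × Bool × Bool) × L × Bool × Bool =>
      f x.1.1 (some x.1.2) (some x.2)) :
    Primrec fun x : ℕ × Pos L × Pos L => f x.1 x.2.1 x.2.2 := by
  have e1 : Primrec fun x : (ℕ × L × Bool × Bool) × Pos L => f x.1.1 (some x.1.2) x.2 :=
    primrec_option_cases (f := fun (x : ℕ × L × Bool × Bool) q => f x.1 (some x.2) q) h1 h2
  have e2 : Primrec fun x : (ℕ × Pos L) × Pos L => f x.1.1 x.2 x.1.2 := by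
    refine primrec_option_cases (f := fun (x : ℕ × Pos L) p => f x.1 p x.2) ?_ ?_
    · exact (h00.comp fst).of_eq fun x => (h0 _ _).symm
    · exact e1.comp (((fst.comp fst).pair snd).pair (snd.comp fst))
  exact e2.comp ((fst.pair (snd.comp snd)).pair (fst.comp snd))

theorem primrec_startPos {S : ℕ → TileSystem L} (hS : TileSystem.IsPrimrec S) :
    Primrec fun k => (some ((S k).start, false, false) : Pos L) :=
  option_some.comp (hS.start.pair (const _))

theorem primrec_tileState {r : ℕ} :
    Primrec fun x : Loc L × Loc L × Loc L => tileState r x.1 x.2.1 x.2.2 := by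
  have h : Primrec fun x : (Loc L × Loc L × Loc L) × Fin (r + 3) => if x.2 = 0 then x.1.1 else
      if x.2 = 1 then x.1.2.1 else if x.2 = 2 then x.1.2.2 else Sum.inl 0 :=
    Primrec.ite (Primrec.eq.comp snd (const _)) (fst.comp fst)
      (Primrec.ite (Primrec.eq.comp snd (const _)) (fst.comp (snd.comp fst))
        (Primrec.ite (Primrec.eq.comp snd (const _)) (snd.comp (snd.comp fst)) (const _)))
  exact list_map (const _) (snd.pair h).to₂

theorem primrec_verMismatch {S : ℕ → TileSystem L} (hS : TileSystem.IsPrimrec S) :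
    Primrec fun x : ℕ × Pos L × Pos L => (S x.1).verMismatch x.2.1 x.2.2 := by
  refine primrec_pos_cases (f := fun k p q => (S k).verMismatch p q) (fun _ q => by cases q <;> rfl)
    (const false) (const false) ?_
  refine primrec_and (primrec_and (primrec_and (primrec_and
    (primrec_not (snd.comp (snd.comp (snd.comp fst))))
    (primrec_not (snd.comp (snd.comp snd)))) (primrec_not ?_))
    (primrec_beq (fst.comp (snd.comp (snd.comp fst))) (fst.comp (snd.comp snd)))) ?_
  · exact hS.initial.comp ((fst.comp fst).pair (fst.comp (snd.comp fst)))
  · have h : Primrec fun x : (ℕ × L × Bool × Bool) × L × Bool × Bool => (x.1.1, x.2.1, x.1.2.1) :=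
      (fst.comp fst).pair ((fst.comp snd).pair (fst.comp (snd.comp fst)))
    exact primrec_not (hS.ver.comp h)

variable [DecidableEq L] {S : ℕ → TileSystem L}

theorem primrec_follows (hS : TileSystem.IsPrimrec S) :
    Primrec fun x : ℕ × Bool × L × L => (S x.1).follows x.2.1 x.2.2.1 x.2.2.2 := by
  have h1 := hS.initial.comp (fst.pair (fst.comp (snd.comp snd)) : Primrec fun x :
    ℕ × Bool × L × L => (x.1, x.2.2.1))
  have h2 := hS.initial.comp (fst.pair (snd.comp (snd.comp snd)) : Primrec fun x :
    ℕ × Bool × L × L => (x.1, x.2.2.2))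
  have h3 := hS.hor.comp (fst.pair (snd.comp snd) : Primrec fun x :
    ℕ × Bool × L × L => (x.1, x.2.2))
  exact primrec_and (primrec_and (primrec_and h3 (primrec_or (primrec_not h2) h1))
    (primrec_not (primrec_decide_eq (snd.comp (snd.comp snd)) (hS.start.comp fst))))
    (primrec_or (primrec_or (primrec_not h1) h2) (fst.comp snd))

theorem primrec_mismatch (hS : TileSystem.IsPrimrec S) :
    Primrec fun x : ℕ × Pos L × Pos L => (S x.1).mismatch x.2.1 x.2.2 := by
  refine primrec_pos_cases (f := fun k p q => (S k).mismatch p q) (fun _ _ => rfl) (const false)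
    (primrec_not (snd.comp (snd.comp snd))) ?_
  refine primrec_and (primrec_and (primrec_not (snd.comp (snd.comp (snd.comp fst))))
    (primrec_not (snd.comp (snd.comp snd)))) ?_
  refine Primrec.ite (Primrec.eq.comp (fst.comp (snd.comp (snd.comp fst)))
    (fst.comp (snd.comp snd))) (primrec_not (primrec_decide_eq (fst.comp (snd.comp fst))
      (fst.comp snd))) (primrec_not ?_)
  exact (primrec_follows hS).comp ((fst.comp fst).pair ((fst.comp (snd.comp snd)).pair
    ((fst.comp snd).pair (fst.comp (snd.comp fst)))))

theorem primrec_inStep (hS : TileSystem.IsPrimrec S) :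
    Primrec fun x : ℕ × Pos L × Pos L => (S x.1).inStep x.2.1 x.2.2 := by
  refine Primrec.comp (f := fun x : (ℕ × Pos L) × Pos L => (S x.1.1).inStep x.2 x.1.2) ?_
    ((fst.pair (snd.comp snd)).pair (fst.comp snd))
  refine primrec_option_cases (f := fun (x : ℕ × Pos L) p => (S x.1).inStep p x.2) (const true) ?_
  refine Primrec.ite ?_ (primrec_decide_eq (snd.comp fst)
    ((primrec_startPos hS).comp (fst.comp fst))) (primrec_not ?_)
  · exact Primrec.eq.comp (hS.initial.comp ((fst.comp fst).pair (fst.comp snd))) (const true)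
  · exact primrec_ahead.comp ((option_some.comp snd).pair (snd.comp fst))

theorem primrec_goodPos (hS : TileSystem.IsPrimrec S) :
    Primrec fun x : ℕ × Fin 8 × Pos L × Pos L => (S x.1).goodPos x.2.1 x.2.2.1 x.2.2.2 := by
  have ha : ∀ b : Fin 8, Primrec fun x : ℕ × Fin 8 × Pos L × Pos L => decide (x.2.1 = b) :=
    fun b => primrec_decide_eq (fst.comp snd) (const b)
  have hp : Primrec fun x : ℕ × Fin 8 × Pos L × Pos L => x.2.2.1 := fst.comp (snd.comp snd)
  have hq : Primrec fun x : ℕ × Fin 8 × Pos L × Pos L => x.2.2.2 := snd.comp (snd.comp snd)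
  have hk : Primrec fun x : ℕ × Fin 8 × Pos L × Pos L => (x.1, x.2.2) := fst.pair (snd.comp snd)
  have hs := (primrec_startPos hS).comp (fst : Primrec fun x : ℕ × Fin 8 × Pos L × Pos L => x.1)
  exact primrec_or (primrec_or (primrec_or (primrec_or (primrec_or (primrec_or
    (primrec_and (ha 0) (primrec_not (primrec_and (primrec_decide_eq hp hs)
      (primrec_decide_eq hq hs))))
    (primrec_and (ha 1) (primrec_or (primrec_decide_eq hp (const none))
      (primrec_ahead.comp (snd.comp snd)))))
    (primrec_and (ha 2) (primrec_not ((primrec_mismatch hS).comp hk))))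
    (primrec_and (ha 3) (primrec_or (primrec_decide_eq hp (const none))
      (primrec_not ((primrec_inStep hS).comp hk)))))
    (primrec_and (ha 4) (primrec_not ((primrec_verMismatch hS).comp hk))))
    (primrec_and (ha 5) (primrec_not (primrec_isChoice.comp hp))))
    (primrec_and (ha 6) (primrec_not (primrec_isChoice.comp hq)))

theorem primrec_posEdge (hS : TileSystem.IsPrimrec S) :
    Primrec fun x : ℕ × Pos L × Pos L => (S x.1).posEdge x.2.1 x.2.2 := by
  refine primrec_pos_cases (f := fun k p q => (S k).posEdge p q) (fun _ q => by cases q <;> rfl)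
    (const false) ?_ ?_
  · have h : Primrec fun x : ℕ × L × Bool × Bool => (x.1, x.2.1) := fst.pair (fst.comp snd)
    exact primrec_and (primrec_and (snd.comp (snd.comp snd)) (hS.accept.comp h))
      (primrec_not (hS.initial.comp h))
  · refine primrec_or (primrec_and (primrec_not (snd.comp (snd.comp (snd.comp fst)))) ?_)
      (primrec_and (primrec_and (snd.comp (snd.comp (snd.comp fst)))
        (primrec_not (snd.comp (snd.comp snd)))) (primrec_beq (fst.comp (snd.comp snd))
          (primrec_not (fst.comp (snd.comp (snd.comp fst))))))
    exact primrec_decide_eq snd ((fst.comp (snd.comp fst)).pair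
      ((fst.comp (snd.comp (snd.comp fst))).pair (const true)))

theorem primrec_locEdge {r : ℕ} (hS : TileSystem.IsPrimrec S) :
    Primrec fun x : ℕ × Fin (r + 3) × Loc L × Loc L =>
      (S x.1).locEdge x.2.1 x.2.2.1 x.2.2.2 := by
  have e : Primrec fun x : ((ℕ × Fin (r + 3)) × Loc L) × Loc L =>
      (S x.1.1.1).locEdge x.1.1.2 x.1.2 x.2 := by
    refine primrec_sum_cases (f := fun (x : (ℕ × Fin (r + 3)) × Loc L) z =>
      (S x.1.1).locEdge x.1.2 x.2 z) ?_ ?_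
    · refine Primrec.comp (f := fun x : ((ℕ × Fin (r + 3)) × Fin 8) × Loc L =>
        (S x.1.1.1).locEdge x.1.1.2 x.2 (Sum.inl x.1.2)) ?_
        (((fst.comp fst).pair snd).pair (snd.comp fst))
      refine primrec_sum_cases (f := fun (x : (ℕ × Fin (r + 3)) × Fin 8) y =>
        (S x.1.1).locEdge x.1.2 y (Sum.inl x.2)) ?_ (const false)
      exact (dom_finite fun x : Fin (r + 3) × Fin 8 × Fin 8 =>
        (decide (x.1.val = 0) && envEdge x.2.1 x.2.2) ||
          (decide (3 ≤ x.1.val) && decide (x.2.1 = 0) && decide (x.2.2 = 1))).comp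
        ((snd.comp (fst.comp fst)).pair (snd.pair (snd.comp fst)))
    · refine Primrec.comp (f := fun x : ((ℕ × Fin (r + 3)) × Pos L) × Loc L =>
        (S x.1.1.1).locEdge x.1.1.2 x.2 (Sum.inr x.1.2)) ?_
        (((fst.comp fst).pair snd).pair (snd.comp fst))
      refine primrec_sum_cases (f := fun (x : (ℕ × Fin (r + 3)) × Pos L) y =>
        (S x.1.1).locEdge x.1.2 y (Sum.inr x.2)) (const false) ?_
      exact primrec_and ((dom_finite fun i : Fin (r + 3) => decide (i.val = 1 ∨ i.val = 2)).comp
          (snd.comp (fst.comp fst)))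
        ((primrec_posEdge hS).comp ((fst.comp (fst.comp fst)).pair (snd.pair (snd.comp fst))))
  exact e.comp (((fst.pair (fst.comp snd)).pair (fst.comp (snd.comp snd))).pair
    (snd.comp (snd.comp snd)))

theorem primrec_tileEdges {r : ℕ} {letters : ℕ → List L} (h : Primrec letters)
    (hS : TileSystem.IsPrimrec S) : Primrec fun k => tileEdges r (letters k) (S k) := by
  refine primrec_list_filter (primrec_list_product (primrec_tilePlaces h) (primrec_tilePlaces h))
    (primrec_and (primrec_decide_eq (fst.comp (fst.comp snd)) (fst.comp (snd.comp snd))) ?_)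
  exact (primrec_locEdge hS).comp (fst.pair ((fst.comp (fst.comp snd)).pair
    ((snd.comp (fst.comp snd)).pair (snd.comp (snd.comp snd)))))

theorem primrec_tileGoods {r : ℕ} {letters : ℕ → List L} (h : Primrec letters)
    (hS : TileSystem.IsPrimrec S) : Primrec fun k => tileGoods r (letters k) (S k) := by
  have hst : Primrec fun x : ℕ × Fin 8 × Pos L × Pos L =>
      tileState r (Sum.inl x.2.1) (Sum.inr x.2.2.1) (Sum.inr x.2.2.2) :=
    primrec_tileState.comp ((sumInl.comp (fst.comp snd)).pair
      ((sumInr.comp (fst.comp (snd.comp snd))).pair (sumInr.comp (snd.comp (snd.comp snd)))))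
  exact list_map (primrec_list_filter (primrec_list_product (const _)
    (primrec_list_product (primrec_positions h) (primrec_positions h))) (primrec_goodPos hS).to₂)
    hst.to₂

theorem primrec_tileCode {r : ℕ} {letters : ℕ → List L} (h : Primrec letters)
    (hS : TileSystem.IsPrimrec S) : Primrec fun k => tileCode r (letters k) (S k) := by
  have hs := sumInr (α := Fin 8).comp (primrec_startPos hS)
  exact primrec_codeOf (primrec_tilePlaces h) primrec_isSystem (primrec_tileEdges h hS)
    (primrec_tileState.comp ((const _).pair (hs.pair hs))) (primrec_tileGoods h hS)

end TilePrimrec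

end PetriGames

/-! ### Configurations of a Turing machine as rows of cells -/

namespace PetriGames

open Turing

section Rows

variable {Γ Λ : Type} [Inhabited Γ]

/-- The content of a tape cell, together with the state if the head is on the cell; `none` is the
left border of the tape. -/
abbrev Cell (Γ Λ : Type) : Type := Option (Γ × Option Λ)

/-- The tape after executing a statement. -/
def tapeAfter (T : Tape Γ) : TM0.Stmt Γ → Tape Γ
  | TM0.Stmt.move d => T.move d
  | TM0.Stmt.write a => T.write a

/-- The cell at position `p` if the head is at position `h`. -/
def cellAt (c : TM0.Cfg Γ Λ) (h p : ℤ) : Γ × Option Λ :=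
  (c.Tape.nth (p - h), if p = h then some c.q else none)

/-- The row of cells of a configuration on a tape with borders at the positions `0` and `d`. -/
def rowCell (d : ℤ) (c : TM0.Cfg Γ Λ) (h p : ℤ) : Cell Γ Λ :=
  if p = 0 ∨ p = d then none else some (cellAt c h p)

variable {d h p : ℤ} {c : TM0.Cfg Γ Λ}

theorem rowCell_of_mem (h1 : 1 ≤ p) (h2 : p < d) : rowCell d c h p = some (cellAt c h p) :=
  if_neg (by omega)

theorem rowCell_zero : rowCell d c h 0 = none := if_pos (Or.inl rfl)

theorem rowCell_self : rowCell d c h d = none := if_pos (Or.inr rfl)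

theorem rowCell_head (h1 : 1 ≤ h) (h2 : h < d) :
    rowCell d c h h = some (c.Tape.head, some c.q) := by
  rw [rowCell_of_mem h1 h2, cellAt, if_pos rfl, sub_self, Tape.nth_zero]

end Rows

section Cells

variable {Γ Λ : Type} [Inhabited Λ] (M : TM0.Machine Γ Λ)

/-- The state in which the head leaves the cell in the direction `D`. -/
def leaves (D : Dir) : Cell Γ Λ → Option Λ
  | some (s, some q) =>
    match M q s with
    | some (q', TM0.Stmt.move D') => if D' = D then some q' else none
    | _ => none
  | _ => none

/-- The next content of a cell between two others, if the machine does not halt and the head does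
not leave the tape. -/
def nextCell : Cell Γ Λ → Cell Γ Λ → Cell Γ Λ → Option (Cell Γ Λ)
  | _, none, _ => some none
  | a, some (s, none), c => some (some (s, leaves M Dir.right a <|> leaves M Dir.left c))
  | a, some (s, some q), c =>
    match M q s with
    | none => none
    | some (q', TM0.Stmt.write s') => some (some (s', some q'))
    | some (_, TM0.Stmt.move Dir.left) => if a.isSome then some (some (s, none)) else none
    | some (_, TM0.Stmt.move Dir.right) => if c.isSome then some (some (s, none)) else none

variable [Inhabited Γ]

/-- The change of the position of the head in the next step. -/
def headMove (c : TM0.Cfg Γ Λ) : ℤ :=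
  match M c.q c.Tape.head with
  | some (_, TM0.Stmt.move Dir.left) => -1
  | some (_, TM0.Stmt.move Dir.right) => 1
  | _ => 0

variable {M} {d h p : ℤ} {c c' : TM0.Cfg Γ Λ}

theorem leaves_rowCell_of_ne (D : Dir) (hp : p ≠ h) : leaves M D (rowCell d c h p) = none := by
  unfold rowCell
  split_ifs
  · rfl
  · simp only [cellAt, if_neg hp]
    rfl

theorem step_eq_some (hs : TM0.step M c = some c') :
    ∃ q a, M c.q c.Tape.head = some (q, a) ∧ c' = ⟨q, tapeAfter c.Tape a⟩ := by
  obtain ⟨q, T⟩ := c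
  rw [TM0.step, Option.map_eq_some_iff] at hs
  obtain ⟨⟨q', a⟩, h1, rfl⟩ := hs
  exact ⟨q', a, h1, by cases a <;> rfl⟩

/-- The next content of a cell is given by `nextCell`, as long as the head stays between the
borders. -/
theorem nextCell_rowCell (hh1 : 1 ≤ h) (hh2 : h < d) (hp1 : 1 ≤ p) (hp2 : p < d)
    (hs : TM0.step M c = some c') :
    (∀ b, nextCell M (rowCell d c h (p - 1)) (rowCell d c h p) (rowCell d c h (p + 1)) = some b →
      b = some (cellAt c' (h + headMove M c) p) ∧
        (p = h → 1 ≤ h + headMove M c ∧ h + headMove M c < d)) ∧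
    (1 ≤ h + headMove M c → h + headMove M c < d →
      nextCell M (rowCell d c h (p - 1)) (rowCell d c h p) (rowCell d c h (p + 1)) =
        some (some (cellAt c' (h + headMove M c) p))) := by
  obtain ⟨q, a, hM, rfl⟩ := step_eq_some hs
  -- Only the cell under the head can send a state to a neighbour, and it does so only if the step
  -- is a move in direction `D`.
  have hleave : ∀ D p', leaves M D (rowCell d c h p') = if p' = h then
      (match a with
        | TM0.Stmt.move D' => if D' = D then some q else none
        | _ => none) else none := by
    intro D p'
    split_ifs with hp'
    · subst hp'
      rw [rowCell_head hh1 hh2]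
      simp only [leaves, hM]
      cases a <;> rfl
    · exact leaves_rowCell_of_ne D hp'
  by_cases hph : p = h
  · subst hph
    rw [rowCell_head hp1 hp2]
    rcases a with (_ | _) | s
    · have hmv : headMove M c = -1 := by simp [headMove, hM]
      -- The left neighbour is the border: `nextCell` is undefined and the head would leave the
      -- tape, so both claims are vacuous.
      by_cases hp0 : p = 1
      · subst hp0
        simp [nextCell, hM, rowCell_zero, hmv]
      · have e : rowCell d c p (p - 1) = some (cellAt c p (p - 1)) :=
          rowCell_of_mem (by omega) (by omega)
        have e2 : cellAt ⟨q, tapeAfter c.Tape (.move Dir.left)⟩ (p + -1) p = (c.Tape.head, none) := by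
          rw [cellAt, if_neg (by omega)]
          simp only [tapeAfter, Tape.move_left_nth]
          rw [show p - (p + -1) - 1 = 0 by ring, Tape.nth_zero]
        simp only [nextCell, hM, e, hmv, e2]
        simp
        omega
    · have hmv : headMove M c = 1 := by simp [headMove, hM]
      by_cases hp0 : p = d - 1
      · have e : rowCell d c p (p + 1) = none := if_pos (by omega)
        simp [nextCell, hM, e, hmv]
        omega
      · have e : rowCell d c p (p + 1) = some (cellAt c p (p + 1)) :=
          rowCell_of_mem (by omega) (by omega)
        have e2 : cellAt ⟨q, tapeAfter c.Tape (.move Dir.right)⟩ (p + 1) p = (c.Tape.head, none) := by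
          rw [cellAt, if_neg (by omega)]
          simp only [tapeAfter, Tape.move_right_nth]
          rw [show p - (p + 1) + 1 = 0 by ring, Tape.nth_zero]
        simp only [nextCell, hM, e, hmv, e2]
        simp
        omega
    · have hmv : headMove M c = 0 := by simp [headMove, hM]
      have e2 : cellAt ⟨q, tapeAfter c.Tape (.write s)⟩ (p + 0) p = (s, some q) := by
        simp [cellAt, tapeAfter, Tape.write]
      simp only [nextCell, hM, hmv, e2]
      simp
      omega
  · have hmid : rowCell d c h p = some (c.Tape.nth (p - h), none) := by
      rw [rowCell_of_mem hp1 hp2, cellAt, if_neg hph]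
    -- Away from the head the symbol stays. A state appears exactly if the head arrives from the
    -- left, moving right, or from the right, moving left.
    have key : (cellAt (⟨q, tapeAfter c.Tape a⟩ : TM0.Cfg Γ Λ) (h + headMove M c) p) =
        (c.Tape.nth (p - h), leaves M Dir.right (rowCell d c h (p - 1)) <|>
          leaves M Dir.left (rowCell d c h (p + 1))) := by
      rw [hleave, hleave]
      rcases a with (_ | _) | s
      · have hmv : headMove M c = -1 := by simp [headMove, hM]
        rw [cellAt, hmv]
        refine Prod.ext ?_ ?_
        · simp only [tapeAfter, Tape.move_left_nth]
          congr 1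
          ring
        · by_cases e : p + 1 = h
          · have e1 : p = h + -1 := by omega
            have e2 : p - 1 ≠ h := by omega
            simp [e1]
          · have e1 : p ≠ h + -1 := by omega
            simp [e, e1]
      · have hmv : headMove M c = 1 := by simp [headMove, hM]
        rw [cellAt, hmv]
        refine Prod.ext ?_ ?_
        · simp only [tapeAfter, Tape.move_right_nth]
          congr 1
          ring
        · by_cases e : p - 1 = h
          · have e1 : p = h + 1 := by omega
            simp [e1]
          · have e1 : p ≠ h + 1 := by omega
            simp [e, e1]
      · have hmv : headMove M c = 0 := by simp [headMove, hM]
        rw [cellAt, hmv]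
        refine Prod.ext ?_ ?_
        · simp only [tapeAfter, Tape.write_nth]
          rw [if_neg (by omega), add_zero]
        · simp [hph]
    rw [key, hmid]
    refine ⟨fun b hb => ⟨?_, fun h => absurd h hph⟩, fun _ _ => rfl⟩
    simpa [nextCell] using hb.symm

end Cells

end PetriGames

/-! ### The tile system of a Turing machine -/

namespace PetriGames

open Turing

/-- The tiles for a Turing machine: windows of three cells and, for the first turn of the helix, the
start tile `0`, the tile `1` for the blanks to the left of the input, the tiles `2` and `3` for the
first two symbols of the input, the natural numbers for the following ones, and the tile `4` for the
blanks to the right of the input. -/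
abbrev MachineTile (Γ Λ : Type) : Type := ((Cell Γ Λ × Cell Γ Λ × Cell Γ Λ) ⊕ Fin 5) ⊕ ℕ

/-- The tiles that can be used for an input with `k + 3` symbols. -/
noncomputable def machineLetters (Γ Λ : Type) [Fintype Γ] [Fintype Λ] (k : ℕ) : List (MachineTile Γ Λ) :=
  (Finset.univ : Finset ((Cell Γ Λ × Cell Γ Λ × Cell Γ Λ) ⊕ Fin 5)).toList.map Sum.inl ++
    (List.range (k + 1)).map Sum.inr

theorem mem_machineLetters {Γ Λ : Type} [Fintype Γ] [Fintype Λ] {k : ℕ} {t : MachineTile Γ Λ} :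
    t ∈ machineLetters Γ Λ k ↔ ∀ i, t = Sum.inr i → i ≤ k := by
  rcases t with t | i <;> simp [machineLetters]

theorem nodup_machineLetters {Γ Λ : Type} [Fintype Γ] [Fintype Λ] (k : ℕ) : (machineLetters Γ Λ k).Nodup := by
  rw [machineLetters, List.nodup_append']
  refine ⟨(Finset.nodup_toList _).map Sum.inl_injective, List.nodup_range.map Sum.inr_injective, ?_⟩
  intro x hx hy
  obtain ⟨a, -, rfl⟩ := List.mem_map.1 hx
  simp at hy

/-- The tile at position `j` of the first turn if the input starts at position `e`. -/
def firstTile (k e j : ℕ) : Fin 5 ⊕ ℕ :=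
  if j = 0 then Sum.inl 0 else if j < e then Sum.inl 1 else if j = e then Sum.inl 2
  else if j = e + 1 then Sum.inl 3 else if j ≤ e + 2 + k then Sum.inr (j - (e + 2))
  else Sum.inl 4

/-- The tile of the first turn as a tile. -/
def toTile {Γ Λ : Type} : Fin 5 ⊕ ℕ → MachineTile Γ Λ
  | Sum.inl i => Sum.inl (Sum.inr i)
  | Sum.inr i => Sum.inr i

theorem nth_mk₁ {Γ : Type} [Inhabited Γ] (l : List Γ) (i : ℤ) :
    (Tape.mk₁ l).nth i = if i < 0 then default else l.getI i.toNat := by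
  rcases i with n | n
  · rw [if_neg (by simp)]
    change (Tape.mk' (ListBlank.mk []) (ListBlank.mk l)).nth (n : ℤ) = _
    rw [Tape.mk'_nth_nat, ListBlank.nth_mk]
    rfl
  · rw [if_pos (Int.negSucc_lt_zero n)]
    change (ListBlank.mk ([] : List Γ)).nth n = _
    rw [ListBlank.nth_mk]
    rfl

/-- The initial configuration of the machine. -/
def inputCfg {Γ Λ : Type} [Inhabited Γ] [Inhabited Λ] (g₀ g₁ g₂ : Γ) (k : ℕ) : TM0.Cfg Γ Λ := TM0.init (g₀ :: g₁ :: List.replicate (k + 1) g₂)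

section InitialCell

variable {Γ Λ : Type} [Inhabited Γ] [Inhabited Λ] (g₀ g₁ g₂ : Γ) (k : ℕ)

/-- The cell that a tile of the first turn stands for. -/
def initialCell : Fin 5 ⊕ ℕ → Cell Γ Λ
  | Sum.inl i => ![none, some (default, none), some (g₀, some default), some (g₁, none),
      some (default, none)] i
  | Sum.inr _ => some (g₂, none)

theorem initialCell_firstTile {e j : ℕ} (he : 1 ≤ e) (hj : 1 ≤ j) :
    initialCell g₀ g₁ g₂ (firstTile k e j) =
      some (cellAt (inputCfg (Λ := Λ) g₀ g₁ g₂ k) e j) := by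
  have hq : (inputCfg (Λ := Λ) g₀ g₁ g₂ k).q = default := rfl
  have hT : (inputCfg (Λ := Λ) g₀ g₁ g₂ k).Tape =
    Tape.mk₁ (g₀ :: g₁ :: List.replicate (k + 1) g₂) := rfl
  rw [cellAt, hq, hT, nth_mk₁]
  rcases lt_trichotomy j e with h | rfl | h
  · have hf : firstTile k e j = Sum.inl 1 := by rw [firstTile, if_neg (by omega), if_pos h]
    rw [hf, if_pos (show (j : ℤ) - e < 0 by omega), if_neg (show (j : ℤ) ≠ e by omega)]
    rfl
  · have hf : firstTile k j j = Sum.inl 2 := by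
      rw [firstTile, if_neg (by omega), if_neg (by omega), if_pos rfl]
    simp [hf, initialCell]
  · obtain ⟨n, rfl⟩ : ∃ n, j = e + 1 + n := ⟨j - (e + 1), by omega⟩
    have e1 : (((e + 1 + n : ℕ) : ℤ) - (e : ℤ)).toNat = n + 1 := by omega
    rw [e1, if_neg (show ¬ ((e + 1 + n : ℕ) : ℤ) - e < 0 by omega),
      if_neg (show ((e + 1 + n : ℕ) : ℤ) ≠ e by omega)]
    rcases n with _ | n
    · have hf : firstTile k e (e + 1 + 0) = Sum.inl 3 := by
        rw [firstTile, if_neg (by omega), if_neg (by omega), if_neg (by omega), if_pos rfl]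
      rw [hf]
      rfl
    · have e2 : (g₀ :: g₁ :: List.replicate (k + 1) g₂).getI (n + 1 + 1) =
          if n ≤ k then g₂ else default := by
        simp only [List.getI_cons_succ]
        split_ifs with hn
        · rw [List.getI_eq_getElem _ (by simp; omega)]
          simp
        · rw [List.getI_eq_default]
          simp; omega
      have hf : firstTile k e (e + 1 + (n + 1)) = if n ≤ k then Sum.inr n else Sum.inl 4 := by
        rw [firstTile, if_neg (by omega), if_neg (by omega), if_neg (by omega), if_neg (by omega),
          show e + 1 + (n + 1) - (e + 2) = n by omega]
        by_cases hn : n ≤ k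
        · rw [if_pos hn, if_pos (by omega)]
        · rw [if_neg hn, if_neg (by omega)]
      rw [hf, e2]
      by_cases hn : n ≤ k
      · rw [if_pos hn, if_pos hn]; rfl
      · rw [if_neg hn, if_neg hn]; rfl

end InitialCell

section MachineTiles

variable {Γ Λ : Type} [Inhabited Γ] [Inhabited Λ] [DecidableEq Γ] [DecidableEq Λ]
  (M : TM0.Machine Γ Λ) (g₀ g₁ g₂ : Γ) (k : ℕ)

/-- The order of the tiles along the helix for an input with `k + 3` symbols. -/
def machineHor : MachineTile Γ Λ → MachineTile Γ Λ → Bool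
  | Sum.inl (Sum.inl v), Sum.inl (Sum.inl w) =>
    -- Overlapping windows must agree, except to the left of a border: there the helix passes to the
    -- next turn, and the two windows belong to different configurations.
    decide (v.2.2 = w.2.1) && (decide (w.2.1 = none) || decide (w.1 = v.2.1))
  | Sum.inl (Sum.inr i), Sum.inl (Sum.inr j) =>
    decide ((i, j) ∈ ([(0, 1), (1, 1), (1, 2), (2, 3), (4, 4)] : List (Fin 5 × Fin 5)))
  -- The first turn can only close after a blank to the right of the input, hence not before the
  -- whole input is laid; the next turn starts with the border.
  | Sum.inl (Sum.inr i), Sum.inl (Sum.inl w) => decide (i = 4) && decide (w.2.1 = none)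
  | Sum.inl (Sum.inl _), Sum.inl (Sum.inr _) => false
  | Sum.inl x, Sum.inr j => decide (x = Sum.inr 3) && decide (j = 0)
  | Sum.inr i, Sum.inl y => decide (i = k) && decide (y = Sum.inr 4)
  -- Numbering the copies of `g₂` enforces their number, since only the copy `k` may be followed by
  -- a blank. Thus the input enters the tiles while the machine stays fixed.
  | Sum.inr i, Sum.inr j => decide (j = i + 1)

/-- The vertical relation between the tiles. -/
def machineVer : MachineTile Γ Λ → MachineTile Γ Λ → Bool
  | Sum.inl (Sum.inl v), Sum.inl (Sum.inl w) => decide (nextCell M v.1 v.2.1 v.2.2 = some w.2.1)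
  | Sum.inl (Sum.inr i), Sum.inl (Sum.inl w) => decide (initialCell g₀ g₁ g₂ (Sum.inl i) = w.2.1)
  | Sum.inr i, Sum.inl (Sum.inl w) => decide (initialCell g₀ g₁ g₂ (Sum.inr i) = w.2.1)
  | _, _ => false

/-- The machine halts in this cell. -/
def haltsAt : Cell Γ Λ → Bool
  | some (s, some q) => (M q s).isNone
  | _ => false

/-- The tile system for a Turing machine whose input starts with `g₀` and `g₁`, followed by `k + 1`
times `g₂`. -/
def machineTiles : TileSystem (MachineTile Γ Λ) where
  start := Sum.inl (Sum.inr 0)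
  initial
    | Sum.inl (Sum.inl _) => false
    | _ => true
  hor := machineHor k
  ver := machineVer M g₀ g₁ g₂
  accept
    | Sum.inl (Sum.inl w) => haltsAt M w.2.1
    | _ => false

end MachineTiles

section Run

/-- The states reached by repeated steps, which stay as they are when no step is possible. -/
def runFrom {σ : Type} (f : σ → Option σ) (a : σ) (r : ℕ) : σ := (fun x => (f x).getD x)^[r] a

theorem runFrom_succ {σ : Type} (f : σ → Option σ) (a : σ) (r : ℕ) :
    runFrom f a (r + 1) = (f (runFrom f a r)).getD (runFrom f a r) :=
  Function.iterate_succ_apply' ..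

theorem step_runFrom {σ : Type} {f : σ → Option σ} {a : σ} {r : ℕ} (h : f (runFrom f a r) ≠ none) :
    f (runFrom f a r) = some (runFrom f a (r + 1)) := by
  rw [runFrom_succ]
  obtain ⟨b, hb⟩ := Option.ne_none_iff_exists'.1 h
  rw [hb]; rfl

/-- Halting becomes a statement about one total sequence, which rests at its final state; the rows
of a tiling are compared with this sequence. -/
theorem eval_dom_iff {σ : Type} (f : σ → Option σ) (a : σ) :
    (StateTransition.eval f a).Dom ↔ ∃ r, f (runFrom f a r) = none := by
  rw [Part.dom_iff_mem]
  simp only [StateTransition.mem_eval]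
  constructor
  · rintro ⟨b, h, hb⟩
    suffices ∃ r, runFrom f a r = b from this.imp fun r hr => by rw [hr, hb]
    clear hb
    induction h with
    | refl => exact ⟨0, rfl⟩
    | tail _ hs ih =>
      obtain ⟨r, rfl⟩ := ih
      refine ⟨r + 1, ?_⟩
      rw [runFrom_succ, Option.mem_def.1 hs]
      rfl
  · rintro ⟨r, hr⟩
    refine ⟨_, ?_, hr⟩
    clear hr
    induction r with
    | zero => exact Relation.ReflTransGen.refl
    | succ r ih =>
      by_cases h : f (runFrom f a r) = none
      · rw [runFrom_succ, h]; exact ih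
      · exact ih.tail (step_runFrom h)

end Run

end PetriGames

/-! ### The shape of the first turn -/

namespace PetriGames

open Turing

section FirstTurn

variable {Γ Λ : Type} [DecidableEq Γ] [DecidableEq Λ] {k : ℕ}

/-- The tiles of the first turn that can follow `t`. -/
theorem machineHor_toTile {s t : Fin 5 ⊕ ℕ} :
    machineHor k (toTile s : MachineTile Γ Λ) (toTile t) = true ↔
      (s = Sum.inl 0 ∧ t = Sum.inl 1) ∨ (s = Sum.inl 1 ∧ (t = Sum.inl 1 ∨ t = Sum.inl 2)) ∨
      (s = Sum.inl 2 ∧ t = Sum.inl 3) ∨ (s = Sum.inl 3 ∧ t = Sum.inr 0) ∨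
      (∃ i, s = Sum.inr i ∧ t = Sum.inr (i + 1)) ∨ (s = Sum.inr k ∧ t = Sum.inl 4) ∨
      (s = Sum.inl 4 ∧ t = Sum.inl 4) := by
  rcases s with i | i <;> rcases t with j | j
  · simp only [toTile, machineHor, Sum.inl.injEq, reduceCtorEq, and_false, exists_const, false_or,
      false_and]
    fin_cases i <;> fin_cases j <;> decide
  · simp [toTile, machineHor]
  · simp [toTile, machineHor]
  · simp [toTile, machineHor]

theorem firstTile_of_lt {e j : ℕ} (h0 : 1 ≤ j) (h : j < e) : firstTile k e j = Sum.inl 1 := by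
  rw [firstTile, if_neg (by omega), if_pos h]

theorem firstTile_self {e : ℕ} (he : 1 ≤ e) : firstTile k e e = Sum.inl 2 := by
  rw [firstTile, if_neg (by omega), if_neg (by omega), if_pos rfl]

theorem firstTile_add_one {e : ℕ} : firstTile k e (e + 1) = Sum.inl 3 := by
  rw [firstTile, if_neg (by omega), if_neg (by omega), if_neg (by omega), if_pos rfl]

theorem firstTile_add_two {e i : ℕ} (hi : i ≤ k) : firstTile k e (e + 2 + i) = Sum.inr i := by
  rw [firstTile, if_neg (by omega), if_neg (by omega), if_neg (by omega), if_neg (by omega),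
    if_pos (by omega)]
  congr 1
  omega

theorem firstTile_of_gt {e j : ℕ} (h : e + 2 + k < j) : firstTile k e j = Sum.inl 4 := by
  rw [firstTile, if_neg (by omega), if_neg (by omega), if_neg (by omega), if_neg (by omega),
    if_neg (by omega)]

/-- The positions of the first turn. -/
theorem firstTile_cases {e : ℕ} (he : 1 ≤ e) (j : ℕ) :
    j = 0 ∨ (1 ≤ j ∧ j < e) ∨ j = e ∨ j = e + 1 ∨ (∃ i ≤ k, j = e + 2 + i) ∨ e + 2 + k < j := by
  by_cases h : e + 2 ≤ j ∧ j ≤ e + 2 + k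
  · exact Or.inr (Or.inr (Or.inr (Or.inr (Or.inl ⟨j - (e + 2), by omega, by omega⟩))))
  · omega

/-- The start tile must be followed by a blank, which is why the input may not begin at position 1.
-/
theorem machineHor_firstTile {e : ℕ} (he : 2 ≤ e) (j : ℕ) :
    machineHor k (toTile (firstTile k e j) : MachineTile Γ Λ) (toTile (firstTile k e (j + 1))) =
      true := by
  rw [machineHor_toTile]
  rcases firstTile_cases (k := k) (show 1 ≤ e by omega) j with rfl | ⟨h1, h2⟩ | rfl | rfl |
    ⟨i, hi, rfl⟩ | h
  · left
    exact ⟨rfl, firstTile_of_lt (by omega) (by omega)⟩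
  · right; left
    refine ⟨firstTile_of_lt h1 h2, ?_⟩
    by_cases h : j + 1 = e
    · exact Or.inr (h ▸ firstTile_self (by omega))
    · exact Or.inl (firstTile_of_lt (by omega) (by omega))
  · exact Or.inr (Or.inr (Or.inl ⟨firstTile_self (by omega), firstTile_add_one⟩))
  · exact Or.inr (Or.inr (Or.inr (Or.inl ⟨firstTile_add_one, firstTile_add_two (i := 0) (by omega)⟩)))
  · right; right; right; right
    by_cases h : i = k
    · subst h
      exact Or.inr (Or.inl ⟨firstTile_add_two le_rfl, firstTile_of_gt (by omega)⟩)
    · exact Or.inl ⟨i, firstTile_add_two hi, firstTile_add_two (i := i + 1) (by omega)⟩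
  · exact Or.inr (Or.inr (Or.inr (Or.inr (Or.inr (Or.inr
      ⟨firstTile_of_gt h, firstTile_of_gt (by omega)⟩)))))

theorem firstTile_zero {e : ℕ} : firstTile k e 0 = Sum.inl 0 := if_pos rfl

/-- The tile at the next position is determined, except where the input starts. -/
theorem firstTile_succ {e j : ℕ} (he : 1 ≤ e) (hej : e ≤ j) {t : Fin 5 ⊕ ℕ}
    (ht : ∀ i, t = Sum.inr i → i ≤ k)
    (h : machineHor k (toTile (firstTile k e j) : MachineTile Γ Λ) (toTile t) = true) :
    t = firstTile k e (j + 1) := by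
  rw [machineHor_toTile] at h
  rcases firstTile_cases (k := k) he j with rfl | ⟨h1, h2⟩ | rfl | rfl | ⟨i, hi, rfl⟩ | h1
  · omega
  · omega
  · rw [firstTile_self he] at h
    rw [firstTile_add_one]
    simpa using h
  · rw [firstTile_add_one] at h
    rw [show e + 1 + 1 = e + 2 + 0 from rfl, firstTile_add_two (by omega)]
    simpa using h
  · rw [firstTile_add_two hi] at h
    simp at h
    rcases h with rfl | ⟨rfl, rfl⟩
    · rw [add_assoc, firstTile_add_two (ht _ rfl)]
    · rw [firstTile_of_gt (by omega)]
  · rw [firstTile_of_gt h1] at h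
    rw [firstTile_of_gt (by omega)]
    simpa using h

/-- A first turn consists of blanks, the input and blanks. -/
theorem exists_firstTile {y : ℕ → Fin 5 ⊕ ℕ} {n : ℕ} (h0 : y 0 = Sum.inl 0)
    (hy : ∀ j ≤ n, ∀ i, y j = Sum.inr i → i ≤ k)
    (hor : ∀ j < n, machineHor k (toTile (y j) : MachineTile Γ Λ) (toTile (y (j + 1))) = true) :
    ∃ e, 1 ≤ e ∧ e ≤ n + 1 ∧ ∀ j ≤ n, y j = firstTile k e j := by
  induction n with
  | zero =>
    refine ⟨1, le_rfl, le_rfl, fun j hj => ?_⟩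
    obtain rfl : j = 0 := by omega
    rw [h0, firstTile_zero]
  | succ n ih =>
    obtain ⟨e, he1, he2, he⟩ := ih (fun j hj => hy j (by omega)) fun j hj => hor j (by omega)
    have hn := hor n (by omega)
    rw [he n le_rfl] at hn
    -- Otherwise `e = n + 1`: the input has not begun among the tiles so far, and its beginning may
    -- still be moved to the right.
    by_cases hen : e ≤ n
    · have := firstTile_succ he1 hen (hy (n + 1) le_rfl) hn
      refine ⟨e, he1, by omega, fun j hj => ?_⟩
      rcases Nat.lt_or_ge n j with h | h
      · obtain rfl : j = n + 1 := by omega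
        exact this
      · exact he j h
    · obtain rfl : e = n + 1 := by omega
      have hext : ∀ e', n < e' → ∀ j ≤ n, y j = firstTile k e' j := by
        intro e' he' j hj
        rw [he j hj]
        rcases Nat.eq_zero_or_pos j with rfl | hj0
        · rw [firstTile_zero, firstTile_zero]
        · rw [firstTile_of_lt hj0 (by omega), firstTile_of_lt hj0 (by omega)]
      have hcase : y (n + 1) = Sum.inl 1 ∨ y (n + 1) = Sum.inl 2 := by
        rw [machineHor_toTile] at hn
        rcases Nat.eq_zero_or_pos n with rfl | hn0
        · rw [firstTile_zero] at hn
          exact Or.inl (by simpa using hn)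
        · rw [firstTile_of_lt hn0 (by omega)] at hn
          simpa using hn
      rcases hcase with h | h
      · refine ⟨n + 2, by omega, by omega, fun j hj => ?_⟩
        rcases Nat.lt_or_ge n j with h' | h'
        · obtain rfl : j = n + 1 := by omega
          rw [h, firstTile_of_lt (by omega) (by omega)]
        · exact hext _ (by omega) j h'
      · refine ⟨n + 1, by omega, by omega, fun j hj => ?_⟩
        rcases Nat.lt_or_ge n j with h' | h'
        · obtain rfl : j = n + 1 := by omega
          rw [h, firstTile_self (by omega)]
        · exact hext _ (by omega) j h'

end FirstTurn

end PetriGames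

/-! ### A tiling shows that the machine halts -/

namespace PetriGames

open Turing

section HeadPos

variable {Γ Λ : Type} [Inhabited Γ] [Inhabited Λ]

/-- The position of the head after `r` steps, starting from `e`. -/
def headPos (M : TM0.Machine Γ Λ) (c : ℕ → TM0.Cfg Γ Λ) (e : ℤ) (r : ℕ) : ℤ :=
  e + ∑ i ∈ Finset.range r, headMove M (c i)

theorem headPos_succ (M : TM0.Machine Γ Λ) (c : ℕ → TM0.Cfg Γ Λ) (e : ℤ) (r : ℕ) :
    headPos M c e (r + 1) = headPos M c e r + headMove M (c r) := by
  rw [headPos, headPos, Finset.sum_range_succ, add_assoc]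

theorem abs_headMove_le (M : TM0.Machine Γ Λ) (c : TM0.Cfg Γ Λ) :
    -1 ≤ headMove M c ∧ headMove M c ≤ 1 := by
  unfold headMove
  split <;> simp

theorem headPos_bounds (M : TM0.Machine Γ Λ) (c : ℕ → TM0.Cfg Γ Λ) (e : ℤ) (r : ℕ) :
    e - r ≤ headPos M c e r ∧ headPos M c e r ≤ e + r := by
  induction r with
  | zero => simp [headPos]
  | succ r ih =>
    have := abs_headMove_le M (c r)
    rw [headPos_succ]
    push_cast
    omega

theorem haltsAt_rowCell {M : TM0.Machine Γ Λ} {c : TM0.Cfg Γ Λ} {d h p : ℤ}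
    (hacc : haltsAt M (rowCell d c h p) = true) : TM0.step M c = none := by
  unfold rowCell at hacc
  split_ifs at hacc with h1
  · simp [haltsAt] at hacc
  · rw [cellAt] at hacc
    split_ifs at hacc with h2
    · subst h2
      rw [sub_self, Tape.nth_zero] at hacc
      obtain ⟨q, T⟩ := c
      simp only [haltsAt, Option.isNone_iff_eq_none] at hacc
      simp [TM0.step, hacc]
    · simp [haltsAt] at hacc

end HeadPos

section MachineTiles

variable {Γ Λ : Type} [Inhabited Γ] [Inhabited Λ] [DecidableEq Γ] [DecidableEq Λ]
  [Fintype Γ] [Fintype Λ] {M : TM0.Machine Γ Λ} {g₀ g₁ g₂ : Γ} {k : ℕ}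

/-- If the machine ran forever, induction would show that turn after turn is filled by its
successive configurations: the vertical relation computes each cell from a window that the
horizontal relation makes correct. The accepting last tile would then be a halting cell of one of
them. -/
theorem eval_dom_of_solvable
    (hS : (machineTiles M g₀ g₁ g₂ k).Solvable (machineLetters Γ Λ k)) :
    (StateTransition.eval (TM0.step M) (inputCfg g₀ g₁ g₂ k)).Dom := by
  obtain ⟨m, d, x, hd0, hdm, -, hx0, hlet, hinit, hhor, hver, hacc⟩ := hS
  by_contra hdom
  rw [eval_dom_iff] at hdom
  push Not at hdom
  set c := runFrom (TM0.step M) (inputCfg g₀ g₁ g₂ k) with hc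
  have hstep := fun r => step_runFrom (hdom r)
  -- the first turn
  have hy : ∀ j, ∃ y, j < d → x j = toTile y := by
    intro j
    by_cases hj : j < d
    · have := (hinit j (by omega)).2 hj
      rcases h : x j with (w | i) | i
      · rw [h] at this; simp [machineTiles] at this
      · exact ⟨Sum.inl i, fun _ => rfl⟩
      · exact ⟨Sum.inr i, fun _ => rfl⟩
    · exact ⟨Sum.inl 0, fun h => absurd h hj⟩
  choose y hy using hy
  have hwin : ∀ j, ∃ w : Cell Γ Λ × Cell Γ Λ × Cell Γ Λ, d ≤ j → j ≤ m → x j = Sum.inl (Sum.inl w) := by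
    intro j
    by_cases hj : d ≤ j ∧ j ≤ m
    · have := mt (hinit j hj.2).1 (by omega)
      rcases h : x j with (w | i) | i
      · exact ⟨w, fun _ _ => rfl⟩
      · rw [h] at this; simp [machineTiles] at this
      · rw [h] at this; simp [machineTiles] at this
    · exact ⟨(none, none, none), fun h1 h2 => absurd ⟨h1, h2⟩ hj⟩
  choose w hw using hwin
  have hhor' : ∀ j < m, machineHor k (x j) (x (j + 1)) = true := fun j hj => (hhor j hj).2
  have hver' : ∀ j, j + d ≤ m → machineVer M g₀ g₁ g₂ (x j) (x (j + d)) = true := hver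
  obtain ⟨e, he1, -, he⟩ := exists_firstTile (Γ := Γ) (Λ := Λ) (k := k) (y := y) (n := d - 1)
    (by
      have := hy 0 hd0
      rw [hx0] at this
      rcases h : y 0 with i | i <;> rw [h] at this <;> simp [machineTiles, toTile] at this
      rw [← this])
    (by
      intro j hj i hi
      have h1 := hlet j (by omega)
      rw [hy j (by omega), hi] at h1
      exact (mem_machineLetters.1 h1) i rfl)
    (by
      intro j hj
      rw [← hy j (by omega), ← hy (j + 1) (by omega)]
      exact hhor' j (by omega))
  -- The tile before the first window must be a blank to the right of the input, so the whole input
  -- fits into the first turn.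
  have hed : e + 2 + k < d - 1 := by
    have h1 := hhor' (d - 1) (by omega)
    rw [show d - 1 + 1 = d by omega, hw d le_rfl hdm, hy _ (by omega), he _ le_rfl] at h1
    rcases firstTile_cases (k := k) he1 (d - 1) with h | ⟨h2, h3⟩ | h | h | ⟨i, hi, h⟩ | h
    · rw [h, firstTile_zero] at h1; simp [toTile, machineHor] at h1
    · rw [firstTile_of_lt h2 h3] at h1; simp [toTile, machineHor] at h1
    · rw [h, firstTile_self he1] at h1; simp [toTile, machineHor] at h1
    · rw [h, firstTile_add_one] at h1; simp [toTile, machineHor] at h1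
    · rw [h, firstTile_add_two hi] at h1; simp [toTile, machineHor] at h1
    · exact h
  -- the other turns
  have key : ∀ r : ℕ, (∀ j < d, (r + 1) * d + j ≤ m →
        (w ((r + 1) * d + j)).2.1 = rowCell d (c r) (headPos M c e r) j) ∧
      -- The head is known to stay between the borders only once the row is complete, since then its
      -- cell one step earlier has been checked by `nextCell`.
      ((r + 2) * d ≤ m → 1 ≤ headPos M c e r ∧ headPos M c e r < d) := by
    intro r
    induction r with
    | zero =>
      refine ⟨fun j hj hjm => ?_, fun _ => by simp [headPos]; omega⟩
      have h1 := hver' j (by omega)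
      rw [hy j hj, he j (by omega), hw (j + d) (by omega) (by omega)] at h1
      have h2 : initialCell g₀ g₁ g₂ (firstTile k e j) = (w (j + d)).2.1 := by
        rcases h : firstTile k e j with i | i <;> rw [h] at h1 <;>
          simpa [toTile, machineVer] using h1
      rw [show (0 + 1) * d + j = j + d by ring, ← h2]
      rcases Nat.eq_zero_or_pos j with rfl | hj0
      · rw [firstTile_zero]
        exact rowCell_zero.symm
      · rw [initialCell_firstTile g₀ g₁ g₂ k he1 hj0,
          rowCell_of_mem (by omega) (by omega)]
        simp [headPos, hc, runFrom]
    | succ r ih =>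
      obtain ⟨ih1, ih2⟩ := ih
      have hnext : ∀ j < d, (r + 2) * d + j ≤ m → 1 ≤ j →
          nextCell M (rowCell d (c r) (headPos M c e r) ((j : ℤ) - 1))
            (rowCell d (c r) (headPos M c e r) j) (rowCell d (c r) (headPos M c e r) ((j : ℤ) + 1)) =
            some (w ((r + 2) * d + j)).2.1 := by
        intro j hj hjm hj0
        have hmul : (r + 2) * d = (r + 1) * d + d := by ring
        have h1 := hver' ((r + 1) * d + j) (by omega)
        have hle : d ≤ (r + 1) * d := Nat.le_mul_of_pos_left d (by omega)
        rw [show (r + 1) * d + j + d = (r + 2) * d + j by omega, hw _ (by omega) (by omega),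
          hw ((r + 2) * d + j) (by omega) (by omega)] at h1
        have h2 : nextCell M (w ((r + 1) * d + j)).1 (w ((r + 1) * d + j)).2.1
            (w ((r + 1) * d + j)).2.2 = some (w ((r + 2) * d + j)).2.1 := by
          simpa [machineVer] using h1
        have hmid := ih1 j hj (by omega)
        have hleft : (w ((r + 1) * d + j)).1 =
            rowCell d (c r) (headPos M c e r) ((j : ℤ) - 1) := by
          have h3 := hhor' ((r + 1) * d + (j - 1)) (by omega)
          rw [show (r + 1) * d + (j - 1) + 1 = (r + 1) * d + j by omega,
            hw _ (by omega) (by omega), hw ((r + 1) * d + j) (by omega) (by omega)] at h3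
          simp only [machineHor, Bool.and_eq_true, Bool.or_eq_true, decide_eq_true_eq] at h3
          have h4 := h3.2
          rw [hmid, rowCell_of_mem (by omega) (by omega)] at h4
          have h5 := ih1 (j - 1) (by omega) (by omega)
          rw [Nat.cast_sub hj0, Nat.cast_one] at h5
          rw [← h5]
          simpa using h4
        have hright : (w ((r + 1) * d + j)).2.2 =
            rowCell d (c r) (headPos M c e r) ((j : ℤ) + 1) := by
          have h3 := hhor' ((r + 1) * d + j) (by omega)
          rw [hw _ (by omega) (by omega), hw ((r + 1) * d + j + 1) (by omega) (by omega)] at h3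
          simp only [machineHor, Bool.and_eq_true, Bool.or_eq_true, decide_eq_true_eq] at h3
          rw [h3.1]
          -- To the right of the last cell the helix continues with the first cell of the next turn.
          -- It lies above a border cell and is therefore a border cell, as `rowCell` has at
          -- position `d`.
          by_cases hjd : j + 1 = d
          · have hd : ((j : ℤ) + 1) = d := by omega
            rw [hd, rowCell_self, show (r + 1) * d + j + 1 = (r + 1) * d + d by omega]
            have h4 := hver' ((r + 1) * d) (by omega)
            rw [hw _ (by omega) (by omega), hw ((r + 1) * d + d) (by omega) (by omega)] at h4
            have h5 := ih1 0 hd0 (by omega)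
            rw [Nat.cast_zero, rowCell_zero, add_zero] at h5
            have h6 : nextCell M (w ((r + 1) * d)).1 (w ((r + 1) * d)).2.1
                (w ((r + 1) * d)).2.2 = some (w ((r + 1) * d + d)).2.1 := by
              simpa [machineVer] using h4
            rw [h5] at h6
            simpa [nextCell] using h6.symm
          · have h4 := ih1 (j + 1) (by omega) (by omega)
            rw [← add_assoc] at h4
            rw [h4]
            push_cast
            rfl
        rw [hleft, hmid, hright] at h2
        exact h2
      refine ⟨fun j hj hjm => ?_, fun hm => ?_⟩
      · obtain ⟨hb1, hb2⟩ := ih2 (by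
          have : (r + 1 + 1) * d = (r + 2) * d := rfl
          omega)
        rcases Nat.eq_zero_or_pos j with rfl | hj0
        · have hmul : (r + 1 + 1) * d = (r + 1) * d + d := by ring
          have hle : d ≤ (r + 1) * d := Nat.le_mul_of_pos_left d (by omega)
          have h4 := hver' ((r + 1) * d) (by omega)
          rw [hw _ (by omega) (by omega), hw ((r + 1) * d + d) (by omega) (by omega)] at h4
          have h5 := ih1 0 hd0 (by omega)
          rw [Nat.cast_zero, rowCell_zero, add_zero] at h5
          have h6 : nextCell M (w ((r + 1) * d)).1 (w ((r + 1) * d)).2.1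
              (w ((r + 1) * d)).2.2 = some (w ((r + 1) * d + d)).2.1 := by
            simpa [machineVer] using h4
          rw [h5] at h6
          rw [Nat.cast_zero, rowCell_zero, add_zero, hmul]
          simpa [nextCell] using h6.symm
        · have h1 := ((nextCell_rowCell hb1 hb2 (by omega) (by omega) (hstep r)).1 _
            (hnext j hj hjm hj0)).1
          rw [headPos_succ, rowCell_of_mem (by omega) (by omega)]
          exact h1
      · have hmul : (r + 1 + 2) * d = (r + 2) * d + d := by ring
        rw [hmul] at hm
        obtain ⟨hb1, hb2⟩ := ih2 (by omega)
        obtain ⟨j, hj⟩ := Int.eq_ofNat_of_zero_le (show 0 ≤ headPos M c e r by omega)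
        have h1 := ((nextCell_rowCell hb1 hb2 (by omega) (by omega) (hstep r)).1 _
            (hnext j (by omega) (by omega) (by omega))).2 hj.symm
        rwa [headPos_succ]
  -- the last tile
  have hm : (m / d - 1 + 1) * d + m % d = m := by
    have : 1 ≤ m / d := Nat.div_pos hdm hd0
    rw [show m / d - 1 + 1 = m / d by omega, mul_comm]
    exact Nat.div_add_mod m d
  have h1 := (key (m / d - 1)).1 (m % d) (Nat.mod_lt _ hd0) hm.le
  rw [hm] at h1
  rw [hw m hdm le_rfl] at hacc
  have h2 : haltsAt M (w m).2.1 = true := hacc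
  rw [h1] at h2
  exact hdom _ (haltsAt_rowCell h2)

end MachineTiles

end PetriGames

/-! ### A halting run gives a tiling -/

namespace PetriGames

open Turing

section RunTiles

variable {Γ Λ : Type} [Inhabited Γ]

/-- The window around position `p` in the row of a configuration. -/
def rowWindow (d : ℤ) (c : TM0.Cfg Γ Λ) (h p : ℤ) : Cell Γ Λ × Cell Γ Λ × Cell Γ Λ :=
  (rowCell d c h (p - 1), rowCell d c h p, rowCell d c h (p + 1))

/-- The tiling for a run of the machine: the configurations follow the first turn. -/
def runTile (k e d : ℕ) (c : ℕ → TM0.Cfg Γ Λ) (h : ℕ → ℤ) (j : ℕ) : MachineTile Γ Λ :=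
  if j < d then toTile (firstTile k e j)
  else Sum.inl (Sum.inl (rowWindow d (c (j / d - 1)) (h (j / d - 1)) (j % d : ℕ)))

theorem runTile_of_lt {k e d j : ℕ} {c : ℕ → TM0.Cfg Γ Λ} {h : ℕ → ℤ} (hj : j < d) :
    runTile k e d c h j = toTile (firstTile k e j) := if_pos hj

theorem runTile_row {k e d p r : ℕ} {c : ℕ → TM0.Cfg Γ Λ} {h : ℕ → ℤ} (hp : p < d) :
    runTile k e d c h ((r + 1) * d + p) = Sum.inl (Sum.inl (rowWindow d (c r) (h r) p)) := by
  have hd : 0 < d := by omega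
  have hle : d ≤ (r + 1) * d := Nat.le_mul_of_pos_left d (by omega)
  have h1 : ((r + 1) * d + p) / d = r + 1 := by
    rw [add_comm, Nat.add_mul_div_right _ _ hd, Nat.div_eq_of_lt hp, zero_add]
  have h2 : ((r + 1) * d + p) % d = p := by
    rw [add_comm, Nat.add_mul_mod_self_right, Nat.mod_eq_of_lt hp]
  rw [runTile, if_neg (by omega), h1, h2, Nat.add_sub_cancel]

/-- A position after the first turn lies in some row. -/
theorem exists_row {d j : ℕ} (hd : 0 < d) (hj : d ≤ j) : ∃ r p, p < d ∧ j = (r + 1) * d + p := by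
  refine ⟨j / d - 1, j % d, Nat.mod_lt _ hd, ?_⟩
  have : 1 ≤ j / d := Nat.div_pos hj hd
  rw [show j / d - 1 + 1 = j / d by omega, mul_comm]
  exact (Nat.div_add_mod j d).symm

end RunTiles

section MachineTiles

variable {Γ Λ : Type} [Inhabited Γ] [Inhabited Λ] [DecidableEq Γ] [DecidableEq Λ]
  [Fintype Γ] [Fintype Λ] {M : TM0.Machine Γ Λ} {g₀ g₁ g₂ : Γ} {k : ℕ}

/-- Lay the successive configurations up to the halting one, with turns so long that the head cannot
reach a border, and stop at the cell of the head in the last row. -/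
theorem solvable_of_eval_dom
    (hdom : (StateTransition.eval (TM0.step M) (inputCfg g₀ g₁ g₂ k)).Dom) :
    (machineTiles M g₀ g₁ g₂ k).Solvable (machineLetters Γ Λ k) := by
  classical
  rw [eval_dom_iff] at hdom
  set c := runFrom (TM0.step M) (inputCfg g₀ g₁ g₂ k) with hc
  obtain ⟨N, hN, hmin⟩ : ∃ N, TM0.step M (c N) = none ∧ ∀ r < N, TM0.step M (c r) ≠ none :=
    ⟨Nat.find hdom, Nat.find_spec hdom, fun r hr => Nat.find_min hdom hr⟩
  have hstep := fun r hr => step_runFrom (hmin r hr)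
  -- In at most `N` steps the head stays between 2 and 2`N` + 2. The even `d` exceeds this and
  -- leaves room for the input and a final blank.
  set e := N + 2 with he
  set d := 2 * (N + k + 5) with hd
  set h := headPos M c e with hh
  have hb : ∀ r : ℕ, (e : ℤ) - r ≤ h r ∧ h r ≤ e + r := headPos_bounds M c e
  have hsucc : ∀ r, h (r + 1) = h r + headMove M (c r) := headPos_succ M c e
  obtain ⟨q, hq⟩ := Int.eq_ofNat_of_zero_le (show 0 ≤ h N by have := hb N; omega)
  have hqd : q < d := by have := hb N; omega
  set x := runTile k e d c h with hx
  have hd0 : 0 < d := by omega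
  have hrow : ∀ r p, p < d → x ((r + 1) * d + p) =
      Sum.inl (Sum.inl (rowWindow d (c r) (h r) p)) := fun r p hp => runTile_row hp
  have hfirst : ∀ j < d, x j = toTile (firstTile k e j) := fun j hj => runTile_of_lt hj
  have hhor : ∀ j, machineHor k (x j) (x (j + 1)) = true := by
    intro j
    rcases Nat.lt_or_ge j d with hj | hj
    · by_cases hj1 : j + 1 < d
      · rw [hfirst j hj, hfirst _ hj1]
        exact machineHor_firstTile (by omega) j
      · rw [hfirst j hj, firstTile_of_gt (by omega),
          show j + 1 = (0 + 1) * d + 0 by omega, hrow 0 0 hd0]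
        simp [toTile, machineHor, rowWindow, rowCell_zero]
    · obtain ⟨r, p, hp, rfl⟩ := exists_row hd0 hj
      rw [hrow r p hp]
      by_cases hp1 : p + 1 < d
      · rw [add_assoc, hrow r _ hp1]
        simp [machineHor, rowWindow]
      · have hpd : ((p : ℤ) + 1) = d := by omega
        rw [show (r + 1) * d + p + 1 = (r + 1 + 1) * d + 0 by
          have : (r + 1 + 1) * d = (r + 1) * d + d := by ring
          omega, hrow (r + 1) 0 hd0]
        simp only [machineHor, rowWindow, hpd, rowCell_self, Nat.cast_zero, rowCell_zero]
        simp
  have hinit : ∀ j, (machineTiles M g₀ g₁ g₂ k).initial (x j) = true ↔ j < d := by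
    intro j
    rcases Nat.lt_or_ge j d with hj | hj
    · rw [hfirst j hj]
      rcases firstTile k e j with i | i <;> simp [machineTiles, toTile, hj]
    · obtain ⟨r, p, hp, rfl⟩ := exists_row hd0 hj
      rw [hrow r p hp]
      simp only [machineTiles, Bool.false_eq_true, false_iff]
      omega
  refine ⟨(N + 1) * d + q, d, x, hd0, ?_, ⟨N + k + 5, by omega⟩, ?_, ?_, fun j _ => hinit j, ?_, ?_,
    ?_⟩
  · have := Nat.le_mul_of_pos_left d (show 0 < N + 1 by omega)
    omega
  · rw [hfirst 0 hd0, firstTile_zero]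
    rfl
  · intro j _
    rw [mem_machineLetters]
    intro i hi
    rcases Nat.lt_or_ge j d with hj | hj
    · rw [hfirst j hj] at hi
      rcases firstTile_cases (k := k) (show 1 ≤ e by omega) j with rfl | ⟨h2, h3⟩ | rfl | rfl |
        ⟨i', hi', rfl⟩ | h
      · simp [firstTile_zero, toTile] at hi
      · simp [firstTile_of_lt h2 h3, toTile] at hi
      · simp [firstTile_self (show 1 ≤ e by omega), toTile] at hi
      · simp [firstTile_add_one, toTile] at hi
      · simp [firstTile_add_two hi', toTile] at hi
        omega
      · simp [firstTile_of_gt h, toTile] at hi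
    · obtain ⟨r, p, hp, rfl⟩ := exists_row hd0 hj
      rw [hrow r p hp] at hi
      simp at hi
  · intro j _
    refine ⟨fun h0 => ?_, hhor j⟩
    rcases Nat.lt_or_ge (j + 1) d with hj | hj
    · rw [hfirst _ hj] at h0
      rcases firstTile_cases (k := k) (show 1 ≤ e by omega) (j + 1) with h1 | ⟨h2, h3⟩ | h1 | h1 |
        ⟨i', hi', h1⟩ | h1
      · omega
      · simp [firstTile_of_lt h2 h3, toTile, machineTiles] at h0
      · simp [h1, firstTile_self (show 1 ≤ e by omega), toTile, machineTiles] at h0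
      · simp [h1, firstTile_add_one, toTile, machineTiles] at h0
      · simp [h1, firstTile_add_two hi', toTile, machineTiles] at h0
      · simp [firstTile_of_gt h1, toTile, machineTiles] at h0
    · have := (hinit (j + 1)).not.2 (by omega)
      rw [h0] at this
      simp [machineTiles] at this
  · intro j hjm
    change machineVer M g₀ g₁ g₂ (x j) (x (j + d)) = true
    rcases Nat.lt_or_ge j d with hj | hj
    · rw [hfirst j hj, show j + d = (0 + 1) * d + j by ring, hrow 0 j hj]
      have h1 : initialCell g₀ g₁ g₂ (firstTile k e j) = rowCell d (c 0) (h 0) j := by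
        rcases Nat.eq_zero_or_pos j with rfl | hj0
        · rw [firstTile_zero]
          exact rowCell_zero.symm
        · rw [initialCell_firstTile g₀ g₁ g₂ k (by omega) hj0, rowCell_of_mem (by omega) (by omega)]
          simp [hh, headPos, hc, runFrom]
      rcases hf : firstTile k e j with i | i <;> rw [hf] at h1 <;>
        simp [toTile, machineVer, rowWindow, h1]
    · obtain ⟨r, p, hp, rfl⟩ := exists_row hd0 hj
      rw [show (r + 1) * d + p + d = (r + 1 + 1) * d + p by ring, hrow r p hp, hrow (r + 1) p hp]
      -- The tile above must not lie beyond the last one, so its row has index at most `N`; hence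
      -- the machine makes a step from row `r`.
      have hr : r < N := by
        by_contra hr
        have h1 : (N + 1) * d ≤ (r + 1) * d := Nat.mul_le_mul_right d (by omega)
        omega
      rcases Nat.eq_zero_or_pos p with rfl | hp0
      · simp [machineVer, rowWindow, rowCell_zero, nextCell]
      · have h1 := hb r
        have h2 := hb (r + 1)
        rw [hsucc] at h2
        push_cast at h2
        have h3 := (nextCell_rowCell (d := d) (p := p) (show 1 ≤ h r by omega) (show h r < d by omega)
          (by omega) (by omega) (hstep r hr)).2
          (show 1 ≤ h r + headMove M (c r) by omega)
          (show h r + headMove M (c r) < d by omega)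
        have h4 : rowCell d (c (r + 1)) (h (r + 1)) p =
            some (cellAt (c (r + 1)) (h r + headMove M (c r)) p) := by
          rw [rowCell_of_mem (by omega) (by omega), hsucc]
        exact decide_eq_true (h3.trans (congrArg some h4.symm))
  · rw [hrow N q hqd]
    change haltsAt M (rowCell d (c N) (h N) q) = true
    have h1 := hb N
    have h0 : rowCell d (c N) (h N) q = some ((c N).Tape.head, some (c N).q) := by
      have hq' : ((q : ℕ) : ℤ) = h N := hq.symm
      rw [hq', rowCell_head (by omega) (by omega)]
    rw [h0]
    have h2 : M (c N).q (c N).Tape.head = none := by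
      simpa [TM0.step] using hN
    simp [haltsAt, h2]

theorem machineTiles_solvable_iff :
    (machineTiles M g₀ g₁ g₂ k).Solvable (machineLetters Γ Λ k) ↔
      (StateTransition.eval (TM0.step M) (inputCfg g₀ g₁ g₂ k)).Dom :=
  ⟨eval_dom_of_solvable, solvable_of_eval_dom⟩

end MachineTiles

end PetriGames

/-! ### A machine with an undecidable halting problem on simple inputs -/

namespace PetriGames

open Turing

theorem primrec_two_pow : Primrec fun k : ℕ => 2 ^ k := by
  refine (Primrec.nat_rec' (f := id) (g := fun _ : ℕ => 1) (h := fun (_ : ℕ) (p : ℕ × ℕ) => p.2 * 2)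
    Primrec.id (Primrec.const 1)
    (Primrec.nat_mul.comp (Primrec.snd.comp Primrec.snd) (Primrec.const 2)).to₂).of_eq fun k => ?_
  induction k with
  | zero => rfl
  | succ k ih => rw [pow_succ, ← ih]; rfl

/-- The exponents can be recovered from the powers of two. -/
theorem exists_primrec_log : ∃ g : ℕ → ℕ, Primrec g ∧ ∀ k, g (2 ^ (k + 1)) = k := by
  refine ⟨fun n => Nat.findGreatest (fun k => 2 ^ (k + 1) = n) n,
    Primrec.nat_findGreatest Primrec.id (p := fun n k => 2 ^ (k + 1) = n) ?_, fun k => ?_⟩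
  · exact Primrec.eq.comp (primrec_two_pow.comp (Primrec.succ.comp Primrec.snd)) Primrec.fst
  · have h := Nat.findGreatest_spec (P := fun j => 2 ^ (j + 1) = 2 ^ (k + 1)) (m := k)
      (n := 2 ^ (k + 1)) ((Nat.lt_two_pow_self).le.trans (Nat.pow_le_pow_right two_pos k.le_succ)) rfl
    exact Nat.succ_injective (Nat.pow_right_injective le_rfl h)

/-- There is a code that does not halt decidably on the powers of two. -/
theorem exists_code_two_pow : ∃ c : ToPartrec.Code,
    ¬ ComputablePred fun k : ℕ => (c.eval [2 ^ (k + 1)]).Dom := by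
  obtain ⟨g, hg, hgk⟩ := exists_primrec_log
  let f : ℕ →. ℕ := fun n => (Denumerable.ofNat Nat.Partrec.Code (g n)).eval 0
  have hf : Partrec f :=
    Nat.Partrec.Code.eval_part.comp ((Computable.ofNat _).comp hg.to_comp) (Computable.const 0)
  obtain ⟨c, hc⟩ := ToPartrec.Code.exists_code (Nat.Partrec'.part_iff₁.2 hf)
  refine ⟨c, fun h => ComputablePred.halting_problem 0 ?_⟩
  have hdom : ∀ k : ℕ, (c.eval [2 ^ (k + 1)]).Dom ↔
      ((Denumerable.ofNat Nat.Partrec.Code k).eval 0).Dom := by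
    intro k
    rw [show [2 ^ (k + 1)] = ((2 ^ (k + 1) ::ᵥ List.Vector.nil : List.Vector ℕ 1)).1 from rfl, hc]
    change ((Denumerable.ofNat Nat.Partrec.Code (g (2 ^ (k + 1)))).eval 0).Dom ↔ _
    rw [hgk]
  obtain ⟨D, hD⟩ := h
  refine ⟨fun a => Classical.dec _, (hD.comp Computable.encode).of_eq fun a => ?_⟩
  rw [decide_eq_decide]
  change (c.eval [2 ^ (Encodable.encode a + 1)]).Dom ↔ (a.eval 0).Dom
  rw [hdom, Denumerable.ofNat_encode]

open PartrecToTM2 in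
-- Binary numbers are written with the lowest digit first. Powers of two are chosen as inputs
-- because their codes repeat one symbol apart from a fixed ending.
theorem trList_two_pow (k : ℕ) :
    trList [2 ^ k] = List.replicate k Γ'.bit0 ++ [Γ'.bit1, Γ'.cons] := by
  have h : ∀ k, ∃ p : PosNum, ((p : PosNum) : ℕ) = 2 ^ k ∧
      trPosNum p = List.replicate k Γ'.bit0 ++ [Γ'.bit1] := by
    intro k
    induction k with
    | zero => exact ⟨PosNum.one, rfl, rfl⟩
    | succ k ih =>
      obtain ⟨p, h1, h2⟩ := ih
      refine ⟨p.bit0, ?_, ?_⟩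
      · rw [PosNum.cast_bit0, h1, pow_succ, mul_two]
      · rw [trPosNum, h2]; rfl
  obtain ⟨p, h1, h2⟩ := h k
  have h3 : ((2 ^ k : ℕ) : Num) = Num.pos p := by
    rw [← h1]
    exact Num.of_to_nat (Num.pos p)
  simp only [trList, trNat, h3, trNum, h2]
  simp

/-- The simulation of stacks on a tape stores the input reversed and marks the bottom cell. The
fixed ending thus becomes the first two cells `g₀`, `g₁`, and the repeated symbol becomes `g₂`. -/
theorem trInit_of_reverse {K : Type} [DecidableEq K] {Γ : K → Type} {k : K} {L : List (Γ k)}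
    {a b x : Γ k} {n : ℕ} (h : L.reverse = a :: b :: List.replicate n x) :
    TM2to1.trInit k L = (true, Function.update (fun _ => none) k (some a)) ::
      (false, Function.update (fun _ => none) k (some b)) ::
      List.replicate n (false, Function.update (fun _ => none) k (some x)) := by
  rw [TM2to1.trInit, h]
  exact congrArg (fun l : List (TM2to1.Γ' K Γ) =>
    (true, Function.update (fun _ => none) k (some a)) ::
      (false, Function.update (fun _ => none) k (some b)) :: l) List.map_replicate

instance : Fintype PartrecToTM2.K' :=
  ⟨{.main, .rev, .aux, .stack}, by rintro (_ | _ | _ | _) <;> simp⟩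

/-- A machine with a finite set of states that is equivalent to a finitely supported one. -/
theorem exists_finite_machine {Γ Λ : Type} [Inhabited Γ] [Inhabited Λ] (M : TM0.Machine Γ Λ)
    {S : Finset Λ} (hS : TM0.Supports M (S : Set Λ)) :
    ∃ (Λ' : Type) (_ : Inhabited Λ') (_ : Fintype Λ') (M' : TM0.Machine Γ Λ'), ∀ l : List Γ,
      (StateTransition.eval (TM0.step M') (TM0.init l)).Dom ↔
        (StateTransition.eval (TM0.step M) (TM0.init l)).Dom := by
  classical
  let _ : Inhabited S := ⟨⟨default, hS.1⟩⟩
  let g : PointedMap Λ S := ⟨fun q => if h : q ∈ S then ⟨q, h⟩ else default, dif_pos hS.1⟩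
  let i : PointedMap Γ Γ := ⟨id, rfl⟩
  refine ⟨S, inferInstance, inferInstance, M.map i i g.f Subtype.val, fun l => ?_⟩
  refine StateTransition.tr_eval_dom (M.map_respects i i g Subtype.val hS (fun _ => rfl)
    fun q hq => ?_) ⟨hS.1, ?_⟩
  · change ((if h : q ∈ S then ⟨q, h⟩ else default : S) : Λ) = q
    rw [dif_pos (Finset.mem_coe.1 hq)]
  · rw [TM0.map_init]
    change TM0.init (l.map id) = _
    rw [List.map_id]

/-- There is a Turing machine whose halting problem is undecidable for inputs that consist of two
fixed symbols and a number of copies of a third one. -/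
theorem exists_machine : ∃ (Γ Λ : Type) (_ : Inhabited Γ) (_ : Inhabited Λ) (_ : Fintype Γ)
    (_ : Fintype Λ) (M : TM0.Machine Γ Λ) (g₀ g₁ g₂ : Γ),
    ¬ ComputablePred fun k => (StateTransition.eval (TM0.step M) (inputCfg g₀ g₁ g₂ k)).Dom := by
  classical
  obtain ⟨c, hc⟩ := exists_code_two_pow
  let _ : Inhabited PartrecToTM2.Λ' := ⟨PartrecToTM2.trNormal c PartrecToTM2.Cont'.halt⟩
  have h1 := TM2to1.tr_supports PartrecToTM2.tr
    (PartrecToTM2.tr_supports c PartrecToTM2.Cont'.halt)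
  have h2 := TM1to0.tr_supports _ h1
  obtain ⟨Λ', i1, i2, M, hM⟩ := exists_finite_machine _ h2
  let u (x : PartrecToTM2.Γ') : ∀ _ : PartrecToTM2.K', Option PartrecToTM2.Γ' :=
    Function.update (fun _ => none) .main (some x)
  refine ⟨_, Λ', inferInstance, i1, inferInstance, i2, M, (true, u .cons), (false, u .bit1),
    (false, u .bit0), fun h => hc ?_⟩
  obtain ⟨D, hD⟩ := h
  refine ⟨fun a => Classical.dec _, hD.of_eq fun k => ?_⟩
  rw [decide_eq_decide]
  have e1 : (inputCfg (true, u .cons) (false, u .bit1) (false, u .bit0) k : TM0.Cfg _ Λ') =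
      TM0.init (TM2to1.trInit .main (PartrecToTM2.trList [2 ^ (k + 1)])) := by
    rw [trList_two_pow]
    refine congrArg TM0.init (Eq.symm (trInit_of_reverse (n := k + 1) ?_))
    simp
  have e2 : PartrecToTM2.init c [2 ^ (k + 1)] =
      TM2.init .main (PartrecToTM2.trList [2 ^ (k + 1)]) := by
    rw [PartrecToTM2.init, TM2.init]
    congr 1
    funext x
    cases x <;> rfl
  refine (Iff.of_eq (congrArg (fun c => (StateTransition.eval (TM0.step M) c).Dom) e1)).trans
    ((hM _).trans ?_)
  have e3 := congrArg Part.Dom (TM1to0.tr_eval (TM2to1.tr PartrecToTM2.tr)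
    (TM2to1.trInit .main (PartrecToTM2.trList [2 ^ (k + 1)])))
  have e4 := TM2to1.tr_eval_dom PartrecToTM2.tr .main (PartrecToTM2.trList [2 ^ (k + 1)])
  have e5 := congrArg Part.Dom (PartrecToTM2.tr_eval c [2 ^ (k + 1)])
  rw [e2] at e5
  exact (Iff.of_eq e3).trans (e4.trans (Iff.of_eq e5))

end PetriGames

/-! ### The reduction -/

namespace PetriGames

open Turing Primrec

section MachineTiles

variable {Γ Λ : Type} [Primcodable Γ] [Primcodable Λ]

/-- A criterion for relations between tiles, given by cases on the two tiles. -/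
theorem primrec_tile_cases {f : ℕ → MachineTile Γ Λ → MachineTile Γ Λ → Bool}
    (h1 : Primrec fun x : (ℕ × ((Cell Γ Λ × Cell Γ Λ × Cell Γ Λ) ⊕ Fin 5)) ×
      ((Cell Γ Λ × Cell Γ Λ × Cell Γ Λ) ⊕ Fin 5) => f x.1.1 (Sum.inl x.1.2) (Sum.inl x.2))
    (h2 : Primrec fun x : (ℕ × ((Cell Γ Λ × Cell Γ Λ × Cell Γ Λ) ⊕ Fin 5)) × ℕ =>
      f x.1.1 (Sum.inl x.1.2) (Sum.inr x.2))
    (h3 : Primrec fun x : (ℕ × ℕ) × ((Cell Γ Λ × Cell Γ Λ × Cell Γ Λ) ⊕ Fin 5) =>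
      f x.1.1 (Sum.inr x.1.2) (Sum.inl x.2))
    (h4 : Primrec fun x : (ℕ × ℕ) × ℕ => f x.1.1 (Sum.inr x.1.2) (Sum.inr x.2)) :
    Primrec fun x : ℕ × MachineTile Γ Λ × MachineTile Γ Λ => f x.1 x.2.1 x.2.2 := by
  have e1 : Primrec fun x : (ℕ × MachineTile Γ Λ) × ((Cell Γ Λ × Cell Γ Λ × Cell Γ Λ) ⊕ Fin 5) =>
      f x.1.1 x.1.2 (Sum.inl x.2) := by
    refine Primrec.comp (f := fun x : (ℕ × ((Cell Γ Λ × Cell Γ Λ × Cell Γ Λ) ⊕ Fin 5)) ×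
      MachineTile Γ Λ => f x.1.1 x.2 (Sum.inl x.1.2)) ?_ (((fst.comp fst).pair snd).pair
        (snd.comp fst))
    refine primrec_sum_cases (f := fun (x : ℕ × ((Cell Γ Λ × Cell Γ Λ × Cell Γ Λ) ⊕ Fin 5))
      (y : MachineTile Γ Λ) => f x.1 y (Sum.inl x.2)) ?_ ?_
    · exact h1.comp (((fst.comp fst).pair snd).pair (snd.comp fst))
    · exact h3.comp (((fst.comp fst).pair snd).pair (snd.comp fst))
  have e2 : Primrec fun x : (ℕ × MachineTile Γ Λ) × ℕ => f x.1.1 x.1.2 (Sum.inr x.2) := by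
    refine Primrec.comp (f := fun x : (ℕ × ℕ) × MachineTile Γ Λ => f x.1.1 x.2 (Sum.inr x.1.2)) ?_
      (((fst.comp fst).pair snd).pair (snd.comp fst))
    refine primrec_sum_cases (f := fun (x : ℕ × ℕ) (y : MachineTile Γ Λ) =>
      f x.1 y (Sum.inr x.2)) ?_ ?_
    · exact h2.comp (((fst.comp fst).pair snd).pair (snd.comp fst))
    · exact h4.comp (((fst.comp fst).pair snd).pair (snd.comp fst))
  exact (primrec_sum_cases (f := fun (x : ℕ × MachineTile Γ Λ) (y : MachineTile Γ Λ) =>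
    f x.1 x.2 y) e1 e2).comp ((fst.pair (fst.comp snd)).pair (snd.comp snd))

theorem primrec_machineLetters [Fintype Γ] [Fintype Λ] : Primrec fun k => machineLetters Γ Λ k :=
  list_append.comp (const _)
    (list_map (list_range.comp Primrec.succ) (sumInr.comp snd).to₂)

variable [Inhabited Γ] [Inhabited Λ] [DecidableEq Γ] [DecidableEq Λ] [Fintype Γ] [Fintype Λ]
  {M : TM0.Machine Γ Λ} {g₀ g₁ g₂ : Γ}

theorem isPrimrec_machineTiles :
    TileSystem.IsPrimrec fun k => machineTiles M g₀ g₁ g₂ k where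
  start := const _
  initial := primrec_sum_cases (f := fun (k : ℕ) t => (machineTiles M g₀ g₁ g₂ k).initial t)
    ((dom_finite fun x : (Cell Γ Λ × Cell Γ Λ × Cell Γ Λ) ⊕ Fin 5 =>
      (machineTiles M g₀ g₁ g₂ 0).initial (Sum.inl x)).comp snd) (const true)
  accept := primrec_sum_cases (f := fun (k : ℕ) t => (machineTiles M g₀ g₁ g₂ k).accept t)
    ((dom_finite fun x : (Cell Γ Λ × Cell Γ Λ × Cell Γ Λ) ⊕ Fin 5 =>
      (machineTiles M g₀ g₁ g₂ 0).accept (Sum.inl x)).comp snd) (const false)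
  hor := by
    refine primrec_tile_cases (f := fun k x y => machineHor k x y) ?_ ?_ ?_ ?_
    · exact ((dom_finite fun x : ((Cell Γ Λ × Cell Γ Λ × Cell Γ Λ) ⊕ Fin 5) ×
        ((Cell Γ Λ × Cell Γ Λ × Cell Γ Λ) ⊕ Fin 5) =>
          machineHor 0 (Sum.inl x.1) (Sum.inl x.2)).comp ((snd.comp fst).pair snd)).of_eq
        fun ⟨⟨k, x⟩, y⟩ => by rcases x with x | x <;> rcases y with y | y <;> rfl
    · exact (primrec_and ((dom_finite fun x : (Cell Γ Λ × Cell Γ Λ × Cell Γ Λ) ⊕ Fin 5 =>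
        decide (x = Sum.inr 3)).comp (snd.comp fst))
        (primrec_decide_eq snd (const 0))).of_eq
        fun ⟨⟨k, x⟩, y⟩ => by rcases x with x | x <;> rfl
    · exact (primrec_and (primrec_decide_eq (snd.comp fst) (fst.comp fst))
        ((dom_finite fun y : (Cell Γ Λ × Cell Γ Λ × Cell Γ Λ) ⊕ Fin 5 =>
          decide (y = Sum.inr 4)).comp snd)).of_eq
        fun ⟨⟨k, x⟩, y⟩ => by rcases y with y | y <;> rfl
    · exact primrec_decide_eq snd (Primrec.succ.comp (snd.comp fst))
  ver := by
    refine primrec_tile_cases (f := fun k x y => machineVer M g₀ g₁ g₂ x y) ?_ ?_ ?_ ?_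
    · exact (dom_finite fun x : ((Cell Γ Λ × Cell Γ Λ × Cell Γ Λ) ⊕ Fin 5) ×
        ((Cell Γ Λ × Cell Γ Λ × Cell Γ Λ) ⊕ Fin 5) =>
          machineVer M g₀ g₁ g₂ (Sum.inl x.1) (Sum.inl x.2)).comp ((snd.comp fst).pair snd)
    · exact (const false).of_eq fun ⟨⟨k, x⟩, y⟩ => by rcases x with x | x <;> rfl
    · exact ((dom_finite fun y : (Cell Γ Λ × Cell Γ Λ × Cell Γ Λ) ⊕ Fin 5 =>
        machineVer M g₀ g₁ g₂ (Sum.inr 0) (Sum.inl y)).comp snd).of_eq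
        fun ⟨⟨k, x⟩, y⟩ => by rcases y with y | y <;> rfl
    · exact const false

end MachineTiles

/-- If the existence of winning strategies were decidable, then so would be the solvability of
tile systems. -/
theorem computablePred_solvable {L : Type} [Primcodable L] [DecidableEq L] {r : ℕ}
    (hdec : DecidableOn (fun c : GameCode => IsAlternatingGame c.toGame (r + 3))
      (fun c : GameCode => HasWinningStrategy c.toGame))
    {S : ℕ → TileSystem L} {letters : ℕ → List L} (hS : TileSystem.IsPrimrec S)
    (hl : Primrec letters) (hn : ∀ k, (letters k).Nodup) (hst : ∀ k, (S k).start ∈ letters k)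
    (hin : ∀ k, (S k).initial (S k).start = true)
    (hacc : ∀ k, ∃ σ ∈ letters k, (S k).accept σ = true ∧ (S k).initial σ = false) :
    ComputablePred fun k => (S k).Solvable (letters k) := by
  classical
  obtain ⟨f, hf, hfQ⟩ := hdec
  have hcode := (primrec_tileCode (r := r) hl hS).to_comp
  have hiff : ∀ k, HasWinningStrategy (tileCode r (letters k) (S k)).toGame ↔
      (S k).Solvable (letters k) := by
    intro k
    obtain ⟨src, dst, s₀, hG⟩ := isTileGame_tileCode (r := r) (hn k) (hst k)
    exact ⟨hG.solvable (hin k), hG.hasWinningStrategy⟩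
  refine ⟨fun k => Classical.dec _, Partrec.of_eq_tot (hf.comp hcode) fun k => ?_⟩
  obtain ⟨src, dst, s₀, hG⟩ := isTileGame_tileCode (r := r) (hn k) (hst k)
  obtain ⟨h1, h2⟩ := hfQ (tileCode r (letters k) (S k)) (hG.isAlternatingGame (hst k) (hacc k))
  by_cases h : (S k).Solvable (letters k)
  · rw [decide_eq_true h]
    exact h1 ((hiff k).2 h)
  · rw [decide_eq_false h]
    exact h2 (mt (hiff k).1 h)

end PetriGames

open PetriGames Turing in
theorem theorem3 (n : ℕ) (hn : 3 ≤ n) :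
    ¬ PetriGames.DecidableOn
      (fun c : PetriGames.GameCode => PetriGames.IsAlternatingGame c.toGame n)
      (fun c : PetriGames.GameCode => PetriGames.HasWinningStrategy c.toGame) := by
  classical
  intro hdec
  obtain ⟨r, rfl⟩ : ∃ r, n = r + 3 := ⟨n - 3, by omega⟩
  obtain ⟨Γ, Λ, _, _, _, _, M, g₀, g₁, g₂, hM⟩ := exists_machine
  let _ : Primcodable Γ := Primcodable.ofEquiv _ (Fintype.equivFin Γ)
  let _ : Primcodable Λ := Primcodable.ofEquiv _ (Fintype.equivFin Λ)
  -- A machine without halting pairs never halts, which would be decidable. The halting pair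
  -- supplies an accepting tile, as needed for the reachability of the good markings.
  obtain ⟨q, s, hqs⟩ : ∃ q s, M q s = none := by
    by_contra hcon
    push Not at hcon
    refine hM ⟨fun _ => Classical.dec _, (Computable.const false).of_eq fun k => ?_⟩
    refine (decide_eq_false fun h => ?_).symm
    obtain ⟨r, hr⟩ := (eval_dom_iff _ _).1 h
    exact hcon _ _ (Option.map_eq_none_iff.1 hr)
  refine hM ?_
  have h := computablePred_solvable hdec (isPrimrec_machineTiles (M := M) (g₀ := g₀) (g₁ := g₁)
    (g₂ := g₂)) primrec_machineLetters nodup_machineLetters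
    (fun k => mem_machineLetters.2 (by rintro i ⟨⟩)) (fun k => rfl)
    (fun k => ⟨Sum.inl (Sum.inl (none, some (s, some q), none)),
      mem_machineLetters.2 (by rintro i ⟨⟩), by simp [machineTiles, haltsAt, hqs], rfl⟩)
  obtain ⟨D, hD⟩ := h
  exact ⟨fun _ => Classical.dec _, hD.of_eq fun k => by
    rw [decide_eq_decide]; exact machineTiles_solvable_iff⟩
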